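/- **Setting.** Let $c_0,c_1,z_{int}>0$ and $\mathbf k_0\in\mathbb R^2$ with $|\mathbf k_0|<c_0^{-1}$ and $|\mathbf k_0|<c_1^{-1}$ (the second condition is automatic if $c_1<c_0$). For $j=0,1$ put $$\mathsf s_j=\frac{\sqrt{1-c_j^2|\mathbf k_0|^2}}{c_j},\qquad \mathcal R=\frac{\mathsf s_0-\mathsf s_1}{\mathsf s_0+\mathsf s_1},\qquad A_0=\frac{1}{c_0^3\mathsf s_0^3}\big(\mathbf I_2-c_0^2\,\mathbf k_0^\perp\otimes\mathbf k_0^\perp\big),\qquad \mathbf k_0^\perp=(-\mathbf k_{0,2},\mathbf k_{0,1})^T,$$ $$\mathbf x_{int}=\frac{z_{int}\mathbf k_0}{\mathsf s_0},\qquad \mathbf x_{obs}=2\,\mathbf x_{int},\qquad t_{obs}=\frac{2z_{int}}{c_0^2\mathsf s_0},\qquad \hat{\mathcal U}_0(\omega,\mathbf q)=e^{-i\omega z_{int}c_0\mathbf q^TA_0\mathbf q/2}.$$ Let $V$ be a stationary random field on $\mathbb R^2$ with continuous sample paths. Let $\Psi:\mathbb R\times\mathbb R^2\to\mathbb R$ be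 an integrable source profile such that $\hat\Psi(\omega,\mathbf k)=\iint\Psi(t,\mathbf x)e^{i\omega(t-\mathbf k\cdot\mathbf x)}\,dt\,d\mathbf x$ vanishes outside a set $\{a\le|\omega|\le b,\ |\mathbf k|\le\kappa\}$ with $a>0$. For $\varepsilon>0$ and $\gamma\in(1/2,1]$, the (leading-order) wave reflected by the interface $z=z_{int}+\varepsilon V(\mathbf x/\varepsilon^\gamma)$ and observed in the plane $z=0$ is $$u^{\varepsilon,ref}(t,\mathbf x)=\frac{\mathcal R}{2(2\pi)^3}\iiint e^{-i\omega(t-2\mathsf s_0z_{int}-\mathbf x\cdot\mathbf k_0)/\varepsilon}e^{i\omega\mathbf q\cdot(\mathbf x-\mathbf x_{obs})/\sqrt\varepsilon}K^\varepsilon(2\mathsf s_0,\omega,\mathbf q,\mathbf q')\,\hat{\mathcal U}_0(\omega,\mathbf q)\hat{\mathcal U}_0(\omega,\mathbf q')\hat\Psi(\omega,\mathbf q')\,\omega^2\,d\mathbf q'\,d\mathbf q\,d\omega ,$$ $$K^\varepsilon(\tau,\omega,\mathbf q,\mathbf q')=\frac{\omega^2}{\varepsilon(2\pi)^2}\int e^{i\omega(\mathbf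 q'-\mathbf q)\cdot(\mathbf x'-\mathbf x_{int})/\sqrt\varepsilon}e^{i\omega\tau V(\mathbf x'/\varepsilon^\gamma)}\,d\mathbf x' .$$ Here $K^\varepsilon$ is understood as an operator acting on functions of $\mathbf q'$ (integrate in $\mathbf q'$ first, then in $\mathbf x'$), and the integral in $\mathbf q$ is an oscillatory integral, $\int f(\mathbf q)\,d\mathbf q:=\lim_{\delta\downarrow0}\int e^{-\delta|\mathbf q|^2}f(\mathbf q)\,d\mathbf q$. The speckle profile is $$S^{\varepsilon,ref}(\bar s,\bar{\mathbf y},\mathbf y,\widetilde s,\widetilde{\mathbf y})=\varepsilon^{1-2\gamma}u^{\varepsilon,ref}\big(t_{obs}+\varepsilon^{1-\gamma}\mathbf k_0\cdot\bar{\mathbf y}+\sqrt\varepsilon\,\mathbf k_0\cdot\mathbf y+\varepsilon^\gamma\mathbf k_0\cdot\widetilde{\mathbf y}+\varepsilon^{2(1-\gamma)}\bar s+\varepsilon\widetilde s,\ \mathbf x_{obs}+\varepsilon^{1-\gamma}\bar{\mathbf y}+\sqrt\varepsilon\,\mathbf y+\varepsilon^\gamma\widetilde{\mathbf y}\big),$$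 and $\mathcal C^{\varepsilon,ref}(\bar s,\bar{\mathbf y},\mathbf y,\widetilde s_1,\widetilde{\mathbf y}_1,\widetilde s_2,\widetilde{\mathbf y}_2)=S^{\varepsilon,ref}(\bar s,\bar{\mathbf y},\mathbf y,\widetilde s_1,\widetilde{\mathbf y}_1)\,S^{\varepsilon,ref}(\bar s,\bar{\mathbf y},\mathbf y,\widetilde s_2,\widetilde{\mathbf y}_2)$. **Statement.** Let $\gamma\in(1/2,1]$. The integrals that define $u^{\varepsilon,ref}$ converge, $\mathcal C^{\varepsilon,ref}$ is integrable at every point, its mean defines a tempered distribution, and, as $\varepsilon\to0^+$, $$\mathbb E\big[\mathcal C^{\varepsilon,ref}(\bar s,\bar{\mathbf y},\mathbf y,\widetilde s_1,\widetilde{\mathbf y}_1,\widetilde s_2,\widetilde{\mathbf y}_2)\big]\longrightarrow\mathbf C^{ref}(\bar s,\bar{\mathbf y},\widetilde s_1-\widetilde s_2,\widetilde{\mathbf y}_1-\widetilde{\mathbf y}_2)\qquad\text{in }\mathcal S'\big((\mathbb R\times\mathbb R^2\times\mathbb R^2)\times(\mathbb R\times\mathbb R^2)\times(\mathbb R\times\mathbb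 R^2)\big),$$ tested against all Schwartz functions (in particular against those supported away from the specular point $\bar{\mathbf y}=0$), where $$\mathbf C^{ref}(\bar s,\bar{\mathbf y},\widetilde s,\widetilde{\mathbf y})=\frac{\mathcal R^2}{4(2\pi)^3}\iint e^{-i\omega(\widetilde s-\mathbf p\cdot\widetilde{\mathbf y})}\mathcal A(2\mathsf s_0,\omega,\mathbf p)\,|\hat\Psi|_2^2(\omega)\,\delta\big(\bar s-z_{int}c_0\mathbf p^TA_0\mathbf p/2\big)\,\delta\big(\bar{\mathbf y}-z_{int}c_0A_0\mathbf p\big)\,\omega^2\,d\omega\,d\mathbf p ,$$ $$\mathcal A(v,\omega,\mathbf p)=\int\mathbb E\big[e^{i\omega v(V(\mathbf y')-V(0))}\big]e^{-i\omega\mathbf p\cdot\mathbf y'}\,d\mathbf y'\quad\text{(as a tempered distribution in }\mathbf p),$$ $$|\hat\Psi|_2^2(\omega)=\frac{\omega^2}{(2\pi)^2}\int|\hat\Psi(\omega,\mathbf q)|^2\,d\mathbf q=\int\Big|\int e^{i\omega s}\Psi(s,\mathbf x)\,ds\Big|^2d\mathbf x .$$ The limit vanishes on every test function that vanishes at all points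 with $(\bar s,\bar{\mathbf y})=(s_{\mathbf p},\mathbf y_{\mathbf p})$, $\mathbf p\in\mathbb R^2$, where $\mathbf y_{\mathbf p}=z_{int}c_0A_0\mathbf p$ and $s_{\mathbf p}=z_{int}c_0\mathbf p^TA_0\mathbf p/2$. Generalized Snell law of reflection: let $\theta_{inc}=\arctan(|\mathbf k_0|/\mathsf s_0)$, and let $\theta^\varepsilon_{ref}(\mathbf p)=\arctan\big(|\mathbf x_{obs}+\varepsilon^{1-\gamma}\mathbf y_{\mathbf p}-\mathbf x_{int}|/z_{int}\big)$ be the reflection angle of the speckle observed at the offset $\mathbf y_{\mathbf p}$. Then $\sin\theta_{inc}=c_0|\mathbf k_0|$ and, for all $\varepsilon>0$ and $\mathbf p\in\mathbb R^2$: if $\mathbf k_0\ne0$, then $$\frac{\tan\theta^\varepsilon_{ref}(\mathbf p)}{\tan\theta_{inc}}=\sqrt{\Xi},\qquad \frac{\sin\theta^\varepsilon_{ref}(\mathbf p)}{c_0}=\frac{\sin\theta_{inc}}{c_0}+|\mathbf k_0|\left(\sqrt{\frac{\Xi}{1+\sin^2(\theta_{inc})(\Xi-1)}}-1\right),$$ $$\Xi=\Big(1+\xi\frac{\mathbf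 p\cdot\mathbf k_0}{\cos^2\theta_{inc}}\Big)^2+\xi^2(\mathbf p\cdot\mathbf k_0^\perp)^2,\qquad \xi=\varepsilon^{1-\gamma}\frac{c_0^2}{\sin^2\theta_{inc}};$$ if $\mathbf k_0=0$, then $\theta^\varepsilon_{ref}(\mathbf p)=\arctan(\varepsilon^{1-\gamma}c_0|\mathbf p|)$. -/

import Mathlib

open MeasureTheory Filter Topology SchwartzMap

noncomputable section

namespace Speckle

/-- The transverse plane `ℝ²`, with its Euclidean norm and Lebesgue measure. -/
abbrev Plane : Type := EuclideanSpace ℝ (Fin 2)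

/-- The space `X = ℝ × ℝ²` of the variables `(s, y)`. -/
abbrev SpaceX : Type := ℝ × Plane

/-- The space `𝕏 = ℝ × ℝ² × ℝ²` of the variables `(s̄, ȳ, y)`. -/
abbrev SpaceXX : Type := ℝ × Plane × Plane

/-- `phase θ = e^{iθ}`. -/
def phase (θ : ℝ) : ℂ := Complex.exp ((θ : ℂ) * Complex.I)

/-- The oscillatory integral `∫ f(q) dq` over the plane, as the limit `δ → 0⁺` of the
Gaussian-regularised integrals `∫ e^{-δ|q|²} f(q) dq`. -/
def oscillatoryIntegral (f : Plane → ℂ) : ℂ :=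
  limUnder (𝓝[>] (0 : ℝ)) fun δ : ℝ => ∫ q, (Real.exp (-δ * ‖q‖ ^ 2) : ℂ) * f q

/-- The Fourier transform `Ψ̂(ω, k) = ∬ Ψ(t, x) e^{iω(t - k·x)} dt dx` of the source profile. -/
def profileHat (Ψ : SpaceX → ℝ) (ω : ℝ) (k : Plane) : ℂ :=
  ∫ a : SpaceX, (Ψ a : ℂ) * phase (ω * (a.1 - inner ℝ k a.2))

/-- `|Ψ̂|₂²(ω) = ω² / (2π)² ∫ |Ψ̂(ω, q)|² dq`. -/
def profilePower (Ψ : SpaceX → ℝ) (ω : ℝ) : ℝ :=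
  ω ^ 2 / (2 * Real.pi) ^ 2 * ∫ q, ‖profileHat Ψ ω q‖ ^ 2

/-- The deterministic parameters: the wave speeds above and below the interface, the distance from
the source plane to the mean interface, and the transverse slowness vector of the source. -/
structure Medium where
  c₀ : ℝ
  c₁ : ℝ
  zint : ℝ
  k₀ : Plane
  c₀_pos : 0 < c₀
  c₁_pos : 0 < c₁
  zint_pos : 0 < zint
  k₀_lt₀ : ‖k₀‖ < c₀⁻¹
  k₀_lt₁ : ‖k₀‖ < c₁⁻¹

namespace Medium

variable (M : Medium)

/-- The vertical slowness `√(1 - c₀²|k₀|²) / c₀` above the interface. -/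
def s₀ : ℝ := Real.sqrt (1 - M.c₀ ^ 2 * ‖M.k₀‖ ^ 2) / M.c₀

/-- The vertical slowness `√(1 - c₁²|k₀|²) / c₁` below the interface. -/
def s₁ : ℝ := Real.sqrt (1 - M.c₁ ^ 2 * ‖M.k₀‖ ^ 2) / M.c₁

/-- The reflection coefficient of the flat interface. -/
def reflCoeff : ℝ := (M.s₀ - M.s₁) / (M.s₀ + M.s₁)

/-- The symmetric matrix `A₀` of the second-order expansion of the vertical slowness. -/
def A₀ : Matrix (Fin 2) (Fin 2) ℝ :=
  (1 / (1 - M.c₀ ^ 2 * ‖M.k₀‖ ^ 2) ^ (3 / 2 : ℝ)) •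
    !![1 - M.c₀ ^ 2 * M.k₀ 1 ^ 2, M.c₀ ^ 2 * M.k₀ 0 * M.k₀ 1;
      M.c₀ ^ 2 * M.k₀ 0 * M.k₀ 1, 1 - M.c₀ ^ 2 * M.k₀ 0 ^ 2]

/-- The vector `A₀ p`. -/
def applyA₀ (p : Plane) : Plane := Matrix.toEuclideanLin M.A₀ p

/-- The point where the incident pulse hits the mean interface. -/
def xInt : Plane := (M.zint / M.s₀) • M.k₀

/-- The point of the plane `z = 0` where the specular reflection is observed. -/
def xObs : Plane := (2 * M.zint / M.s₀) • M.k₀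

/-- The travel time of the specular reflection. -/
def tObs : ℝ := 2 * M.zint / (M.c₀ ^ 2 * M.s₀)

/-- The paraxial propagator `Û₀(ω, q, z) = exp(-iω z c₀ qᵀA₀q / 2)`. -/
def propagator (ω : ℝ) (q : Plane) (z : ℝ) : ℂ :=
  phase (-(ω * z * M.c₀ * inner ℝ q (M.applyA₀ q) / 2))

/-- The scattering operator of the interface with fluctuations `f`, applied to a function `ψ` of
`q'`. Its kernel is `K(τ, ω, q, q') =
ω² / (ε (2π)²) ∫ e^{iω(q' - q)·(x' - x_int)/√ε} e^{iωτ f(x'/ε^γ)} dx'`. -/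
def scatteringOperator (ε γ : ℝ) (f : Plane → ℝ) (τ ω : ℝ) (ψ : Plane → ℂ) (q : Plane) : ℂ :=
  (ω ^ 2 / (ε * (2 * Real.pi) ^ 2) : ℝ) *
    ∫ x' : Plane, phase (-(ω * inner ℝ q (x' - M.xInt) / Real.sqrt ε)) *
      phase (ω * τ * f ((ε ^ γ)⁻¹ • x')) *
        ∫ q' : Plane, phase (ω * inner ℝ q' (x' - M.xInt) / Real.sqrt ε) * ψ q'

/-- The integrand in `q` of the reflected field at frequency `ω` and position `x`. -/
def reflIntegrand (Ψ : SpaceX → ℝ) (ε γ : ℝ) (f : Plane → ℝ) (x : Plane) (ω : ℝ) (q : Plane) : ℂ :=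
  phase (ω * inner ℝ q (x - M.xObs) / Real.sqrt ε) * M.propagator ω q M.zint *
    M.scatteringOperator ε γ f (2 * M.s₀) ω
      (fun q' => M.propagator ω q' M.zint * profileHat Ψ ω q') q

/-- The integrand in `ω` of the reflected field at time `t` and position `x`. -/
def reflFreqIntegrand (Ψ : SpaceX → ℝ) (ε γ : ℝ) (f : Plane → ℝ) (t : ℝ) (x : Plane) (ω : ℝ) : ℂ :=
  phase (-(ω * (t - 2 * M.s₀ * M.zint - inner ℝ x M.k₀) / ε)) *
    oscillatoryIntegral (M.reflIntegrand Ψ ε γ f x ω) * (ω ^ 2 : ℝ)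

/-- The (leading-order) reflected wave `u^{ε,ref}(t, x, z = 0)` for the interface
`z = z_int + ε f(x / ε^γ)`. -/
def uRef (Ψ : SpaceX → ℝ) (ε γ : ℝ) (f : Plane → ℝ) (t : ℝ) (x : Plane) : ℂ :=
  (M.reflCoeff / (2 * (2 * Real.pi) ^ 3) : ℝ) * ∫ ω : ℝ, M.reflFreqIntegrand Ψ ε γ f t x ω

/-- The observation point `x_obs + ε^{1-γ} ȳ + √ε y`. -/
def obsPoint (ε γ : ℝ) (ybar y : Plane) : Plane :=
  M.xObs + ε ^ (1 - γ) • ybar + Real.sqrt ε • y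

/-- The observation time
`t_obs + ε^{1-γ} k₀·ȳ + √ε k₀·y + ε^γ k₀·ỹ + ε^{2(1-γ)} s̄`. -/
def obsTime (ε γ : ℝ) (sbar : ℝ) (ybar y yt : Plane) : ℝ :=
  M.tObs + ε ^ (1 - γ) * inner ℝ M.k₀ ybar + Real.sqrt ε * inner ℝ M.k₀ y
    + ε ^ γ * inner ℝ M.k₀ yt + ε ^ (2 * (1 - γ)) * sbar

/-- The speckle profile `S^{ε,ref}(s̄, ȳ, y, s̃, ỹ)`; here `a = (s̄, ȳ, y)` and `b = (s̃, ỹ)`. -/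
def speckle (Ψ : SpaceX → ℝ) (ε γ : ℝ) (f : Plane → ℝ) (a : SpaceXX) (b : SpaceX) : ℂ :=
  (ε ^ (1 - 2 * γ) : ℝ) *
    M.uRef Ψ ε γ f (M.obsTime ε γ a.1 a.2.1 a.2.2 b.2 + ε * b.1)
      (M.obsPoint ε γ a.2.1 a.2.2 + ε ^ γ • b.2)

/-- The two-point correlation function `S^{ε,ref}(a, b₁) S^{ε,ref}(a, b₂)` (the field is real). -/
def corr (Ψ : SpaceX → ℝ) (ε γ : ℝ) (f : Plane → ℝ) (m : SpaceXX × SpaceX × SpaceX) : ℂ :=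
  M.speckle Ψ ε γ f m.1 m.2.1 * M.speckle Ψ ε γ f m.1 m.2.2

/-- The offset `y_p = z_int c₀ A₀ p` of the speckle scattered in direction `p`. -/
def speckleOffset (p : Plane) : Plane := (M.zint * M.c₀) • M.applyA₀ p

/-- The time lag `s_p = z_int c₀ pᵀA₀p / 2` of the speckle scattered in direction `p`. -/
def speckleDelay (p : Plane) : ℝ := M.zint * M.c₀ * inner ℝ p (M.applyA₀ p) / 2

/-- The angle of incidence. -/
def incidenceAngle : ℝ := Real.arctan (‖M.k₀‖ / M.s₀)

/-- The angle, from the vertical, of the ray that joins the point `(x_int, z_int)` of the interface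
to the point of the plane `z = 0` where the speckle scattered in direction `p` is observed. -/
def reflectionAngle (ε γ : ℝ) (p : Plane) : ℝ :=
  Real.arctan (‖M.obsPoint ε γ (M.speckleOffset p) 0 - M.xInt‖ / M.zint)

/-- `Ξ(p) = (1 + ξ p·k₀ / cos²θ_inc)² + ξ² (p·k₀^⊥)²`, where `ξ = ε^{1-γ} c₀² / sin²θ_inc` and
`k₀^⊥ = (-k₀₂, k₀₁)`. -/
def snellXi (ε γ : ℝ) (p : Plane) : ℝ :=
  let ξ := ε ^ (1 - γ) * M.c₀ ^ 2 / Real.sin M.incidenceAngle ^ 2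
  (1 + ξ * (inner ℝ p M.k₀ / Real.cos M.incidenceAngle ^ 2)) ^ 2
    + ξ ^ 2 * inner ℝ p (!₂[-M.k₀ 1, M.k₀ 0] : Plane) ^ 2

end Medium

section Random

variable {Ω : Type*} [MeasurableSpace Ω]

/-- `V` is stationary: all its translates have the same law, as random elements of `ℝ^(ℝ²)` with
the product `σ`-algebra (that is, the same finite-dimensional distributions). -/
def IsStationary (P : Measure Ω) (V : Ω → Plane → ℝ) : Prop :=
  ∀ h : Plane, P.map (fun w x => V w (x + h)) = P.map V

/-- The scattering distribution
`𝒜(v, ω, ·) = ∫ E[e^{iωv(V(y) - V(0))}] e^{-iω p·y} dy`, a tempered distribution in `p`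
(the Fourier transform of a bounded function), paired with the test function `a`. -/
def scatteringPairing (P : Measure Ω) (V : Ω → Plane → ℝ) (v ω : ℝ) (a : Plane → ℂ) : ℂ :=
  ∫ y : Plane, (∫ w, phase (ω * v * (V w y - V w 0)) ∂P) *
    ∫ p : Plane, phase (-(ω * inner ℝ p y)) * a p

/-- The distribution
`C(s̄, ȳ, s̃, ỹ) = 𝓡² / (4 (2π)³) ∬ e^{-iω(s̃ - p·ỹ)} 𝒜(2s₀, ω, p) |Ψ̂|₂²(ω)
  δ(s̄ - z_int c₀ pᵀA₀p / 2) δ(ȳ - z_int c₀ A₀ p) ω² dω dp`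
paired with the test function `φ` of `((s̄, ȳ), (s̃, ỹ))`. -/
def limitCorrPairing (M : Medium) (Ψ : SpaceX → ℝ) (P : Measure Ω) (V : Ω → Plane → ℝ)
    (φ : SpaceX → SpaceX → ℂ) : ℂ :=
  (M.reflCoeff ^ 2 / (4 * (2 * Real.pi) ^ 3) : ℝ) *
    ∫ ω : ℝ, (profilePower Ψ ω * ω ^ 2 : ℝ) *
      scatteringPairing P V (2 * M.s₀) ω fun p =>
        ∫ b : SpaceX, phase (-(ω * (b.1 - inner ℝ p b.2))) *
          φ (M.speckleDelay p, M.speckleOffset p) b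

end Random

/-- The test function `φ` such that pairing `C(s̄, ȳ, s̃₁ - s̃₂, ỹ₁ - ỹ₂)`, as a distribution in
`((s̄, ȳ, y), (s̃₁, ỹ₁), (s̃₂, ỹ₂))`, with `Φ` is pairing `C(s̄, ȳ, s̃, ỹ)` with `φ`. -/
def differenceAverage (Φ : SpaceXX × SpaceX × SpaceX → ℂ) (a b : SpaceX) : ℂ :=
  ∫ r : Plane × SpaceX, Φ ((a.1, a.2, r.1), b + r.2, r.2)

end Speckle

end

/-!
The reflected wave is an oscillatory integral over the frequency `ω` and the position `u` on the
interface. The integral in `q` is a Fresnel integral, which the Gaussian regularisation makes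
convergent: `tendsto_fresnelReg` gives its value, `2π / (iω √det)` times a phase in the quadratic
form `dualForm` inverse to `p ↦ inner p y_p`. The source has a band-limited, compactly supported
transform, so the field propagated to the interface (`Medium.pulse`) is continuous and integrable.
Hence the speckle profile is an absolutely convergent integral of `Medium.amp` against a phase that
depends on `ε` only through `η = ε^{γ - 1/2}` (`speckle_eq`), and `η → 0` because `γ > 1/2`.

The speckle is real, so its two-point product is also `S · conj S`; stationarity turns the mean of
the two interface phases into the coherence function `cohere`, a continuous function of the two
frequencies and of the separation of the two interface points (`integral_corr_eq`). Tested against a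
Schwartz function `Φ`, the mean correlation becomes an integral over two pairs `(ω₁, u₁)`,
`(ω₂, u₂)` and the observation variables. In the coordinates `s̄ = σ + s_p`, `ȳ = y_p` the quadratic
part of the phase difference cancels: what remains is *linear* in `(σ, p)`, with dual variables
`ν = (ω₁ - ω₂) / η²` and `ξ = (ω₁ e₁ - ω₂ e₂) / η`, where `e₁`, `e₂` are the two levers
(`corrPhase_straighten`). The change of coordinates keeps Schwartz functions Schwartz, so the
integral over `(σ, p)` is a Fourier transform of a Schwartz function and decays in `(ν, ξ)`. Taking
`(ν, ξ)` in place of `(ω₂, u₂)` as integration variables absorbs the power `η⁻⁴`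
(`integral_eq_integral_detuning`) and leaves an integrand with an integrable majorant independent
of `η` and a pointwise limit; dominated convergence gives the limit for all test functions at once
(`tendsto_integral_corr_mul`).

In the limit integrand the two frequencies and the two positions of the pulse coincide.
The integral over `u` is the energy of the pulse, given by Plancherel's identity
(`integral_norm_sq_pulse`); the integral over `ν` is a Fourier inversion that restricts `Φ` to
`σ = 0`, the scattered directions; the variable `ξ` becomes, up to the factor `ω`, the separation at
which the coherence function is evaluated. This is the stated distribution (`limitFunctional_eq`).

Snell's law is the Pythagorean theorem for the slope of the reflected ray, decomposed along `k₀` and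
its rotation by a right angle (`norm_sq_raySlope`).
-/

noncomputable section

namespace Speckle

open LineDeriv

/-! ### The function `phase` -/

lemma phase_add (a b : ℝ) : phase (a + b) = phase a * phase b := by
  simp [phase, add_mul, Complex.exp_add]

lemma norm_phase (a : ℝ) : ‖phase a‖ = 1 := by
  simp [phase, Complex.norm_exp_ofReal_mul_I]

lemma conj_phase (a : ℝ) : (starRingEnd ℂ) (phase a) = phase (-a) := by
  simp [phase, ← Complex.exp_conj]

lemma contDiff_phase {n : WithTop ℕ∞} : ContDiff ℝ n phase := by
  unfold phase
  exact Complex.contDiff_exp.comp ((Complex.ofRealCLM.contDiff).mul contDiff_const)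

@[fun_prop]
lemma continuous_phase : Continuous phase := by
  unfold phase; fun_prop

@[fun_prop]
lemma measurable_phase : Measurable phase := continuous_phase.measurable

lemma hasDerivAt_phase (a : ℝ) : HasDerivAt phase (Complex.I * phase a) a := by
  unfold phase
  have h := ((Complex.ofRealCLM.hasDerivAt (x := a)).mul_const Complex.I).cexp
  simpa [mul_comm] using h

lemma norm_phase_mul (a : ℝ) (z : ℂ) : ‖phase a * z‖ = ‖z‖ := by
  rw [norm_mul, norm_phase, one_mul]

/-- Multiplying an integrable function by a measurable phase factor keeps it integrable. -/
lemma Integrable.phase_mul {α : Type*} [MeasurableSpace α] {μ : Measure α} {f : α → ℂ}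
    (hf : Integrable f μ) {θ : α → ℝ} (hθ : AEMeasurable θ μ) :
    Integrable (fun x => phase (θ x) * f x) μ :=
  hf.bdd_mul (c := 1) (measurable_phase.comp_aemeasurable hθ).aestronglyMeasurable
    (Eventually.of_forall fun _ => (norm_phase _).le)

/-! ### Partial Fourier transforms of Schwartz functions -/

section PartialFourier

instance instIsAddHaarMeasureVolumeProd {A B : Type*} [NormedAddCommGroup A] [NormedSpace ℝ A]
    [FiniteDimensional ℝ A] [MeasureSpace A] [BorelSpace A] [NormedAddCommGroup B]
    [NormedSpace ℝ B] [FiniteDimensional ℝ B] [MeasureSpace B] [BorelSpace B]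
    [(volume : Measure A).IsAddHaarMeasure] [(volume : Measure B).IsAddHaarMeasure] :
    (volume : Measure (A × B)).IsAddHaarMeasure := by
  have := FiniteDimensional.proper ℝ A
  have := FiniteDimensional.proper ℝ B
  rw [Measure.volume_eq_prod]; infer_instance

variable {E R : Type*} [NormedAddCommGroup E] [NormedSpace ℝ E] [NormedAddCommGroup R]
  [NormedSpace ℝ R]

/-- The restriction `x ↦ f (x, r)` of a Schwartz function of two variables. -/
def sliceCLM (r : R) : 𝓢(E × R, ℂ) →L[ℂ] 𝓢(E, ℂ) :=
  SchwartzMap.compCLM ℂ (g := fun x : E => (x, r))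
    (by
      have h := ((ContinuousLinearMap.inl ℝ E R).hasTemperateGrowth).add
        (Function.HasTemperateGrowth.const (E := E) ((0 : E), r))
      convert h using 1
      ext x <;> simp)
    ⟨1, 1, fun x => by
      have : ‖x‖ ≤ ‖((x, r) : E × R)‖ := le_max_left _ _
      linarith⟩

@[simp] lemma sliceCLM_apply (r : R) (f : 𝓢(E × R, ℂ)) (x : E) : sliceCLM r f x = f (x, r) := rfl

lemma lineDeriv_sliceCLM (r : R) (f : 𝓢(E × R, ℂ)) (v x : E) :
    (∂_{v} (sliceCLM r f)) x = (∂_{((v, 0) : E × R)} f) (x, r) := by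
  rw [SchwartzMap.lineDerivOp_apply_eq_fderiv, SchwartzMap.lineDerivOp_apply_eq_fderiv]
  have h : HasFDerivAt (fun x : E => (x, r)) (ContinuousLinearMap.inl ℝ E R) x :=
    hasFDerivAt_prodMk_left x r
  have h2 := HasFDerivAt.comp (f := fun x : E => (x, r)) (g := f) x (f.hasFDerivAt (x, r)) h
  change HasFDerivAt (sliceCLM r f) _ x at h2
  rw [h2.fderiv]; simp

variable [MeasureSpace E]

/-- The partial Fourier transform in the first variable, at the frequency `L`. -/
def partialFourier (f : 𝓢(E × R, ℂ)) (L : E →L[ℝ] ℝ) (r : R) : ℂ := ∫ x, phase (L x) * f (x, r)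

lemma norm_partialFourier_le (f : 𝓢(E × R, ℂ)) (L : E →L[ℝ] ℝ) (r : R) :
    ‖partialFourier f L r‖ ≤ ∫ x, ‖f (x, r)‖ := by
  refine (norm_integral_le_integral_norm _).trans (le_of_eq ?_)
  simp [norm_phase]

variable [BorelSpace E] [FiniteDimensional ℝ E]
  [(volume : Measure E).IsAddHaarMeasure]

/-- Integration by parts against the character `x ↦ phase (L x)`. -/
lemma integral_phase_mul_lineDeriv (s : 𝓢(E, ℂ)) (L : E →L[ℝ] ℝ) (v : E) :
    ∫ x, phase (L x) * (∂_{v} s) x = -(Complex.I * (L v : ℝ)) * ∫ x, phase (L x) * s x := by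
  have hd : ∀ x, HasFDerivAt (fun x => phase (L x)) ((Complex.I * phase (L x)) •
      (Complex.ofRealCLM.comp L)) x := by
    intro x
    have h := HasFDerivAt.comp (g := phase) (f := fun x => L x) x
      (hasDerivAt_phase (L x)).hasFDerivAt L.hasFDerivAt
    refine h.congr_fderiv ?_
    ext y; simp [mul_comm]
  have hL : AEMeasurable (fun x => L x) (volume : Measure E) := L.continuous.measurable.aemeasurable
  have h := integral_mul_fderiv_eq_neg_fderiv_mul_of_integrable (μ := (volume : Measure E))
    (f := fun x => phase (L x)) (g := s) (v := v) ?_ ?_ (Integrable.phase_mul s.integrable hL)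
    (fun x _ => (hd x).differentiableAt) (fun x _ => s.differentiableAt)
  · simp only [SchwartzMap.lineDerivOp_apply_eq_fderiv]
    rw [h, ← integral_const_mul, ← integral_neg]
    congr 1; ext x; rw [(hd x).fderiv]; simp; ring
  · have : (fun x => (fderiv ℝ (fun x => phase (L x)) x) v * s x) =
        fun x => (Complex.I * (L v : ℝ)) * (phase (L x) * s x) := by
      ext x; rw [(hd x).fderiv]; simp; ring
    rw [this]
    exact (Integrable.phase_mul s.integrable hL).const_mul _
  · have := Integrable.phase_mul (μ := (volume : Measure E)) ((∂_{v} s).integrable) hL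
    simpa only [SchwartzMap.lineDerivOp_apply_eq_fderiv] using this

/-- The operator `1 - ∂_v²` on Schwartz functions. Under the Fourier transform it becomes
multiplication by `1 + (L v)²`. -/
def oneSubSq {F : Type*} [NormedAddCommGroup F] [NormedSpace ℝ F] (v : F) :
    𝓢(F, ℂ) →L[ℂ] 𝓢(F, ℂ) :=
  ContinuousLinearMap.id ℂ _ -
    (lineDerivOpCLM ℂ 𝓢(F, ℂ) v).comp (lineDerivOpCLM ℂ 𝓢(F, ℂ) v)

lemma partialFourier_oneSubSq (f : 𝓢(E × R, ℂ)) (L : E →L[ℝ] ℝ) (r : R) (v : E) :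
    partialFourier (oneSubSq ((v, 0) : E × R) f) L r = (1 + (L v : ℂ) ^ 2) * partialFourier f L r := by
  have hL : AEMeasurable (fun x => L x) (volume : Measure E) := L.continuous.measurable.aemeasurable
  have e : ∀ x, oneSubSq ((v, 0) : E × R) f (x, r) =
      sliceCLM r f x - (∂_{v} (∂_{v} (sliceCLM r f))) x := by
    intro x
    have h1 : ∂_{v} (sliceCLM r f) = sliceCLM r (∂_{((v, 0) : E × R)} f) := by
      ext y; exact lineDeriv_sliceCLM r f v y
    rw [h1, lineDeriv_sliceCLM]
    rfl
  unfold partialFourier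
  simp only [e, mul_sub]
  rw [integral_sub (Integrable.phase_mul (SchwartzMap.integrable _) hL)
    (Integrable.phase_mul (SchwartzMap.integrable _) hL), integral_phase_mul_lineDeriv,
    integral_phase_mul_lineDeriv]
  simp only [sliceCLM_apply]
  ring_nf
  simp

lemma one_add_sq_mul_norm_partialFourier (f : 𝓢(E × R, ℂ)) (L : E →L[ℝ] ℝ) (r : R) (v : E) :
    (1 + L v ^ 2) * ‖partialFourier f L r‖ =
      ‖partialFourier (oneSubSq ((v, 0) : E × R) f) L r‖ := by
  rw [partialFourier_oneSubSq, norm_mul]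
  congr 1
  have : (1 + (L v : ℂ) ^ 2) = ((1 + L v ^ 2 : ℝ) : ℂ) := by push_cast; ring
  rw [this, Complex.norm_real, Real.norm_of_nonneg (by positivity)]

/-- Decay of a partial Fourier transform in the directions of a list of vectors. -/
lemma norm_partialFourier_le_of_list (l : List E) (f : 𝓢(E × R, ℂ)) (L : E →L[ℝ] ℝ) (r : R) :
    (l.map fun v => 1 + L v ^ 2).prod * ‖partialFourier f L r‖ ≤
      ∫ x, ‖(l.foldr (fun v g => oneSubSq ((v, 0) : E × R) g) f) (x, r)‖ := by
  suffices h : (l.map fun v => 1 + L v ^ 2).prod * ‖partialFourier f L r‖ =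
      ‖partialFourier (l.foldr (fun v g => oneSubSq ((v, 0) : E × R) g) f) L r‖ by
    rw [h]; exact norm_partialFourier_le _ _ _
  induction l with
  | nil => simp
  | cons v l ih =>
    simp only [List.map_cons, List.prod_cons, List.foldr_cons]
    rw [mul_assoc, ih, one_add_sq_mul_norm_partialFourier]

end PartialFourier

end Speckle

namespace Speckle

/-! ### The quadratic form of the paraxial propagator -/

namespace Medium

variable (M : Medium)

lemma one_sub_pos : 0 < 1 - M.c₀ ^ 2 * ‖M.k₀‖ ^ 2 := by
  have h : M.c₀ * ‖M.k₀‖ < 1 := by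
    have := mul_lt_mul_of_pos_left M.k₀_lt₀ M.c₀_pos
    rwa [mul_inv_cancel₀ M.c₀_pos.ne'] at this
  have h0 : 0 ≤ M.c₀ * ‖M.k₀‖ := mul_nonneg M.c₀_pos.le (norm_nonneg _)
  nlinarith

lemma s₀_pos : 0 < M.s₀ := div_pos (Real.sqrt_pos.2 M.one_sub_pos) M.c₀_pos

lemma s₀_sq : M.s₀ ^ 2 = (1 - M.c₀ ^ 2 * ‖M.k₀‖ ^ 2) / M.c₀ ^ 2 := by
  unfold s₀; rw [div_pow, Real.sq_sqrt M.one_sub_pos.le]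

lemma norm_k₀_sq : ‖M.k₀‖ ^ 2 = M.k₀ 0 ^ 2 + M.k₀ 1 ^ 2 := by
  rw [EuclideanSpace.norm_sq_eq]; simp

/-- The scalar prefactor of the matrix `A₀`. -/
def A₀coef : ℝ := 1 / (1 - M.c₀ ^ 2 * ‖M.k₀‖ ^ 2) ^ (3 / 2 : ℝ)

lemma A₀coef_pos : 0 < M.A₀coef := one_div_pos.2 (Real.rpow_pos_of_pos M.one_sub_pos _)

lemma applyA₀_zero (p : Plane) : M.applyA₀ p 0 =
    M.A₀coef * ((1 - M.c₀ ^ 2 * M.k₀ 1 ^ 2) * p 0 + M.c₀ ^ 2 * M.k₀ 0 * M.k₀ 1 * p 1) := by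
  simp [applyA₀, A₀, A₀coef, Matrix.toLpLin_apply, dotProduct, Fin.sum_univ_two]
  ring

lemma applyA₀_one (p : Plane) : M.applyA₀ p 1 =
    M.A₀coef * (M.c₀ ^ 2 * M.k₀ 0 * M.k₀ 1 * p 0 + (1 - M.c₀ ^ 2 * M.k₀ 0 ^ 2) * p 1) := by
  simp [applyA₀, A₀, A₀coef, Matrix.toLpLin_apply, dotProduct, Fin.sum_univ_two]
  ring

lemma inner_plane (p q : Plane) : inner ℝ p q = p 0 * q 0 + p 1 * q 1 := by
  simp [PiLp.inner_apply, Fin.sum_univ_two]; ring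

/-- The linear map `p ↦ y_p = z_int c₀ A₀ p`. -/
def offsetLin : Plane →ₗ[ℝ] Plane := (M.zint * M.c₀) • Matrix.toEuclideanLin M.A₀

/-- The continuous linear map `p ↦ y_p = z_int c₀ A₀ p`. -/
def offset : Plane →L[ℝ] Plane := LinearMap.toContinuousLinearMap M.offsetLin

lemma offset_apply (p : Plane) : M.offset p = (M.zint * M.c₀) • M.applyA₀ p := rfl

lemma offset_eq (p : Plane) : M.speckleOffset p = M.offset p := rfl

lemma speckleDelay_eq (p : Plane) : M.speckleDelay p = inner ℝ p (M.offset p) / 2 := by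
  rw [speckleDelay, offset_apply, inner_smul_right]

lemma propagator_eq (ω : ℝ) (q : Plane) :
    M.propagator ω q M.zint = phase (-(ω * inner ℝ q (M.offset q) / 2)) := by
  rw [propagator, offset_apply, inner_smul_right]; congr 1; ring

lemma offset_symm (p q : Plane) : inner ℝ (M.offset p) q = inner ℝ p (M.offset q) := by
  simp only [offset_apply, inner_smul_right, inner_smul_left, inner_plane, applyA₀_zero,
    applyA₀_one, RCLike.conj_to_real]
  ring

lemma offset_pos {p : Plane} (hp : p ≠ 0) : 0 < inner ℝ p (M.offset p) := by
  have h : inner ℝ p (M.offset p) = (M.zint * M.c₀ * M.A₀coef) *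
      (‖p‖ ^ 2 - M.c₀ ^ 2 * (M.k₀ 0 * p 1 - M.k₀ 1 * p 0) ^ 2) := by
    simp only [offset_apply, inner_smul_right, inner_plane, applyA₀_zero, applyA₀_one]
    rw [EuclideanSpace.norm_sq_eq]; simp; ring
  rw [h]
  refine mul_pos (mul_pos (mul_pos M.zint_pos M.c₀_pos) M.A₀coef_pos) ?_
  have hp' : 0 < ‖p‖ ^ 2 := by positivity
  have h1 : (M.k₀ 0 * p 1 - M.k₀ 1 * p 0) ^ 2 ≤ ‖M.k₀‖ ^ 2 * ‖p‖ ^ 2 := by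
    rw [norm_k₀_sq, EuclideanSpace.norm_sq_eq]; simp
    nlinarith [sq_nonneg (M.k₀ 0 * p 0 + M.k₀ 1 * p 1)]
  have h2 := mul_pos M.one_sub_pos hp'
  have h3 := mul_le_mul_of_nonneg_left h1 (sq_nonneg M.c₀)
  nlinarith

lemma offsetLin_symm : M.offsetLin.IsSymmetric := M.offset_symm

/-- The eigenvalues of the map `p ↦ y_p`. -/
def eig : Fin 2 → ℝ := M.offsetLin_symm.eigenvalues finrank_euclideanSpace_fin

/-- An orthonormal basis of eigenvectors of the map `p ↦ y_p`. -/
def eigBasis : OrthonormalBasis (Fin 2) ℝ Plane :=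
  M.offsetLin_symm.eigenvectorBasis finrank_euclideanSpace_fin

lemma offset_eigBasis (i : Fin 2) : M.offset (M.eigBasis i) = M.eig i • M.eigBasis i :=
  M.offsetLin_symm.apply_eigenvectorBasis finrank_euclideanSpace_fin i

lemma eig_pos (i : Fin 2) : 0 < M.eig i := by
  have h := M.offset_pos (p := M.eigBasis i) (M.eigBasis.orthonormal.ne_zero i)
  rw [offset_eigBasis, inner_smul_right, real_inner_self_eq_norm_sq, M.eigBasis.norm_eq_one] at h
  simpa using h

lemma repr_offset (p : Plane) (i : Fin 2) :
    M.eigBasis.repr (M.offset p) i = M.eig i * M.eigBasis.repr p i := by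
  rw [OrthonormalBasis.repr_apply_apply, OrthonormalBasis.repr_apply_apply, ← offset_symm,
    offset_eigBasis, inner_smul_left]
  simp

/-- The determinant of the map `p ↦ y_p`. -/
def detOffset : ℝ := M.eig 0 * M.eig 1

lemma detOffset_pos : 0 < M.detOffset := mul_pos (M.eig_pos 0) (M.eig_pos 1)

lemma det_offset : LinearMap.det M.offsetLin = M.detOffset := by
  rw [M.offsetLin_symm.det_eq_prod_eigenvalues finrank_euclideanSpace_fin]
  simp [detOffset, eig, Fin.prod_univ_two]

/-- The inverse of the map `p ↦ y_p`. -/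
def offsetInv : Plane →L[ℝ] Plane :=
  ∑ i, (M.eig i)⁻¹ • (innerSL ℝ (M.eigBasis i)).smulRight (M.eigBasis i)

lemma repr_offsetInv (p : Plane) (i : Fin 2) :
    M.eigBasis.repr (M.offsetInv p) i = (M.eig i)⁻¹ * M.eigBasis.repr p i := by
  have e : M.offsetInv p = ∑ j, ((M.eig j)⁻¹ * M.eigBasis.repr p j) • M.eigBasis j := by
    simp [offsetInv, OrthonormalBasis.repr_apply_apply, smul_smul]
  rw [e, OrthonormalBasis.repr_apply_apply, inner_sum]
  simp [inner_smul_right, orthonormal_iff_ite.1 M.eigBasis.orthonormal]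

lemma inner_eq_repr (p q : Plane) :
    inner ℝ p q = ∑ i, M.eigBasis.repr p i * M.eigBasis.repr q i := by
  rw [← M.eigBasis.repr.inner_map_map, PiLp.inner_apply]
  simp [mul_comm]

lemma offsetInv_offset (p : Plane) : M.offsetInv (M.offset p) = p := by
  apply M.eigBasis.repr.injective
  ext i
  rw [repr_offsetInv, repr_offset, inv_mul_cancel_left₀ (M.eig_pos i).ne']

lemma offset_offsetInv (p : Plane) : M.offset (M.offsetInv p) = p := by
  apply M.eigBasis.repr.injective
  ext i
  rw [repr_offset, repr_offsetInv, mul_inv_cancel_left₀ (M.eig_pos i).ne']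

lemma offsetInv_symm (p q : Plane) : inner ℝ (M.offsetInv p) q = inner ℝ p (M.offsetInv q) := by
  rw [← M.offset_offsetInv q, ← offset_symm, offset_offsetInv, offsetInv_offset]

/-- The quadratic form dual to the phase of the propagator. -/
def dualForm (v : Plane) : ℝ := inner ℝ v (M.offsetInv v)

lemma dualForm_eq_repr (v : Plane) :
    M.dualForm v = ∑ i, M.eigBasis.repr v i ^ 2 / M.eig i := by
  rw [dualForm, inner_eq_repr]
  refine Finset.sum_congr rfl fun i _ => ?_
  rw [repr_offsetInv]; ring

@[fun_prop]
lemma continuous_dualForm : Continuous M.dualForm := by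
  unfold dualForm; fun_prop

lemma dualForm_add (v w : Plane) :
    M.dualForm (v + w) = M.dualForm v + 2 * inner ℝ (M.offsetInv v) w + M.dualForm w := by
  simp only [dualForm, map_add, inner_add_left, inner_add_right]
  rw [← M.offsetInv_symm v w, real_inner_comm (M.offsetInv v) w]
  ring

lemma dualForm_smul (a : ℝ) (v : Plane) : M.dualForm (a • v) = a ^ 2 * M.dualForm v := by
  simp only [dualForm, map_smul, inner_smul_left, inner_smul_right, RCLike.conj_to_real]; ring

lemma dualForm_offset (p : Plane) : M.dualForm (M.offset p) = inner ℝ p (M.offset p) := by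
  rw [dualForm, offsetInv_offset, real_inner_comm]

/-! ### Fresnel integrals -/

/-- Integration over the plane in the coordinates of the eigenbasis. -/
lemma integral_eq_integral_coord {F : Type*} [NormedAddCommGroup F] [NormedSpace ℝ F]
    (f : Plane → F) :
    ∫ q, f q = ∫ t : Fin 2 → ℝ, f (M.eigBasis.repr.symm (WithLp.toLp 2 t)) := by
  rw [← M.eigBasis.measurePreserving_repr_symm.integral_comp
      M.eigBasis.measurableEquiv.symm.measurableEmbedding,
    ← (PiLp.volume_preserving_toLp (Fin 2)).integral_comp
      (MeasurableEquiv.toLp 2 (Fin 2 → ℝ)).measurableEmbedding]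

/-- Gaussian-regularised Fresnel integral of the propagator. -/
def fresnelReg (δ ω : ℝ) (v : Plane) : ℂ :=
  ∫ q, (Real.exp (-δ * ‖q‖ ^ 2) : ℂ) * phase (ω * inner ℝ q v - ω * inner ℝ q (M.offset q) / 2)

lemma fresnelReg_eq {δ : ℝ} (hδ : 0 < δ) (ω : ℝ) (v : Plane) :
    M.fresnelReg δ ω v = ∏ i, (Real.pi / (δ + ω * M.eig i / 2 * Complex.I)) ^ (1 / 2 : ℂ) *
      Complex.exp ((ω * M.eigBasis.repr v i * Complex.I) ^ 2 /
        (4 * (δ + ω * M.eig i / 2 * Complex.I))) := by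
  rw [← GaussianFourier.integral_cexp_neg_sum_mul_add (ι := Fin 2)
    (b := fun i => (δ + ω * M.eig i / 2 * Complex.I)) (by intro i; simp [hδ])
    (fun i => (ω * M.eigBasis.repr v i * Complex.I)), fresnelReg, M.integral_eq_integral_coord]
  congr 1; ext t
  have h1 : ‖M.eigBasis.repr.symm (WithLp.toLp 2 t)‖ ^ 2 = ∑ i, t i ^ 2 := by
    rw [LinearIsometryEquiv.norm_map, EuclideanSpace.norm_sq_eq]; simp
  rw [h1, M.inner_eq_repr, M.inner_eq_repr]
  simp only [repr_offset, LinearIsometryEquiv.apply_symm_apply, phase, Fin.sum_univ_two]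
  push_cast
  rw [← Complex.exp_add]
  congr 1; ring

/-- The value `2π / (iω √det)` at the origin of the Fresnel integral. -/
def fresnelConst (ω : ℝ) : ℂ := 2 * Real.pi / (Complex.I * ω * Real.sqrt M.detOffset)

/-- The two principal square roots have the same argument, so their product is a rational
expression in `ω`. -/
lemma prod_sqrt_eq {ω : ℝ} (hω : ω ≠ 0) :
    ∏ i, (Real.pi / (ω * M.eig i / 2 * Complex.I)) ^ (1 / 2 : ℂ) = M.fresnelConst ω := by
  have hz : (Real.pi / (ω * Complex.I) : ℂ) ≠ 0 := by
    simp [hω, Real.pi_ne_zero]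
  have h : ∀ i, (Real.pi / (ω * M.eig i / 2 * Complex.I)) ^ (1 / 2 : ℂ) =
      ((Real.sqrt (2 / M.eig i) : ℝ) : ℂ) * (Real.pi / (ω * Complex.I) : ℂ) ^ (1 / 2 : ℂ) := by
    intro i
    have hi := M.eig_pos i
    have e : (Real.pi / (ω * M.eig i / 2 * Complex.I) : ℂ) =
        ((2 / M.eig i : ℝ) : ℂ) * (Real.pi / (ω * Complex.I) : ℂ) := by
      have : (M.eig i : ℂ) ≠ 0 := by exact_mod_cast hi.ne'
      have : (ω : ℂ) ≠ 0 := by exact_mod_cast hω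
      push_cast; field_simp
    have hr : 0 < 2 / M.eig i := by positivity
    have hr' : ((2 / M.eig i : ℝ) : ℂ) ≠ 0 := by exact_mod_cast hr.ne'
    rw [e, Real.sqrt_eq_rpow, Complex.ofReal_cpow hr.le,
      Complex.cpow_def_of_ne_zero (mul_ne_zero hr' hz), Complex.cpow_def_of_ne_zero hr',
      Complex.cpow_def_of_ne_zero hz, Complex.log_ofReal_mul hr hz, ← Complex.ofReal_log hr.le,
      ← Complex.exp_add]
    congr 1; push_cast; ring
  rw [Fin.prod_univ_two, h, h]
  have e2 : (Real.pi / (ω * Complex.I) : ℂ) ^ (1 / 2 : ℂ) * (Real.pi / (ω * Complex.I) : ℂ) ^ (1 / 2 : ℂ)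
      = Real.pi / (ω * Complex.I) := by
    rw [← Complex.cpow_add _ _ hz]; norm_num
  have e3 : Real.sqrt (2 / M.eig 0) * Real.sqrt (2 / M.eig 1) = 2 / Real.sqrt M.detOffset := by
    have h0 := M.eig_pos 0
    have h1 := M.eig_pos 1
    rw [← Real.sqrt_mul (by positivity), detOffset, show 2 / M.eig 0 * (2 / M.eig 1) =
      2 ^ 2 / (M.eig 0 * M.eig 1) by field_simp, Real.sqrt_div (by positivity),
      Real.sqrt_sq (by norm_num)]
  calc _ = ((Real.sqrt (2 / M.eig 0) * Real.sqrt (2 / M.eig 1) : ℝ) : ℂ) *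
      ((Real.pi / (ω * Complex.I) : ℂ) ^ (1 / 2 : ℂ) * (Real.pi / (ω * Complex.I) : ℂ) ^ (1 / 2 : ℂ)) := by
        push_cast; ring
    _ = _ := by
        rw [e2, e3, fresnelConst]; push_cast; rw [div_mul_div_comm]; congr 1; ring

/-- The boundary value of the Gaussian integral: the real part `δ` of the quadratic form keeps the
square roots on their principal branch in the limit. -/
lemma tendsto_fresnelReg {ω : ℝ} (hω : ω ≠ 0) (v : Plane) :
    Tendsto (fun δ => M.fresnelReg δ ω v) (𝓝[>] 0)
      (𝓝 (M.fresnelConst ω * phase (ω * M.dualForm v / 2))) := by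
  have hω' : (ω : ℂ) ≠ 0 := by exact_mod_cast hω
  have hval : M.fresnelConst ω * phase (ω * M.dualForm v / 2) =
      ∏ i, (Real.pi / (((0 : ℝ) : ℂ) + ω * M.eig i / 2 * Complex.I)) ^ (1 / 2 : ℂ) *
      Complex.exp ((ω * M.eigBasis.repr v i * Complex.I) ^ 2 /
        (4 * (((0 : ℝ) : ℂ) + ω * M.eig i / 2 * Complex.I))) := by
    rw [Finset.prod_mul_distrib]
    simp only [Complex.ofReal_zero, zero_add]
    rw [M.prod_sqrt_eq hω]
    congr 1
    rw [← Complex.exp_sum, phase, dualForm_eq_repr]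
    congr 1
    push_cast
    rw [Finset.mul_sum, Finset.sum_div, Finset.sum_mul]
    refine Finset.sum_congr rfl fun i _ => ?_
    have : (M.eig i : ℂ) ≠ 0 := by exact_mod_cast (M.eig_pos i).ne'
    field_simp
    norm_num
  rw [hval]
  refine Tendsto.congr' (f₁ := fun δ : ℝ => ∏ i,
    (Real.pi / ((δ : ℂ) + ω * M.eig i / 2 * Complex.I)) ^ (1 / 2 : ℂ) *
      Complex.exp ((ω * M.eigBasis.repr v i * Complex.I) ^ 2 /
        (4 * ((δ : ℂ) + ω * M.eig i / 2 * Complex.I)))) ?_ ?_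
  · filter_upwards [self_mem_nhdsWithin] with δ hδ
    exact (M.fresnelReg_eq hδ ω v).symm
  · refine tendsto_nhdsWithin_of_tendsto_nhds (tendsto_finsetProd _ fun i _ => ?_)
    have hi : (M.eig i : ℂ) ≠ 0 := by exact_mod_cast (M.eig_pos i).ne'
    have hne : (((0 : ℝ) : ℂ) + ω * M.eig i / 2 * Complex.I) ≠ 0 := by
      simp [hω, hi]
    have hc : ContinuousAt (fun δ : ℝ => (Real.pi / ((δ : ℂ) + ω * M.eig i / 2 * Complex.I) : ℂ)) 0 :=
      ContinuousAt.div continuousAt_const (by fun_prop) hne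
    refine (ContinuousAt.mul ?_ ?_ : ContinuousAt (fun δ : ℝ =>
      (Real.pi / ((δ : ℂ) + ω * M.eig i / 2 * Complex.I) : ℂ) ^ (1 / 2 : ℂ) *
      Complex.exp ((ω * M.eigBasis.repr v i * Complex.I) ^ 2 /
        (4 * ((δ : ℂ) + ω * M.eig i / 2 * Complex.I)))) 0)
    · refine hc.cpow continuousAt_const (Or.inr ?_)
      simp [Complex.div_im, Real.pi_ne_zero, hω, (M.eig_pos i).ne']
    · refine ContinuousAt.cexp (ContinuousAt.div continuousAt_const (by fun_prop) ?_)
      exact mul_ne_zero (by norm_num) hne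

/-- The regularised Fresnel integrals are bounded by their limit, uniformly in `v`. -/
lemma norm_fresnelReg_le {ω δ : ℝ} (hω : ω ≠ 0) (hδ : 0 < δ) (v : Plane) :
    ‖M.fresnelReg δ ω v‖ ≤ ‖M.fresnelConst ω‖ := by
  rw [M.fresnelReg_eq hδ, ← M.prod_sqrt_eq hω, norm_prod, norm_prod]
  refine Finset.prod_le_prod (fun i _ => norm_nonneg _) fun i _ => ?_
  have hi := M.eig_pos i
  set y : ℝ := ω * M.eig i / 2 with hy
  have hy0 : y ≠ 0 := by positivity
  have ey : (ω * M.eig i / 2 : ℂ) = (y : ℂ) := by rw [hy]; push_cast; rfl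
  rw [ey, norm_mul, show (1 / 2 : ℂ) = ((1 / 2 : ℝ) : ℂ) by push_cast; rfl,
    Complex.norm_cpow_real, Complex.norm_cpow_real]
  have hexp : ‖Complex.exp ((ω * M.eigBasis.repr v i * Complex.I) ^ 2 /
      (4 * (δ + y * Complex.I)))‖ ≤ 1 := by
    rw [Complex.norm_exp, Real.exp_le_one_iff]
    have : ((ω * M.eigBasis.repr v i * Complex.I) ^ 2 / (4 * (δ + y * Complex.I)) : ℂ) =
        ((-(ω * M.eigBasis.repr v i) ^ 2 / 4 : ℝ) : ℂ) * (δ + y * Complex.I : ℂ)⁻¹ := by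
      rw [mul_pow, Complex.I_sq, div_eq_mul_inv, mul_inv]; push_cast; ring
    rw [this, Complex.re_ofReal_mul, Complex.inv_re]
    refine mul_nonpos_of_nonpos_of_nonneg ?_ ?_
    · have := sq_nonneg (ω * M.eigBasis.repr v i); linarith
    · refine div_nonneg ?_ (Complex.normSq_nonneg _)
      simp [hδ.le]
  have hbase : ‖(Real.pi / (δ + y * Complex.I) : ℂ)‖ ≤ ‖(Real.pi / (y * Complex.I) : ℂ)‖ := by
    rw [norm_div, norm_div]
    refine div_le_div_of_nonneg_left (norm_nonneg _) (by simp [hy0]) ?_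
    have := Complex.abs_im_le_norm (δ + y * Complex.I : ℂ)
    simpa using this
  calc _ ≤ ‖(Real.pi / (δ + y * Complex.I) : ℂ)‖ ^ (1 / 2 : ℝ) * 1 := by gcongr
    _ ≤ _ := by rw [mul_one]; gcongr

end Medium
end Speckle

namespace Speckle

/-! ### The source profile and its propagation to the interface -/

section Profile

variable {Ψ : SpaceX → ℝ}

lemma norm_profileHat_le (ω : ℝ) (k : Plane) : ‖profileHat Ψ ω k‖ ≤ ∫ a, ‖Ψ a‖ := by
  refine (norm_integral_le_integral_norm _).trans (le_of_eq ?_)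
  simp [norm_phase]

lemma continuous_profileHat (hΨ : Integrable Ψ) :
    Continuous fun z : ℝ × Plane => profileHat Ψ z.1 z.2 := by
  refine continuous_of_dominated (bound := fun a => ‖Ψ a‖) (fun z => ?_) (fun z => ?_) hΨ.norm ?_
  · exact hΨ.ofReal.aestronglyMeasurable.mul (by fun_prop : Continuous _).aestronglyMeasurable
  · exact Eventually.of_forall fun a => by simp [norm_phase]
  · exact Eventually.of_forall fun a => by fun_prop

lemma profileHat_neg (ω : ℝ) (k : Plane) :
    profileHat Ψ (-ω) k = (starRingEnd ℂ) (profileHat Ψ ω k) := by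
  unfold profileHat
  rw [← integral_conj]
  congr 1; ext a
  rw [map_mul, conj_phase, Complex.conj_ofReal]; congr 2; ring

end Profile

/-- A convolution estimate: `a ↦ k (u - a.2)` averaged against an integrable function of `a`. -/
lemma integrable_conv {f : SpaceX → ℂ} {k : Plane → ℂ} (hf : Integrable f) (hk : Continuous k)
    (hki : Integrable k) :
    Integrable (fun p : Plane × SpaceX => f p.2 * k (p.1 - p.2.2)) := by
  have hm : AEStronglyMeasurable (fun p : Plane × SpaceX => f p.2 * k (p.1 - p.2.2)) :=
    hf.aestronglyMeasurable.comp_snd.mul (by fun_prop : Continuous _).aestronglyMeasurable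
  rw [Measure.volume_eq_prod] at hm ⊢
  rw [integrable_prod_iff' hm]
  refine ⟨Eventually.of_forall fun a => (hki.comp_sub_right a.2).const_mul (f a), ?_⟩
  have : (fun a : SpaceX => ∫ u : Plane, ‖f a * k (u - a.2)‖) = fun a => ‖f a‖ * ∫ u, ‖k u‖ := by
    ext a
    simp only [norm_mul]
    rw [integral_const_mul, integral_sub_right_eq_self (fun u => ‖k u‖)]
  rw [this]
  exact hf.norm.mul_const _

lemma integral_norm_conv_le {f : SpaceX → ℂ} {k : Plane → ℂ} (hf : Integrable f)
    (hk : Continuous k) (hki : Integrable k) :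
    Integrable (fun u => ∫ a, f a * k (u - a.2)) ∧
      ∫ u, ‖∫ a, f a * k (u - a.2)‖ ≤ (∫ a, ‖f a‖) * ∫ u, ‖k u‖ := by
  have h := integrable_conv hf hk hki
  refine ⟨h.integral_prod_left, ?_⟩
  calc ∫ u, ‖∫ a, f a * k (u - a.2)‖ ≤ ∫ u, ∫ a, ‖f a * k (u - a.2)‖ := by
        refine integral_mono h.integral_prod_left.norm h.norm.integral_prod_left fun u => ?_
        exact norm_integral_le_integral_norm _
    _ = ∫ a, ∫ u, ‖f a * k (u - a.2)‖ := integral_integral_swap h.norm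
    _ = _ := by
        simp only [norm_mul]
        rw [← integral_mul_const]
        congr 1; ext a
        rw [integral_const_mul, integral_sub_right_eq_self (fun u => ‖k u‖)]

/-- The standard basis vector of the plane. -/
def planeBasis (i : Fin 2) : Plane := EuclideanSpace.single i 1

lemma inner_planeBasis (v : Plane) (i : Fin 2) : inner ℝ v (planeBasis i) = v i := by
  simp [planeBasis, EuclideanSpace.inner_single_right]

/-- An integrable majorant on the plane. -/
def planeDecay (v : Plane) : ℝ := (1 + v 0 ^ 2)⁻¹ * (1 + v 1 ^ 2)⁻¹

lemma planeDecay_nonneg (v : Plane) : 0 ≤ planeDecay v := by unfold planeDecay; positivity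

lemma integrable_planeDecay : Integrable planeDecay := by
  have h := (PiLp.volume_preserving_ofLp (Fin 2)).integrable_comp_emb
    (MeasurableEquiv.toLp 2 (Fin 2 → ℝ)).symm.measurableEmbedding
    (g := fun t : Fin 2 → ℝ => ∏ i, (1 + t i ^ 2)⁻¹)
  have h2 : Integrable (fun t : Fin 2 → ℝ => ∏ i, (1 + t i ^ 2)⁻¹) :=
    Integrable.fintype_prod (f := fun _ (x : ℝ) => (1 + x ^ 2)⁻¹) fun _ => integrable_inv_one_add_sq
  refine (h.2 h2).congr (Eventually.of_forall fun v => ?_)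
  simp [planeDecay, Fin.prod_univ_two, mul_comm]

lemma continuous_partialFourier {E R : Type*} [NormedAddCommGroup E] [NormedSpace ℝ E]
    [NormedAddCommGroup R] [NormedSpace ℝ R] [MeasureSpace E] [BorelSpace E]
    [FiniteDimensional ℝ E] [(volume : Measure E).IsAddHaarMeasure] (f : 𝓢(E × R, ℂ)) (r : R) :
    Continuous fun L => partialFourier f L r := by
  refine continuous_of_dominated (bound := fun x => ‖f (x, r)‖) (fun L => ?_) (fun L => ?_)
    (sliceCLM r f).integrable.norm ?_
  · exact (by fun_prop : Continuous fun x => phase (L x) * f (x, r)).aestronglyMeasurable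
  · exact Eventually.of_forall fun x => by simp [norm_phase]
  · exact Eventually.of_forall fun x => by fun_prop

namespace Medium

variable (M : Medium) {Ψ : SpaceX → ℝ}

/-- The field at frequency `ω`, after propagation to the mean interface. -/
def pulse (Ψ : SpaceX → ℝ) (ω : ℝ) (u : Plane) : ℂ :=
  ∫ q, phase (ω * inner ℝ q u) * (M.propagator ω q M.zint * profileHat Ψ ω q)

lemma norm_propagator (ω : ℝ) (q : Plane) (z : ℝ) : ‖M.propagator ω q z‖ = 1 := norm_phase _

lemma pulse_neg (ω : ℝ) (u : Plane) :
    M.pulse Ψ (-ω) u = (starRingEnd ℂ) (M.pulse Ψ ω u) := by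
  unfold pulse
  rw [← integral_conj]
  congr 1; ext q
  rw [map_mul, map_mul, conj_phase, profileHat_neg, propagator_eq, propagator_eq, conj_phase]
  congr 2
  · ring
  · congr 1; ring

lemma pulse_eq_zero {ω : ℝ} (h : ∀ q, profileHat Ψ ω q = 0) (u : Plane) : M.pulse Ψ ω u = 0 := by
  simp [pulse, h]

/-- On bounded sets the propagator agrees with a Schwartz function of `(q, ω)`. -/
lemma exists_propagator_cutoff (R : ℝ) : ∃ F : 𝓢(Plane × ℝ, ℂ), ∀ q ω, ‖q‖ ≤ R → |ω| ≤ R →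
    F (q, ω) = M.propagator ω q M.zint := by
  have hR : 0 < max R 1 := lt_max_of_lt_right one_pos
  let χ : ContDiffBump (0 : Plane × ℝ) := ⟨max R 1, max R 1 + 1, hR, by linarith⟩
  have hsm : ContDiff ℝ (⊤ : ℕ∞) (fun x : Plane × ℝ =>
      (χ x : ℂ) * phase (-(x.2 * inner ℝ x.1 (M.offset x.1) / 2))) := by
    refine ContDiff.mul (Complex.ofRealCLM.contDiff.comp χ.contDiff) (contDiff_phase.comp ?_)
    exact ((contDiff_snd.mul (contDiff_fst.inner ℝ
      (M.offset.contDiff.comp contDiff_fst))).div_const 2).neg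
  have hc : HasCompactSupport (fun x : Plane × ℝ =>
      (χ x : ℂ) * phase (-(x.2 * inner ℝ x.1 (M.offset x.1) / 2))) :=
    HasCompactSupport.mul_right (χ.hasCompactSupport.comp_left Complex.ofReal_zero)
  refine ⟨hc.toSchwartzMap hsm, fun q ω hq hω => ?_⟩
  have h1 : χ (q, ω) = 1 := by
    apply χ.one_of_mem_closedBall
    rw [mem_closedBall_zero_iff, Prod.norm_def]
    exact max_le (hq.trans (le_max_left _ _)) (hω.trans (le_max_left _ _))
  change (χ (q, ω) : ℂ) * phase _ = _
  rw [h1, propagator_eq]; simp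

section Support

variable {a b κ : ℝ} (hs : ∀ ω k, profileHat Ψ ω k ≠ 0 → a ≤ |ω| ∧ |ω| ≤ b ∧ ‖k‖ ≤ κ)
include hs

lemma norm_pulse_integrand_le (ω : ℝ) (u q : Plane) :
    ‖phase (ω * inner ℝ q u) * (M.propagator ω q M.zint * profileHat Ψ ω q)‖ ≤
      (Metric.closedBall (0 : Plane) κ).indicator (fun _ => ∫ a, ‖Ψ a‖) q := by
  rw [norm_phase_mul, norm_mul, norm_propagator, one_mul]
  by_cases hq : q ∈ Metric.closedBall (0 : Plane) κ
  · rw [Set.indicator_of_mem hq]; exact norm_profileHat_le ω q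
  · rw [Set.indicator_of_notMem hq, norm_le_zero_iff]
    by_contra h
    exact hq (mem_closedBall_zero_iff.2 (hs ω q h).2.2)

omit hs in
lemma integrable_indicator_ball (κ c : ℝ) :
    Integrable ((Metric.closedBall (0 : Plane) κ).indicator fun _ => c) :=
  (integrable_indicator_iff Metric.isClosed_closedBall.measurableSet).2
    (integrableOn_const (isCompact_closedBall _ _).measure_lt_top.ne)

omit hs in
lemma continuous_propagator : Continuous fun z : ℝ × Plane => M.propagator z.1 z.2 M.zint := by
  simp only [propagator_eq]; fun_prop

lemma continuous_pulse (hΨ : Integrable Ψ) :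
    Continuous fun z : SpaceX => M.pulse Ψ z.1 z.2 := by
  have h1 := continuous_profileHat hΨ
  have h2 := M.continuous_propagator
  refine continuous_of_dominated (fun z => ?_)
    (fun z => Eventually.of_forall fun q => M.norm_pulse_integrand_le hs z.1 z.2 q)
    (integrable_indicator_ball κ _) (Eventually.of_forall fun q => ?_)
  · refine Continuous.aestronglyMeasurable ?_
    exact (by fun_prop : Continuous fun q => phase (z.1 * inner ℝ q z.2)).mul
      ((h2.comp (by fun_prop : Continuous fun q : Plane => (z.1, q))).mul
      (h1.comp (by fun_prop : Continuous fun q : Plane => (z.1, q))))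
  · exact (by fun_prop : Continuous fun z : SpaceX => phase (z.1 * inner ℝ q z.2)).mul
      ((h2.comp (by fun_prop : Continuous fun z : SpaceX => (z.1, q))).mul
      (h1.comp (by fun_prop : Continuous fun z : SpaceX => (z.1, q))))

lemma exists_norm_pulse_le : ∃ C, ∀ ω u, ‖M.pulse Ψ ω u‖ ≤ C := by
  refine ⟨∫ q, (Metric.closedBall (0 : Plane) κ).indicator (fun _ => ∫ a, ‖Ψ a‖) q, fun ω u => ?_⟩
  exact norm_integral_le_of_norm_le (integrable_indicator_ball κ _)
    (Eventually.of_forall fun q => M.norm_pulse_integrand_le hs ω u q)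

/-- The pulse is a convolution of the source profile, transformed in time, with the Fourier
transform of a cut-off propagator; the cut-off is invisible on the support of the source. -/
lemma pulse_eq_conv (hΨ : Integrable Ψ) {F : 𝓢(Plane × ℝ, ℂ)} {ω : ℝ}
    (hF : ∀ q, ‖q‖ ≤ κ → F (q, ω) = M.propagator ω q M.zint) (u : Plane) :
    M.pulse Ψ ω u = ∫ x : SpaceX, ((Ψ x : ℂ) * phase (ω * x.1)) *
      partialFourier F (ω • innerSL ℝ (u - x.2)) ω := by
  have e1 : M.pulse Ψ ω u = ∫ q, ∫ x : SpaceX,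
      F (q, ω) * (Ψ x : ℂ) * phase (ω * inner ℝ q u + ω * (x.1 - inner ℝ q x.2)) := by
    refine integral_congr_ae (Eventually.of_forall fun q => ?_)
    simp only
    by_cases hq : ‖q‖ ≤ κ
    · rw [← hF q hq, profileHat, ← integral_const_mul, ← integral_const_mul]
      congr 1; ext x
      rw [phase_add]; ring
    · have h0 : profileHat Ψ ω q = 0 := by
        by_contra h; exact hq (hs ω q h).2.2
      rw [h0, mul_zero, mul_zero]
      have : (fun x : SpaceX => F (q, ω) * (Ψ x : ℂ) *
          phase (ω * inner ℝ q u + ω * (x.1 - inner ℝ q x.2))) = fun x =>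
          (F (q, ω) * phase (ω * inner ℝ q u)) * ((Ψ x : ℂ) * phase (ω * (x.1 - inner ℝ q x.2))) := by
        ext x; rw [phase_add]; ring
      rw [this, integral_const_mul]
      change 0 = _ * profileHat Ψ ω q
      rw [h0, mul_zero]
  rw [e1, integral_integral_swap]
  · refine integral_congr_ae (Eventually.of_forall fun x => ?_)
    simp only [partialFourier]
    rw [← integral_const_mul]
    congr 1; ext q
    have : ω * inner ℝ q u + ω * (x.1 - inner ℝ q x.2) =
        ω * x.1 + (ω • innerSL ℝ (u - x.2)) q := by
      simp only [smul_apply, innerSL_apply_apply, smul_eq_mul]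
      rw [real_inner_comm q, inner_sub_right]; ring
    rw [this, phase_add]; ring
  · have h := (sliceCLM ω F).integrable (μ := volume) |>.mul_prod (hΨ.ofReal (𝕜 := ℂ))
    refine (Integrable.phase_mul h (θ := fun p : Plane × SpaceX =>
      ω * inner ℝ p.1 u + ω * (p.2.1 - inner ℝ p.1 p.2.2)) (by fun_prop)).congr ?_
    exact Eventually.of_forall fun p => by simp [Function.uncurry]; ring

/-- Integrability of the pulse at a fixed frequency, with a bound of its `L¹` norm. The convolution
kernel of `pulse_eq_conv` is integrable as the Fourier transform of a Schwartz function. -/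
lemma exists_integral_norm_pulse_le (hΨ : Integrable Ψ) (ha : 0 < a) : ∃ K : ℝ → ℝ, Integrable K ∧
    ∀ ω, Integrable (M.pulse Ψ ω) ∧ ∫ u, ‖M.pulse Ψ ω u‖ ≤ K ω := by
  obtain ⟨F, hF⟩ := M.exists_propagator_cutoff (max b κ)
  let l : List Plane := [planeBasis 0, planeBasis 1]
  let T : 𝓢(Plane × ℝ, ℂ) := l.foldr (fun v g => oneSubSq ((v, 0) : Plane × ℝ) g) F
  have hT : Integrable (fun ω : ℝ => ∫ q : Plane, ‖T (q, ω)‖) := by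
    have := (T.integrable (μ := volume)).norm
    exact this.integral_prod_right
  refine ⟨fun ω => (∫ a, ‖Ψ a‖) * (a⁻¹ ^ 2 * (∫ v, planeDecay v)) * ∫ q : Plane, ‖T (q, ω)‖,
    hT.const_mul _, fun ω => ?_⟩
  have hnn : 0 ≤ ∫ q : Plane, ‖T (q, ω)‖ := integral_nonneg fun _ => norm_nonneg _
  have hΨn : 0 ≤ ∫ a, ‖Ψ a‖ := integral_nonneg fun _ => norm_nonneg _
  have hpd : 0 ≤ ∫ v, planeDecay v := integral_nonneg planeDecay_nonneg
  by_cases h0 : ∀ q, profileHat Ψ ω q = 0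
  · have : M.pulse Ψ ω = 0 := funext fun u => M.pulse_eq_zero h0 u
    rw [this]
    refine ⟨integrable_zero _ _ _, ?_⟩
    simp only [Pi.zero_apply, norm_zero, integral_zero]; positivity
  push Not at h0
  obtain ⟨q₀, hq₀⟩ := h0
  obtain ⟨h1, h2, -⟩ := hs ω q₀ hq₀
  have hω : ω ≠ 0 := by rintro rfl; simp at h1; linarith
  let k : Plane → ℂ := fun v => partialFourier F (ω • innerSL ℝ v) ω
  have hk : Continuous k := (continuous_partialFourier F ω).comp (by fun_prop)
  have hkb : ∀ v, ‖k v‖ ≤ (∫ q : Plane, ‖T (q, ω)‖) * planeDecay (ω • v) := by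
    intro v
    have h := norm_partialFourier_le_of_list l F (ω • innerSL ℝ v) ω
    simp only [l, List.map_cons, List.map_nil, List.prod_cons, List.prod_nil, mul_one,
      smul_apply, innerSL_apply_apply, smul_eq_mul, inner_planeBasis] at h
    have hp : 0 < (1 + (ω * v 0) ^ 2) * (1 + (ω * v 1) ^ 2) := by positivity
    rw [mul_comm, ← le_div_iff₀ hp] at h
    refine h.trans (le_of_eq ?_)
    simp [planeDecay, div_eq_mul_inv, mul_comm, T, l]
  have hdi : Integrable (fun v => (∫ q : Plane, ‖T (q, ω)‖) * planeDecay (ω • v)) :=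
    (integrable_planeDecay.comp_smul hω).const_mul _
  have hki : Integrable k := hdi.mono' hk.aestronglyMeasurable (Eventually.of_forall hkb)
  have hkn : ∫ v, ‖k v‖ ≤ (a⁻¹ ^ 2 * (∫ v, planeDecay v)) * ∫ q : Plane, ‖T (q, ω)‖ := by
    refine (integral_mono hki.norm hdi hkb).trans ?_
    rw [integral_const_mul, Measure.integral_comp_smul, finrank_euclideanSpace_fin, smul_eq_mul,
      mul_comm]
    gcongr
    rw [abs_of_nonneg (by positivity), ← inv_pow, ← sq_abs, abs_inv]
    gcongr
  have hf : Integrable (fun x : SpaceX => (Ψ x : ℂ) * phase (ω * x.1)) := by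
    refine (Integrable.phase_mul (hΨ.ofReal (𝕜 := ℂ))
      (θ := fun x : SpaceX => ω * x.1) (by fun_prop)).congr (Eventually.of_forall fun x => ?_)
    exact mul_comm _ _
  have hc := integral_norm_conv_le hf hk hki
  have e : M.pulse Ψ ω = fun u => ∫ x : SpaceX, ((Ψ x : ℂ) * phase (ω * x.1)) * k (u - x.2) :=
    funext fun u => M.pulse_eq_conv hs hΨ
      (fun q hq => hF q ω (hq.trans (le_max_right _ _)) (h2.trans (le_max_left _ _))) u
  rw [e]
  refine ⟨hc.1, hc.2.trans ?_⟩
  simp only [norm_mul, norm_phase, mul_one, Complex.norm_real]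
  rw [mul_assoc]
  gcongr

/-- The pulse is jointly integrable in frequency and position. -/
lemma integrable_pulse (hΨ : Integrable Ψ) (ha : 0 < a) :
    Integrable (fun z : SpaceX => M.pulse Ψ z.1 z.2) := by
  obtain ⟨K, hK, h⟩ := M.exists_integral_norm_pulse_le hs hΨ ha
  have hm := (M.continuous_pulse hs hΨ).aestronglyMeasurable (μ := volume)
  rw [Measure.volume_eq_prod] at hm ⊢
  rw [integrable_prod_iff hm]
  refine ⟨Eventually.of_forall fun ω => (h ω).1, hK.mono' hm.norm.integral_prod_right' ?_⟩
  refine Eventually.of_forall fun ω => ?_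
  rw [Real.norm_of_nonneg (integral_nonneg fun _ => norm_nonneg _)]
  exact (h ω).2

end Support

end Medium
end Speckle

namespace Speckle

/-! ### Plancherel's identity for integrable functions -/

section Plancherel

open FourierTransform

variable {V : Type*} [NormedAddCommGroup V] [InnerProductSpace ℝ V] [MeasurableSpace V]
  [BorelSpace V] [FiniteDimensional ℝ V]

/-- Fourier inversion without continuity, tested against smooth functions. -/
lemma fourierInv_fourier_ae_eq {f : V → ℂ} (hf : Integrable f) (hf' : Integrable (𝓕 f)) :
    ∀ᵐ x, (𝓕⁻ (𝓕 f)) x = f x := by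
  have hcont : Continuous (𝓕⁻ (𝓕 f)) := by
    rw [show 𝓕⁻ (𝓕 f) = fun x => 𝓕 (𝓕 f) (-x) from funext fun x =>
      Real.fourierInv_eq_fourier_neg _ x]
    exact (VectorFourier.fourierIntegral_continuous Real.continuous_fourierChar
      (L := innerₗ V) continuous_inner hf').comp continuous_neg
  refine ae_eq_of_integral_contDiff_smul_eq hcont.locallyIntegrable hf.locallyIntegrable ?_
  intro g hg hgc
  have hG : HasCompactSupport (fun x => (g x : ℂ)) := hgc.comp_left Complex.ofReal_zero
  let G : 𝓢(V, ℂ) := hG.toSchwartzMap (Complex.ofRealCLM.contDiff.comp hg)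
  have hGx : ∀ x, G x = (g x : ℂ) := fun x => rfl
  have h1 : ∫ x, (𝓕 (𝓕⁻ G) x) • f x = ∫ x, (𝓕⁻ G x) • 𝓕 f x := by
    have h := VectorFourier.integral_fourierIntegral_smul_eq_flip (L := innerₗ V)
      Real.continuous_fourierChar continuous_inner ((𝓕⁻ G).integrable (μ := volume)) hf
    have e : (innerₗ V).flip = innerₗ V := by
      ext x y; simp
    rw [e] at h
    exact h
  have h2 : ∫ x, (𝓕⁻ (G : V → ℂ) x) • 𝓕 f x = ∫ x, G x • 𝓕⁻ (𝓕 f) x := by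
    have := VectorFourier.integral_fourierIntegral_smul_eq_flip (L := -innerₗ V)
      Real.continuous_fourierChar (continuous_inner.neg : Continuous fun p : V × V => -inner ℝ p.1 p.2)
      (G.integrable (μ := volume)) hf'
    have e : (-innerₗ V).flip = -innerₗ V := by
      ext x y; simp [real_inner_comm]
    rw [e] at this
    exact this
  rw [FourierTransform.fourier_fourierInv_eq, SchwartzMap.fourierInv_coe, h2] at h1
  simp only [hGx] at h1
  simpa using h1.symm

/-- Plancherel's identity for an integrable function with integrable Fourier transform. -/
lemma integral_norm_sq_fourier {f : V → ℂ} (hf : Integrable f) (hf' : Integrable (𝓕 f)) :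
    ∫ ξ, ‖𝓕 f ξ‖ ^ 2 = ∫ x, ‖f x‖ ^ 2 := by
  have h := VectorFourier.integral_sesq_fourierIntegral_eq_neg_flip (innerSL ℂ (E := ℂ))
    (L := innerₗ V) Real.continuous_fourierChar continuous_inner hf hf'
  have e : -(innerₗ V).flip = -innerₗ V := by
    ext x y; simp
  rw [e] at h
  have h' : ∫ ξ, inner ℂ (𝓕 f ξ) (𝓕 f ξ) = ∫ x, inner ℂ (f x) ((𝓕⁻ (𝓕 f)) x) := h
  have h3 : ∫ x, inner ℂ (f x) ((𝓕⁻ (𝓕 f)) x) = ∫ x, inner ℂ (f x) (f x) := by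
    refine integral_congr_ae ?_
    filter_upwards [fourierInv_fourier_ae_eq hf hf'] with x hx
    rw [hx]
  rw [h3] at h'
  have h4 : ∀ F : V → ℂ, ∫ x, inner ℂ (F x) (F x) = ((∫ x, ‖F x‖ ^ 2 : ℝ) : ℂ) := by
    intro F
    rw [← integral_complex_ofReal]
    congr 1; ext x
    rw [inner_self_eq_norm_sq_to_K]; simp
  rw [h4, h4] at h'
  exact_mod_cast h'

end Plancherel

lemma phaseFourier_eq (f : Plane → ℂ) (ω : ℝ) (k : Plane) :
    ∫ x, phase (ω * inner ℝ x k) * f x = FourierTransform.fourier f ((-(ω / (2 * Real.pi))) • k) := by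
  rw [Real.fourier_eq']
  congr 1; ext x
  rw [smul_eq_mul, phase, inner_smul_right]
  congr 3; field_simp [Real.pi_ne_zero]

/-- Plancherel's identity on the plane, for the kernel `e^{iω x·k}`. -/
lemma integral_norm_sq_phaseFourier {f : Plane → ℂ} (hf : Integrable f) {ω : ℝ} (hω : ω ≠ 0)
    (hf' : Integrable fun k => ∫ x, phase (ω * inner ℝ x k) * f x) :
    ∫ k, ‖∫ x, phase (ω * inner ℝ x k) * f x‖ ^ 2 =
      (2 * Real.pi) ^ 2 / ω ^ 2 * ∫ x, ‖f x‖ ^ 2 := by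
  have hc : -(ω / (2 * Real.pi)) ≠ 0 := by
    simp [hω, Real.pi_ne_zero]
  simp only [phaseFourier_eq] at hf' ⊢
  rw [integrable_comp_smul_iff volume _ hc] at hf'
  rw [Measure.integral_comp_smul volume (fun k => ‖FourierTransform.fourier f k‖ ^ 2),
    integral_norm_sq_fourier hf hf', finrank_euclideanSpace_fin, smul_eq_mul]
  congr 1
  rw [abs_of_nonneg (by positivity), neg_sq, div_pow, inv_div]

/-- An integrable function whose Fourier transform vanishes is zero almost everywhere. -/
lemma ae_eq_zero_of_phaseFourier {f : Plane → ℂ} (hf : Integrable f)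
    (h : ∀ k, ∫ x, phase (inner ℝ x k) * f x = 0) : ∀ᵐ x, f x = 0 := by
  have h0 : FourierTransform.fourier f = 0 := by
    funext k
    have := phaseFourier_eq f 1 ((-(2 * Real.pi)) • k)
    simp only [one_mul, h] at this
    rw [smul_smul, show -(1 / (2 * Real.pi)) * -(2 * Real.pi) = 1 by field_simp [Real.pi_ne_zero],
      one_smul] at this
    exact this.symm
  have h1 := fourierInv_fourier_ae_eq hf (by rw [h0]; exact integrable_zero _ _ _)
  filter_upwards [h1] with x hx
  rw [← hx, h0, Real.fourierInv_eq]; simp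

/-! ### The power spectrum of the source -/

section Power

variable {Ψ : SpaceX → ℝ} {a b κ : ℝ}

/-- The time-Fourier transform of the source profile. -/
def timeHat (Ψ : SpaceX → ℝ) (ω : ℝ) (x : Plane) : ℂ := ∫ s : ℝ, phase (ω * s) * (Ψ (s, x) : ℂ)

lemma integrable_phase_mul_profile (hΨ : Integrable Ψ) (ω : ℝ) :
    Integrable (fun p : ℝ × Plane => phase (ω * p.1) * (Ψ p : ℂ)) :=
  Integrable.phase_mul (hΨ.ofReal (𝕜 := ℂ)) (by fun_prop)

lemma integrable_timeHat (hΨ : Integrable Ψ) (ω : ℝ) : Integrable (timeHat Ψ ω) :=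
  (integrable_phase_mul_profile hΨ ω).integral_prod_right

lemma integral_phase_mul_timeHat (hΨ : Integrable Ψ) (ω : ℝ) (k : Plane) :
    ∫ x, phase (inner ℝ x k) * timeHat Ψ ω x =
      ∫ p : SpaceX, (Ψ p : ℂ) * phase (ω * p.1 + inner ℝ p.2 k) := by
  have hi : Integrable (fun p : ℝ × Plane => phase (inner ℝ p.2 k) * (phase (ω * p.1) * (Ψ p : ℂ))) :=
    Integrable.phase_mul (integrable_phase_mul_profile hΨ ω) (by fun_prop)
  have e : (fun p : SpaceX => (Ψ p : ℂ) * phase (ω * p.1 + inner ℝ p.2 k)) =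
      fun p : ℝ × Plane => phase (inner ℝ p.2 k) * (phase (ω * p.1) * (Ψ p : ℂ)) := by
    ext p; rw [phase_add]; ring
  rw [e]
  rw [Measure.volume_eq_prod] at hi ⊢
  rw [integral_prod_symm _ hi]
  simp only [timeHat, integral_const_mul]

lemma profileHat_eq (hΨ : Integrable Ψ) (ω : ℝ) (k : Plane) :
    profileHat Ψ ω k = ∫ x, phase (-ω * inner ℝ x k) * timeHat Ψ ω x := by
  have h := integral_phase_mul_timeHat hΨ ω ((-ω) • k)
  simp only [inner_smul_right] at h
  rw [h, profileHat]
  congr 1; ext p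
  rw [real_inner_comm]; congr 2; ring

variable (hs : ∀ ω k, profileHat Ψ ω k ≠ 0 → a ≤ |ω| ∧ |ω| ≤ b ∧ ‖k‖ ≤ κ)
include hs

lemma integrable_profileHat (hΨ : Integrable Ψ) (ω : ℝ) : Integrable (profileHat Ψ ω) := by
  refine (Medium.integrable_indicator_ball κ (∫ a, ‖Ψ a‖)).mono'
    ((continuous_profileHat hΨ).comp (by fun_prop :
      Continuous fun q : Plane => (ω, q))).aestronglyMeasurable (Eventually.of_forall fun q => ?_)
  by_cases hq : q ∈ Metric.closedBall (0 : Plane) κ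
  · rw [Set.indicator_of_mem hq]; exact norm_profileHat_le ω q
  · rw [Set.indicator_of_notMem hq, norm_le_zero_iff]
    by_contra h
    exact hq (mem_closedBall_zero_iff.2 (hs ω q h).2.2)

/-- The zero-frequency part of the source profile vanishes: the Fourier transform is continuous
and vanishes for small nonzero frequencies. -/
lemma timeHat_zero_ae (hΨ : Integrable Ψ) (ha : 0 < a) : ∀ᵐ x, timeHat Ψ 0 x = 0 := by
  refine ae_eq_zero_of_phaseFourier (integrable_timeHat hΨ 0) fun k => ?_
  rw [integral_phase_mul_timeHat hΨ]
  have hc : Continuous fun ω : ℝ => ∫ p : SpaceX, (Ψ p : ℂ) * phase (ω * p.1 + inner ℝ p.2 k) := by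
    refine continuous_of_dominated (bound := fun a => ‖Ψ a‖) (fun z => ?_) (fun z => ?_) hΨ.norm ?_
    · exact hΨ.ofReal.aestronglyMeasurable.mul (by fun_prop : Continuous _).aestronglyMeasurable
    · exact Eventually.of_forall fun a => by simp [norm_phase]
    · exact Eventually.of_forall fun a => by fun_prop
  refine tendsto_nhds_unique (f := fun ω : ℝ => ∫ p : SpaceX, (Ψ p : ℂ) *
    phase (ω * p.1 + inner ℝ p.2 k)) (l := 𝓝[≠] 0)
    ((hc.tendsto 0).mono_left nhdsWithin_le_nhds) (tendsto_const_nhds.congr' ?_)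
  have hU : ∀ᶠ ω : ℝ in 𝓝[≠] 0, |ω| < a :=
    nhdsWithin_le_nhds ((continuous_abs.tendsto' 0 0 abs_zero).eventually (gt_mem_nhds ha))
  filter_upwards [hU, self_mem_nhdsWithin] with ω hω hω0
  have h0 : profileHat Ψ ω ((-ω⁻¹) • k) = 0 := by
    by_contra h; exact absurd (hs ω _ h).1 (not_le.2 hω)
  rw [← h0, profileHat]
  congr 1; ext p
  rw [inner_smul_left, real_inner_comm]
  congr 2
  have : ω ≠ 0 := hω0
  simp; field_simp

/-- Plancherel's identity in the plane gives the two expressions of the power spectrum. At `ω = 0`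
the prefactor `ω²` vanishes, and so does the zero-frequency part of the profile. -/
lemma profilePower_eq (hΨ : Integrable Ψ) (ha : 0 < a) (ω : ℝ) :
    profilePower Ψ ω = ∫ x : Plane, ‖timeHat Ψ ω x‖ ^ 2 := by
  by_cases hω : ω = 0
  · subst hω
    have : ∫ x : Plane, ‖timeHat Ψ 0 x‖ ^ 2 = ∫ x : Plane, (0 : ℝ) := by
      refine integral_congr_ae ?_
      filter_upwards [timeHat_zero_ae hs hΨ ha] with x hx
      simp [hx]
    rw [this]; simp [profilePower]
  · have hi : Integrable fun k => ∫ x, phase (-ω * inner ℝ x k) * timeHat Ψ ω x := by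
      simp only [← profileHat_eq hΨ]; exact integrable_profileHat hs hΨ ω
    have h := integral_norm_sq_phaseFourier (integrable_timeHat hΨ ω) (neg_ne_zero.2 hω) hi
    simp only [← profileHat_eq hΨ] at h
    rw [profilePower, h, neg_sq]
    field_simp [Real.pi_ne_zero]

/-- Energy of the pulse at the interface: the propagator has modulus one, so it drops out of
Plancherel's identity. -/
lemma Medium.integral_norm_sq_pulse (M : Medium) (hΨ : Integrable Ψ) (ha : 0 < a) {ω : ℝ}
    (hω : ω ≠ 0) :
    ∫ u, ‖M.pulse Ψ ω u‖ ^ 2 = (2 * Real.pi) ^ 4 / ω ^ 4 * profilePower Ψ ω := by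
  have hf : Integrable fun q => M.propagator ω q M.zint * profileHat Ψ ω q := by
    simp only [M.propagator_eq]
    exact Integrable.phase_mul (integrable_profileHat hs hΨ ω) (by fun_prop)
  obtain ⟨K, -, hK⟩ := M.exists_integral_norm_pulse_le hs hΨ ha
  have h := integral_norm_sq_phaseFourier hf hω (hK ω).1
  have e : ∀ q, ‖M.propagator ω q M.zint * profileHat Ψ ω q‖ ^ 2 = ‖profileHat Ψ ω q‖ ^ 2 := by
    intro q; rw [norm_mul, M.norm_propagator, one_mul]
  simp only [e] at h
  change ∫ u, ‖M.pulse Ψ ω u‖ ^ 2 = _ at h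
  rw [h, profilePower]
  field_simp [Real.pi_ne_zero]

end Power

end Speckle

namespace Speckle

/-! ### The reflected field as an absolutely convergent integral -/

namespace Medium

variable (M : Medium) {Ψ : SpaceX → ℝ}

/-- The amplitude with which the frequency `ω` and the point `u` of the interface contribute to the
reflected field. -/
def amp (Ψ : SpaceX → ℝ) (z : SpaceX) : ℂ :=
  z.1 ^ 3 / (2 * Real.pi * Complex.I * Real.sqrt M.detOffset) * M.pulse Ψ z.1 z.2

lemma amp_neg (ω : ℝ) (u : Plane) : M.amp Ψ (-ω, u) = (starRingEnd ℂ) (M.amp Ψ (ω, u)) := by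
  simp only [amp, pulse_neg, map_mul, map_div₀, Complex.conj_I, Complex.conj_ofReal, map_pow]
  congr 1
  push_cast
  rw [show (starRingEnd ℂ) 2 = 2 from Complex.conj_ofNat 2]
  ring

/-- The scattering operator in the rescaled variable of the interface. -/
lemma scatteringOperator_eq {ε : ℝ} (hε : 0 < ε) (γ : ℝ) (f : Plane → ℝ) (τ ω : ℝ) (ψ : Plane → ℂ)
    (q : Plane) :
    M.scatteringOperator ε γ f τ ω ψ q = (ω ^ 2 / (2 * Real.pi) ^ 2 : ℝ) *
      ∫ u : Plane, phase (-(ω * inner ℝ q u)) *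
        (phase (ω * τ * f ((ε ^ γ)⁻¹ • (M.xInt + Real.sqrt ε • u))) *
          ∫ q' : Plane, phase (ω * inner ℝ q' u) * ψ q') := by
  have hs : 0 < Real.sqrt ε := Real.sqrt_pos.2 hε
  set g : Plane → ℂ := fun u => phase (-(ω * inner ℝ q u)) *
        (phase (ω * τ * f ((ε ^ γ)⁻¹ • (M.xInt + Real.sqrt ε • u))) *
          ∫ q' : Plane, phase (ω * inner ℝ q' u) * ψ q') with hg
  have h1 : ∫ x' : Plane, phase (-(ω * inner ℝ q (x' - M.xInt) / Real.sqrt ε)) *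
      phase (ω * τ * f ((ε ^ γ)⁻¹ • x')) *
        ∫ q' : Plane, phase (ω * inner ℝ q' (x' - M.xInt) / Real.sqrt ε) * ψ q' =
      ∫ x', g ((Real.sqrt ε)⁻¹ • (x' - M.xInt)) := by
    congr 1; ext x'
    simp only [hg, inner_smul_right, smul_inv_smul₀ hs.ne', add_sub_cancel, mul_assoc,
      mul_div_assoc]
    simp only [div_eq_inv_mul]
  rw [scatteringOperator, h1, integral_sub_right_eq_self (fun x => g ((Real.sqrt ε)⁻¹ • x)),
    Measure.integral_comp_smul, finrank_euclideanSpace_fin, abs_of_nonneg (by positivity),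
    inv_pow, inv_inv, Real.sq_sqrt hε.le, Complex.real_smul, ← mul_assoc]
  congr 1
  push_cast
  have : (ε : ℂ) ≠ 0 := by exact_mod_cast hε.ne'
  field_simp

section Field

variable {a b κ : ℝ} (hs : ∀ ω k, profileHat Ψ ω k ≠ 0 → a ≤ |ω| ∧ |ω| ≤ b ∧ ‖k‖ ≤ κ)
  (hΨ : Integrable Ψ) (ha : 0 < a)

include hs hΨ in
lemma continuous_amp : Continuous (M.amp Ψ) := by
  unfold amp
  exact (by fun_prop : Continuous fun z : SpaceX =>
    ((z.1 : ℂ) ^ 3 / (2 * Real.pi * Complex.I * Real.sqrt M.detOffset))).mul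
    (M.continuous_pulse hs hΨ)

include hs in
lemma amp_eq_zero {z : SpaceX} (h : ¬ (a ≤ |z.1| ∧ |z.1| ≤ b)) : M.amp Ψ z = 0 := by
  rw [amp, M.pulse_eq_zero, mul_zero]
  intro q
  by_contra hq
  exact h ⟨(hs _ q hq).1, (hs _ q hq).2.1⟩

include hs in
lemma norm_amp_le (z : SpaceX) :
    ‖M.amp Ψ z‖ ≤ (b ^ 3 / (2 * Real.pi * Real.sqrt M.detOffset)) * ‖M.pulse Ψ z.1 z.2‖ := by
  by_cases h : a ≤ |z.1| ∧ |z.1| ≤ b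
  · have : (0 : ℝ) < Real.sqrt M.detOffset := Real.sqrt_pos.2 M.detOffset_pos
    rw [amp, norm_mul]
    gcongr
    simp only [norm_div, norm_pow, norm_mul, Complex.norm_real, Complex.norm_I, mul_one,
      Complex.norm_ofNat, Real.norm_eq_abs, abs_of_pos Real.pi_pos, abs_of_pos this]
    gcongr
    exact h.2
  · have h0 := M.amp_eq_zero hs h
    rw [h0, norm_zero]
    by_cases hb : 0 ≤ b
    · positivity
    · have : M.pulse Ψ z.1 z.2 = 0 := by
        refine M.pulse_eq_zero (fun q => ?_) _
        by_contra hq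
        exact h ⟨(hs _ q hq).1, (hs _ q hq).2.1⟩
      rw [this]; simp

include hs hΨ ha in
lemma integrable_amp : Integrable (M.amp Ψ) :=
  ((M.integrable_pulse hs hΨ ha).norm.const_mul _).mono'
    (M.continuous_amp hs hΨ).aestronglyMeasurable (Eventually.of_forall fun z => M.norm_amp_le hs z)

include hs in
lemma exists_norm_amp_le : ∃ C, 0 ≤ C ∧ ∀ z, ‖M.amp Ψ z‖ ≤ C := by
  obtain ⟨C, hC⟩ := M.exists_norm_pulse_le hs
  have hC0 : 0 ≤ C := (norm_nonneg _).trans (hC 0 0)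
  have : (0 : ℝ) < Real.sqrt M.detOffset := Real.sqrt_pos.2 M.detOffset_pos
  refine ⟨(|b| ^ 3 / (2 * Real.pi * Real.sqrt M.detOffset)) * C, by positivity, fun z => ?_⟩
  refine (M.norm_amp_le hs z).trans ?_
  refine mul_le_mul ?_ (hC _ _) (norm_nonneg _) (by positivity)
  exact div_le_div_of_nonneg_right ((le_abs_self _).trans_eq (abs_pow b 3)) (by positivity)

/-- The part of the phase of the reflected field that comes from the interface fluctuations `f` and
from the propagation from the interface to the point at rescaled offset `X`. -/
def fieldPhase (f : Plane → ℝ) (X : Plane) (z : SpaceX) : ℝ :=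
  z.1 * (2 * M.s₀) * f z.2 + z.1 * M.dualForm (X - z.2) / 2

include hs hΨ ha in
/-- The regularised integral in `q`, computed after exchanging it with the integral over the
interface, converges by dominated convergence. -/
lemma tendsto_reg_reflIntegrand {ε : ℝ} (hε : 0 < ε) (γ : ℝ) {f : Plane → ℝ} (hf : Continuous f)
    (x : Plane) (ω : ℝ) :
    Tendsto (fun δ : ℝ => ∫ q, (Real.exp (-δ * ‖q‖ ^ 2) : ℂ) * M.reflIntegrand Ψ ε γ f x ω q)
      (𝓝[>] 0) (𝓝 ((ω ^ 2 / (2 * Real.pi) ^ 2 : ℝ) *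
        ∫ u, (M.fresnelConst ω * phase (M.fieldPhase
          (fun u => f ((ε ^ γ)⁻¹ • (M.xInt + Real.sqrt ε • u)))
          ((Real.sqrt ε)⁻¹ • (x - M.xObs)) (ω, u))) * M.pulse Ψ ω u)) := by
  set X := (Real.sqrt ε)⁻¹ • (x - M.xObs) with hX
  set F : Plane → ℝ := fun u => f ((ε ^ γ)⁻¹ • (M.xInt + Real.sqrt ε • u)) with hF
  have hFc : Continuous F := hf.comp (by fun_prop)
  set h : Plane → ℂ := fun u => phase (ω * (2 * M.s₀) * F u) * M.pulse Ψ ω u with hh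
  have hhi : Integrable h := by
    obtain ⟨K, -, hK⟩ := M.exists_integral_norm_pulse_le hs hΨ ha
    exact Integrable.phase_mul (hK ω).1 (by fun_prop)
  have hrefl : ∀ q, M.reflIntegrand Ψ ε γ f x ω q = (ω ^ 2 / (2 * Real.pi) ^ 2 : ℝ) *
      ∫ u, phase (ω * inner ℝ q (X - u) - ω * inner ℝ q (M.offset q) / 2) * h u := by
    intro q
    rw [reflIntegrand, M.scatteringOperator_eq hε, propagator_eq, ← phase_add, mul_left_comm,
      ← integral_const_mul]
    congr 2; ext u
    rw [← mul_assoc, ← phase_add]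
    congr 2
    rw [hX, inner_sub_right q (_ • _), inner_smul_right]; ring
  by_cases hω : ω = 0
  · subst hω
    simp [hrefl]
  have hreg : ∀ δ : ℝ, 0 < δ → ∫ q, (Real.exp (-δ * ‖q‖ ^ 2) : ℂ) * M.reflIntegrand Ψ ε γ f x ω q =
      (ω ^ 2 / (2 * Real.pi) ^ 2 : ℝ) * ∫ u, M.fresnelReg δ ω (X - u) * h u := by
    intro δ hδ
    have hgauss : Integrable fun q : Plane => (Real.exp (-δ * ‖q‖ ^ 2) : ℂ) := by
      have := GaussianFourier.integrable_cexp_neg_mul_sq_norm_add (V := Plane) (b := (δ : ℂ))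
        (by simpa using hδ) 0 0
      refine this.congr (Eventually.of_forall fun q => ?_)
      simp
    have e1 : ∀ q : Plane, (Real.exp (-δ * ‖q‖ ^ 2) : ℂ) * M.reflIntegrand Ψ ε γ f x ω q =
        (ω ^ 2 / (2 * Real.pi) ^ 2 : ℝ) * ∫ u, (Real.exp (-δ * ‖q‖ ^ 2) : ℂ) *
          phase (ω * inner ℝ q (X - u) - ω * inner ℝ q (M.offset q) / 2) * h u := by
      intro q
      rw [hrefl, mul_left_comm, ← integral_const_mul]
      simp only [mul_assoc]
    simp only [e1]
    rw [integral_const_mul, integral_integral_swap]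
    · congr 2; ext u
      rw [fresnelReg, integral_mul_const]
    · refine (Integrable.phase_mul (hgauss.mul_prod hhi) (θ := fun p : Plane × Plane =>
        ω * inner ℝ p.1 (X - p.2) - ω * inner ℝ p.1 (M.offset p.1) / 2) (by fun_prop)).congr ?_
      exact Eventually.of_forall fun p => by simp only [Function.uncurry]; ring
  refine Tendsto.congr' (f₁ := fun δ => (ω ^ 2 / (2 * Real.pi) ^ 2 : ℝ) *
    ∫ u, M.fresnelReg δ ω (X - u) * h u) ?_ ?_
  · filter_upwards [self_mem_nhdsWithin] with δ hδ
    exact (hreg δ hδ).symm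
  refine Tendsto.const_mul _ ?_
  have hlim : ∫ u, (M.fresnelConst ω * phase (M.fieldPhase F X (ω, u))) * M.pulse Ψ ω u =
      ∫ u, (M.fresnelConst ω * phase (ω * M.dualForm (X - u) / 2)) * h u := by
    congr 1; ext u
    simp only [hh, fieldPhase, phase_add]; ring
  rw [hlim]
  refine tendsto_integral_filter_of_dominated_convergence
    (fun u => ‖M.fresnelConst ω‖ * ‖h u‖) ?_ ?_ (hhi.norm.const_mul _) ?_
  · filter_upwards [self_mem_nhdsWithin] with δ hδ
    refine AEStronglyMeasurable.mul ?_ hhi.aestronglyMeasurable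
    simp only [M.fresnelReg_eq hδ]
    refine Continuous.aestronglyMeasurable ?_
    refine continuous_finsetProd _ fun i _ => ?_
    refine continuous_const.mul (Complex.continuous_exp.comp ?_)
    refine Continuous.div_const ?_ _
    refine Continuous.pow ?_ _
    refine Continuous.mul (continuous_const.mul (Complex.continuous_ofReal.comp ?_)) continuous_const
    have : Continuous fun u : Plane => inner ℝ (M.eigBasis i) (X - u) := by fun_prop
    simpa only [OrthonormalBasis.repr_apply_apply] using this
  · filter_upwards [self_mem_nhdsWithin] with δ hδ
    refine Eventually.of_forall fun u => ?_
    rw [norm_mul]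
    gcongr
    exact M.norm_fresnelReg_le hω hδ _
  · exact Eventually.of_forall fun u => (M.tendsto_fresnelReg hω _).mul_const _

include hs hΨ ha in
/-- The integrand in `ω` is the partial integral over `u` of an integrable function of `(ω, u)`. -/
lemma reflFreqIntegrand_eq {ε : ℝ} (hε : 0 < ε) (γ : ℝ) {f : Plane → ℝ} (hf : Continuous f)
    (t : ℝ) (x : Plane) (ω : ℝ) :
    M.reflFreqIntegrand Ψ ε γ f t x ω =
      ∫ u, phase (-(ω * (t - 2 * M.s₀ * M.zint - inner ℝ x M.k₀) / ε) + M.fieldPhase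
          (fun u => f ((ε ^ γ)⁻¹ • (M.xInt + Real.sqrt ε • u)))
          ((Real.sqrt ε)⁻¹ • (x - M.xObs)) (ω, u)) * M.amp Ψ (ω, u) := by
  rw [reflFreqIntegrand, oscillatoryIntegral,
    (M.tendsto_reg_reflIntegrand hs hΨ ha hε γ hf x ω).limUnder_eq, ← integral_const_mul,
    ← integral_const_mul, ← integral_mul_const]
  congr 1; ext u
  rw [phase_add, amp, fresnelConst]
  by_cases hω : ω = 0
  · subst hω; simp
  have h1 : (ω : ℂ) ≠ 0 := by exact_mod_cast hω
  have h2 : ((Real.sqrt M.detOffset : ℝ) : ℂ) ≠ 0 := by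
    exact_mod_cast (Real.sqrt_pos.2 M.detOffset_pos).ne'
  have h3 : (Real.pi : ℂ) ≠ 0 := by exact_mod_cast Real.pi_ne_zero
  push_cast
  field_simp

include hs hΨ ha in
lemma integrable_field_integrand {θ : SpaceX → ℝ} (hθ : Measurable θ) :
    Integrable (fun z => phase (θ z) * M.amp Ψ z) :=
  Integrable.phase_mul (M.integrable_amp hs hΨ ha) hθ.aemeasurable

@[fun_prop]
lemma continuous_fieldPhase {f : Plane → ℝ} (hf : Continuous f) (X : Plane) :
    Continuous (M.fieldPhase f X) := by
  unfold fieldPhase; fun_prop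

include hs hΨ ha in
lemma integrable_reflFreqIntegrand {ε : ℝ} (hε : 0 < ε) (γ : ℝ) {f : Plane → ℝ} (hf : Continuous f)
    (t : ℝ) (x : Plane) : Integrable (M.reflFreqIntegrand Ψ ε γ f t x) := by
  have h : M.reflFreqIntegrand Ψ ε γ f t x = _ :=
    funext fun ω => M.reflFreqIntegrand_eq hs hΨ ha hε γ hf t x ω
  rw [h]
  have hf' : Continuous fun u => f ((ε ^ γ)⁻¹ • (M.xInt + Real.sqrt ε • u)) := hf.comp (by fun_prop)
  have hθ := M.continuous_fieldPhase hf' ((Real.sqrt ε)⁻¹ • (x - M.xObs))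
  exact (M.integrable_field_integrand hs hΨ ha (θ := fun z : SpaceX =>
    -(z.1 * (t - 2 * M.s₀ * M.zint - inner ℝ x M.k₀) / ε) + M.fieldPhase _ _ (z.1, z.2))
    ((by fun_prop : Continuous _).add hθ).measurable).integral_prod_left

include hs hΨ ha in
lemma uRef_eq {ε : ℝ} (hε : 0 < ε) (γ : ℝ) {f : Plane → ℝ} (hf : Continuous f)
    (t : ℝ) (x : Plane) :
    M.uRef Ψ ε γ f t x = (M.reflCoeff / (2 * (2 * Real.pi) ^ 3) : ℝ) *
      ∫ z : SpaceX, phase (-(z.1 * (t - 2 * M.s₀ * M.zint - inner ℝ x M.k₀) / ε) + M.fieldPhase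
          (fun u => f ((ε ^ γ)⁻¹ • (M.xInt + Real.sqrt ε • u)))
          ((Real.sqrt ε)⁻¹ • (x - M.xObs)) z) * M.amp Ψ z := by
  rw [uRef]
  congr 1
  have hf' : Continuous fun u => f ((ε ^ γ)⁻¹ • (M.xInt + Real.sqrt ε • u)) := hf.comp (by fun_prop)
  have hθ := M.continuous_fieldPhase hf' ((Real.sqrt ε)⁻¹ • (x - M.xObs))
  have hi := M.integrable_field_integrand hs hΨ ha (θ := fun z : SpaceX =>
    -(z.1 * (t - 2 * M.s₀ * M.zint - inner ℝ x M.k₀) / ε) + M.fieldPhase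
      (fun u => f ((ε ^ γ)⁻¹ • (M.xInt + Real.sqrt ε • u)))
          ((Real.sqrt ε)⁻¹ • (x - M.xObs)) z)
    ((by fun_prop : Continuous _).add hθ).measurable
  rw [Measure.volume_eq_prod] at hi ⊢
  rw [integral_prod _ hi]
  congr 1; ext ω
  exact M.reflFreqIntegrand_eq hs hΨ ha hε γ hf t x ω

/-- The deterministic part of the phase of the speckle profile at scale `η = ε^{γ - 1/2}`. -/
def specklePhase (η : ℝ) (p : SpaceXX) (q : SpaceX) (z : SpaceX) : ℝ :=
  -(z.1 * (p.1 / η ^ 2 + q.1)) + z.1 * M.dualForm (η⁻¹ • p.2.1 + p.2.2 + η • q.2 - z.2) / 2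

/-- The point of the rescaled interface above the centre of the illuminated area. -/
def centre (ε γ : ℝ) : Plane := (ε ^ γ)⁻¹ • M.xInt

include hs hΨ ha in
/-- The speckle profile as an absolutely convergent integral that depends on `ε` only through
`η = ε^{γ - 1/2}` and a translation of the fluctuations. -/
lemma speckle_eq {ε : ℝ} (hε : 0 < ε) (γ : ℝ) {f : Plane → ℝ} (hf : Continuous f)
    (p : SpaceXX) (q : SpaceX) {η : ℝ} (hη : η = ε ^ (γ - 1 / 2)) :
    M.speckle Ψ ε γ f p q = ((η⁻¹) ^ 2 * (M.reflCoeff / (2 * (2 * Real.pi) ^ 3)) : ℝ) *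
      ∫ z : SpaceX, phase (M.specklePhase η p q z +
        z.1 * (2 * M.s₀) * f (M.centre ε γ + η⁻¹ • z.2)) * M.amp Ψ z := by
  have hη0 : 0 < η := hη ▸ Real.rpow_pos_of_pos hε _
  have hsq : Real.sqrt ε = ε ^ (1 / 2 : ℝ) := Real.sqrt_eq_rpow ε
  have hs0 : 0 < Real.sqrt ε := Real.sqrt_pos.2 hε
  have r1 : ε ^ (1 - 2 * γ) = (η⁻¹) ^ 2 := by
    rw [hη, ← Real.rpow_neg hε.le, ← Real.rpow_natCast, ← Real.rpow_mul hε.le]; congr 1; push_cast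
    ring
  have r2 : ε ^ (1 - γ) = Real.sqrt ε * η⁻¹ := by
    rw [hη, hsq, ← Real.rpow_neg hε.le, ← Real.rpow_add hε]; congr 1; ring
  have r3 : ε ^ γ = Real.sqrt ε * η := by
    rw [hη, hsq, ← Real.rpow_add hε]; congr 1; ring
  have r4 : ε ^ (2 * (1 - γ)) = ε * (η⁻¹) ^ 2 := by
    rw [← r1]; nth_rewrite 2 [← Real.rpow_one ε]
    rw [← Real.rpow_add hε]; congr 1; ring
  rw [speckle, M.uRef_eq hs hΨ ha hε γ hf, r1, ← mul_assoc]
  push_cast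
  congr 1
  congr 1; ext z
  congr 2
  have eX : (Real.sqrt ε)⁻¹ • (M.obsPoint ε γ p.2.1 p.2.2 + ε ^ γ • q.2 - M.xObs) =
      η⁻¹ • p.2.1 + p.2.2 + η • q.2 := by
    rw [obsPoint, r2, r3, show M.xObs + (Real.sqrt ε * η⁻¹) • p.2.1 + Real.sqrt ε • p.2.2 +
      (Real.sqrt ε * η) • q.2 - M.xObs = Real.sqrt ε • (η⁻¹ • p.2.1 + p.2.2 + η • q.2) by
        simp only [mul_smul, smul_add]; abel, inv_smul_smul₀ hs0.ne']
  have eT : (M.obsTime ε γ p.1 p.2.1 p.2.2 q.2 + ε * q.1 - 2 * M.s₀ * M.zint -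
      inner ℝ (M.obsPoint ε γ p.2.1 p.2.2 + ε ^ γ • q.2) M.k₀) / ε = p.1 / η ^ 2 + q.1 := by
    have hk : M.tObs - 2 * M.s₀ * M.zint - inner ℝ M.xObs M.k₀ = 0 := by
      have h1 := M.s₀_sq
      have h2 := M.s₀_pos.ne'
      have h3 := M.c₀_pos.ne'
      rw [tObs, xObs, inner_smul_left, real_inner_self_eq_norm_sq]
      simp only [RCLike.conj_to_real]
      have h4 : ‖M.k₀‖ ^ 2 = 1 / M.c₀ ^ 2 - M.s₀ ^ 2 := by rw [h1]; field_simp; ring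
      rw [h4]; field_simp; ring
    have : M.obsTime ε γ p.1 p.2.1 p.2.2 q.2 + ε * q.1 - 2 * M.s₀ * M.zint -
        inner ℝ (M.obsPoint ε γ p.2.1 p.2.2 + ε ^ γ • q.2) M.k₀ =
        (M.tObs - 2 * M.s₀ * M.zint - inner ℝ M.xObs M.k₀) +
          ε * (η⁻¹ ^ 2 * p.1 + q.1) := by
      rw [obsTime, obsPoint, r4]
      simp only [inner_add_left, inner_smul_left, RCLike.conj_to_real]
      rw [real_inner_comm M.k₀ p.2.1, real_inner_comm M.k₀ p.2.2, real_inner_comm M.k₀ q.2, r2, r3]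
      ring
    rw [this, hk, zero_add, mul_div_cancel_left₀ _ hε.ne']
    field_simp
  have eV : (ε ^ γ)⁻¹ • (M.xInt + Real.sqrt ε • z.2) = M.centre ε γ + η⁻¹ • z.2 := by
    rw [smul_add, centre, smul_smul, r3]
    congr 2; field_simp
  rw [eX, mul_div_assoc, eT, fieldPhase, specklePhase, eV]
  ring

end Field

end Medium

end Speckle

namespace Speckle

/-! ### The mean correlation function -/

section Random

variable {Ω : Type*} [MeasurableSpace Ω]

/-- The mean `E[e^{iτ(ω₁V(y) - ω₂V(0))}]`. -/
def cohere (P : Measure Ω) (V : Ω → Plane → ℝ) (τ ω₁ ω₂ : ℝ) (y : Plane) : ℂ :=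
  ∫ w, phase (τ * (ω₁ * V w y - ω₂ * V w 0)) ∂P

variable {P : Measure Ω} [IsProbabilityMeasure P] {V : Ω → Plane → ℝ}

lemma norm_cohere_le (τ ω₁ ω₂ : ℝ) (y : Plane) : ‖cohere P V τ ω₁ ω₂ y‖ ≤ 1 := by
  refine (norm_integral_le_of_norm_le_const (C := 1)
    (Eventually.of_forall fun w => (norm_phase _).le)).trans ?_
  simp

variable (hVm : ∀ x, Measurable fun w => V w x) (hVc : ∀ w, Continuous (V w))

include hVm hVc in
lemma continuous_cohere (τ : ℝ) :
    Continuous fun q : ℝ × ℝ × Plane => cohere P V τ q.1 q.2.1 q.2.2 := by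
  refine continuous_of_dominated (bound := fun _ => (1 : ℝ)) (fun q => ?_) (fun q => ?_)
    (integrable_const _) (Eventually.of_forall fun w => ?_)
  · have := hVm q.2.2
    have := hVm 0
    exact (by fun_prop : Measurable _).aestronglyMeasurable
  · exact Eventually.of_forall fun w => (norm_phase _).le
  · have := hVc w
    fun_prop

omit [IsProbabilityMeasure P] in
include hVm in
/-- Stationarity removes the dependence on the absolute position. -/
lemma integral_phase_eq_cohere (hV : IsStationary P V) (τ ω₁ ω₂ : ℝ) (y₁ y₂ : Plane) :
    ∫ w, phase (τ * (ω₁ * V w y₁ - ω₂ * V w y₂)) ∂P = cohere P V τ ω₁ ω₂ (y₁ - y₂) := by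
  have hF : Measurable fun f : Plane → ℝ => phase (τ * (ω₁ * f (y₁ - y₂) - ω₂ * f 0)) := by
    have h1 := measurable_pi_apply (X := fun _ : Plane => ℝ) (y₁ - y₂)
    have h2 := measurable_pi_apply (X := fun _ : Plane => ℝ) 0
    exact measurable_phase.comp (((h1.const_mul _).sub (h2.const_mul _)).const_mul _)
  have h1 := integral_map (μ := P) (φ := V) (measurable_pi_lambda _ hVm).aemeasurable
    hF.aestronglyMeasurable
  have h2 := integral_map (μ := P) (φ := fun w x => V w (x + y₂))
    (measurable_pi_lambda _ fun x => hVm _).aemeasurable hF.aestronglyMeasurable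
  rw [hV y₂] at h2
  rw [cohere, ← h1, h2]
  simp

include hVm hVc in
lemma measurable_uncurry_field : Measurable fun q : Ω × Plane => V q.1 q.2 :=
  (measurable_uncurry_of_continuous_of_measurable (u := fun (x : Plane) w => V w x) hVc hVm).comp
    measurable_swap

namespace Medium

variable (M : Medium) {Ψ : SpaceX → ℝ} {a b κ : ℝ}
  (hs : ∀ ω k, profileHat Ψ ω k ≠ 0 → a ≤ |ω| ∧ |ω| ≤ b ∧ ‖k‖ ≤ κ)
  (hΨ : Integrable Ψ) (ha : 0 < a)

/-- The constant prefactor of the reflected field. -/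
def prefactor : ℝ := M.reflCoeff / (2 * (2 * Real.pi) ^ 3)

include hs hΨ ha in
/-- The speckle profile is real: its integral representation is invariant under `ω ↦ -ω`. -/
lemma conj_speckle {ε : ℝ} (hε : 0 < ε) (γ : ℝ) {f : Plane → ℝ} (hf : Continuous f)
    (p : SpaceXX) (q : SpaceX) :
    (starRingEnd ℂ) (M.speckle Ψ ε γ f p q) = M.speckle Ψ ε γ f p q := by
  rw [M.speckle_eq hs hΨ ha hε γ hf p q rfl, map_mul, Complex.conj_ofReal, ← integral_conj]
  congr 1
  have hmp : MeasurePreserving (fun z : SpaceX => ((-z.1, z.2) : SpaceX)) :=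
    (Measure.measurePreserving_neg (volume : Measure ℝ)).prod (MeasurePreserving.id volume)
  have hme : MeasurableEmbedding (fun z : SpaceX => ((-z.1, z.2) : SpaceX)) :=
    ((MeasurableEquiv.neg ℝ).prodCongr (MeasurableEquiv.refl Plane)).measurableEmbedding
  rw [← hmp.integral_comp hme]
  congr 1; ext z
  obtain ⟨ω, u⟩ := z
  rw [map_mul, conj_phase, amp_neg, Complex.conj_conj]
  congr 2
  simp only [specklePhase]; ring

/-- The phase difference in the product of two speckle profiles. -/
def corrPhase (η : ℝ) (m : SpaceXX × SpaceX × SpaceX) (zz : SpaceX × SpaceX) : ℝ :=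
  M.specklePhase η m.1 m.2.1 zz.1 - M.specklePhase η m.1 m.2.2 zz.2

@[fun_prop]
lemma continuous_corrPhase (η : ℝ) : Continuous fun q : (SpaceXX × SpaceX × SpaceX) ×
    (SpaceX × SpaceX) => M.corrPhase η q.1 q.2 := by
  unfold corrPhase specklePhase; fun_prop

/-- The product of the two amplitudes. -/
def ampProd (Ψ : SpaceX → ℝ) (zz : SpaceX × SpaceX) : ℂ :=
  M.amp Ψ zz.1 * (starRingEnd ℂ) (M.amp Ψ zz.2)

include hs hΨ ha in
lemma integrable_ampProd : Integrable (M.ampProd Ψ) := by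
  have h := M.integrable_amp hs hΨ ha
  have h2 : Integrable fun z => (starRingEnd ℂ) (M.amp Ψ z) :=
    (LinearIsometryEquiv.integrable_comp_iff (RCLike.conjLIE (K := ℂ))).2 h
  exact h.mul_prod h2

include hs hΨ in
lemma continuous_ampProd : Continuous (M.ampProd Ψ) := by
  have h := M.continuous_amp hs hΨ
  unfold ampProd
  exact (h.comp continuous_fst).mul (Complex.continuous_conj.comp (h.comp continuous_snd))

include hs hΨ ha in
lemma corr_eq {ε : ℝ} (hε : 0 < ε) (γ : ℝ) {f : Plane → ℝ} (hf : Continuous f)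
    (m : SpaceXX × SpaceX × SpaceX) {η : ℝ} (hη : η = ε ^ (γ - 1 / 2)) :
    M.corr Ψ ε γ f m = ((η⁻¹) ^ 4 * M.prefactor ^ 2 : ℝ) *
      ∫ zz : SpaceX × SpaceX, phase (M.corrPhase η m zz + 2 * M.s₀ *
        (zz.1.1 * f (M.centre ε γ + η⁻¹ • zz.1.2) - zz.2.1 * f (M.centre ε γ + η⁻¹ • zz.2.2))) *
        M.ampProd Ψ zz := by
  rw [corr, ← M.conj_speckle hs hΨ ha hε γ hf m.1 m.2.2, M.speckle_eq hs hΨ ha hε γ hf m.1 m.2.1 hη,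
    M.speckle_eq hs hΨ ha hε γ hf m.1 m.2.2 hη, map_mul, Complex.conj_ofReal, ← integral_conj,
    mul_mul_mul_comm, ← integral_prod_mul, prefactor]
  congr 1
  · push_cast; ring
  · rw [← Measure.volume_eq_prod]
    congr 1; ext zz
    rw [map_mul, conj_phase, mul_mul_mul_comm, ← phase_add, ampProd]
    congr 2
    simp only [corrPhase]; ring

include hs hΨ ha hVm hVc in
lemma integrable_corr_integrand {ε : ℝ} (γ η : ℝ) (m : SpaceXX × SpaceX × SpaceX) :
    Integrable (fun q : Ω × (SpaceX × SpaceX) => phase (M.corrPhase η m q.2 + 2 * M.s₀ *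
        (q.2.1.1 * V q.1 (M.centre ε γ + η⁻¹ • q.2.1.2) -
          q.2.2.1 * V q.1 (M.centre ε γ + η⁻¹ • q.2.2.2))) * M.ampProd Ψ q.2) (P.prod volume) := by
  refine Integrable.phase_mul ((M.integrable_ampProd hs hΨ ha).comp_snd P) ?_
  have hV := measurable_uncurry_field hVm hVc
  have h1 : Measurable fun q : Ω × (SpaceX × SpaceX) => V q.1 (M.centre ε γ + η⁻¹ • q.2.1.2) :=
    hV.comp (by fun_prop : Measurable fun q : Ω × (SpaceX × SpaceX) =>
      (q.1, M.centre ε γ + η⁻¹ • q.2.1.2))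
  have h2 : Measurable fun q : Ω × (SpaceX × SpaceX) => V q.1 (M.centre ε γ + η⁻¹ • q.2.2.2) :=
    hV.comp (by fun_prop : Measurable fun q : Ω × (SpaceX × SpaceX) =>
      (q.1, M.centre ε γ + η⁻¹ • q.2.2.2))
  have h3 : Measurable fun q : Ω × (SpaceX × SpaceX) => M.corrPhase η m q.2 :=
    (by fun_prop : Continuous fun zz => M.corrPhase η m zz).measurable.comp measurable_snd
  exact (by fun_prop : Measurable _).aemeasurable

include hs hΨ ha hVm hVc in
lemma integrable_corr {ε : ℝ} (hε : 0 < ε) (γ : ℝ) (m : SpaceXX × SpaceX × SpaceX) :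
    Integrable (fun w => M.corr Ψ ε γ (V w) m) P := by
  simp only [M.corr_eq hs hΨ ha hε γ (hVc _) m rfl]
  exact (M.integrable_corr_integrand hVm hVc hs hΨ ha γ _ m).integral_prod_left.const_mul _

/-- The deterministic weight of a pair of contributions to the mean correlation. -/
def weight (P : Measure Ω) (V : Ω → Plane → ℝ) (Ψ : SpaceX → ℝ) (η : ℝ) (zz : SpaceX × SpaceX) : ℂ :=
  M.ampProd Ψ zz * cohere P V (2 * M.s₀) zz.1.1 zz.2.1 (η⁻¹ • (zz.1.2 - zz.2.2))

include hs hΨ hVm hVc in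
lemma continuous_weight (η : ℝ) : Continuous (M.weight P V Ψ η) := by
  unfold weight
  exact (M.continuous_ampProd hs hΨ).mul ((continuous_cohere hVm hVc (2 * M.s₀)).comp
    (by fun_prop : Continuous fun zz : SpaceX × SpaceX =>
      (zz.1.1, zz.2.1, η⁻¹ • (zz.1.2 - zz.2.2))))

lemma norm_weight_le (η : ℝ) (zz : SpaceX × SpaceX) :
    ‖M.weight P V Ψ η zz‖ ≤ ‖M.amp Ψ zz.1‖ * ‖M.amp Ψ zz.2‖ := by
  rw [weight, norm_mul, ampProd, norm_mul, RCLike.norm_conj]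
  exact mul_le_of_le_one_right (by positivity) (norm_cohere_le _ _ _ _)

include hs hΨ ha hVm hVc in
lemma integrable_weight (η : ℝ) : Integrable (M.weight P V Ψ η) := by
  refine (M.integrable_ampProd hs hΨ ha).norm.mono'
    (M.continuous_weight hVm hVc hs hΨ η).aestronglyMeasurable (Eventually.of_forall fun zz => ?_)
  refine (M.norm_weight_le η zz).trans_eq ?_
  rw [ampProd, norm_mul, RCLike.norm_conj]

include hs hΨ ha hVm hVc in
/-- The translation by `centre` disappears from the mean by stationarity, which leaves `η` as the
only trace of `ε`. -/
lemma integral_corr_eq (hV : IsStationary P V) {ε : ℝ} (hε : 0 < ε) (γ : ℝ)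
    (m : SpaceXX × SpaceX × SpaceX) {η : ℝ} (hη : η = ε ^ (γ - 1 / 2)) :
    ∫ w, M.corr Ψ ε γ (V w) m ∂P = ((η⁻¹) ^ 4 * M.prefactor ^ 2 : ℝ) *
      ∫ zz : SpaceX × SpaceX, phase (M.corrPhase η m zz) * M.weight P V Ψ η zz := by
  simp only [M.corr_eq hs hΨ ha hε γ (hVc _) m hη]
  rw [integral_const_mul]
  congr 1
  rw [integral_integral_swap (M.integrable_corr_integrand hVm hVc hs hΨ ha γ _ m)]
  congr 1; ext zz
  simp only [phase_add]
  rw [integral_mul_const, integral_const_mul, integral_phase_eq_cohere hVm hV, weight]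
  rw [show M.centre ε γ + η⁻¹ • zz.1.2 - (M.centre ε γ + η⁻¹ • zz.2.2) =
    η⁻¹ • (zz.1.2 - zz.2.2) by rw [smul_sub]; abel]
  ring

include hs hΨ ha hVm hVc in
lemma continuous_integral_corr (hV : IsStationary P V) {ε : ℝ} (hε : 0 < ε) (γ : ℝ) :
    Continuous fun m => ∫ w, M.corr Ψ ε γ (V w) m ∂P := by
  simp only [fun m => M.integral_corr_eq hVm hVc hs hΨ ha hV hε γ m rfl]
  refine continuous_const.mul ?_
  have hw := M.continuous_weight (P := P) hVm hVc hs hΨ (ε ^ (γ - 1 / 2))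
  refine continuous_of_dominated (fun m => ?_) (fun m => Eventually.of_forall fun zz => ?_)
    (M.integrable_weight (P := P) hVm hVc hs hΨ ha (ε ^ (γ - 1 / 2))).norm
    (Eventually.of_forall fun zz => ?_)
  · exact (by fun_prop : Continuous fun zz => phase (M.corrPhase (ε ^ (γ - 1 / 2)) m zz) *
      M.weight P V Ψ (ε ^ (γ - 1 / 2)) zz).aestronglyMeasurable
  · rw [norm_phase_mul]
  · fun_prop

include hs hΨ ha hVm hVc in
lemma exists_norm_integral_corr_le (hV : IsStationary P V) {ε : ℝ} (hε : 0 < ε) (γ : ℝ) :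
    ∃ C, ∀ m, ‖∫ w, M.corr Ψ ε γ (V w) m ∂P‖ ≤ C := by
  refine ⟨‖(((ε ^ (γ - 1 / 2))⁻¹ ^ 4 * M.prefactor ^ 2 : ℝ) : ℂ)‖ *
    ∫ zz, ‖M.weight P V Ψ (ε ^ (γ - 1 / 2)) zz‖, fun m => ?_⟩
  rw [M.integral_corr_eq hVm hVc hs hΨ ha hV hε γ m rfl, norm_mul]
  gcongr
  refine (norm_integral_le_integral_norm _).trans (le_of_eq ?_)
  simp only [norm_phase_mul]

end Medium

end Random

end Speckle

namespace Speckle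

/-! ### Straightened test functions -/

/-- The space `ℝ² × (ℝ × ℝ²) × (ℝ × ℝ²)` of the variables `(y, (s̃₁, ỹ₁), (s̃₂, ỹ₂))`. -/
abbrev SpaceR : Type := Plane × SpaceX × SpaceX

/- Instance search does not assemble these by itself for the nested products below. -/

instance instIsAddHaarMeasureSpaceX : (volume : Measure SpaceX).IsAddHaarMeasure :=
  instIsAddHaarMeasureVolumeProd (A := ℝ) (B := Plane)

instance instIsAddHaarMeasurePairs : (volume : Measure (SpaceX × SpaceX)).IsAddHaarMeasure :=
  instIsAddHaarMeasureVolumeProd (A := SpaceX) (B := SpaceX)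

instance instIsAddHaarMeasureSpaceR : (volume : Measure SpaceR).IsAddHaarMeasure :=
  instIsAddHaarMeasureVolumeProd (A := Plane) (B := SpaceX × SpaceX)

instance instIsAddHaarMeasureStraight : (volume : Measure (SpaceX × SpaceR)).IsAddHaarMeasure :=
  instIsAddHaarMeasureVolumeProd (A := SpaceX) (B := SpaceR)

instance instIsAddHaarMeasurePlanes : (volume : Measure (Plane × Plane)).IsAddHaarMeasure :=
  instIsAddHaarMeasureVolumeProd (A := Plane) (B := Plane)

/- Instance search does not assemble these by itself for the nested products below. -/

instance instIsAddHaarMeasureSpaceXX : (volume : Measure SpaceXX).IsAddHaarMeasure :=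
  instIsAddHaarMeasureVolumeProd (A := ℝ) (B := Plane × Plane)

instance instIsAddHaarMeasureTest :
    (volume : Measure (SpaceXX × SpaceX × SpaceX)).IsAddHaarMeasure :=
  instIsAddHaarMeasureVolumeProd (A := SpaceXX) (B := SpaceX × SpaceX)

instance instHasTemperateGrowthStraight :
    (volume : Measure (SpaceX × SpaceR)).HasTemperateGrowth :=
  MeasureTheory.Measure.IsAddHaarMeasure.instHasTemperateGrowth

instance instHasTemperateGrowthTest :
    (volume : Measure (SpaceXX × SpaceX × SpaceX)).HasTemperateGrowth :=
  MeasureTheory.Measure.IsAddHaarMeasure.instHasTemperateGrowth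

namespace Medium

variable (M : Medium)

/-- The coordinates `s̄ = σ + s_p`, `ȳ = y_p`, in which the curve of the scattered directions is
`σ = 0`. -/
def straighten (x : SpaceX × SpaceR) : SpaceXX × SpaceX × SpaceX :=
  ((x.1.1 + M.speckleDelay x.1.2, M.speckleOffset x.1.2, x.2.1), x.2.2.1, x.2.2.2)

/-- `straighten` is the sum of a continuous linear map and of a quadratic one. -/
lemma straighten_hasTemperateGrowth : M.straighten.HasTemperateGrowth := by
  let A : SpaceX × SpaceR →L[ℝ] SpaceXX × SpaceX × SpaceX :=
    ((ContinuousLinearMap.fst ℝ ℝ Plane ∘L ContinuousLinearMap.fst ℝ SpaceX SpaceR).prod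
      ((M.offset ∘L ContinuousLinearMap.snd ℝ ℝ Plane ∘L
        ContinuousLinearMap.fst ℝ SpaceX SpaceR).prod
        (ContinuousLinearMap.fst ℝ Plane (SpaceX × SpaceX) ∘L
          ContinuousLinearMap.snd ℝ SpaceX SpaceR))).prod
      (ContinuousLinearMap.snd ℝ Plane (SpaceX × SpaceX) ∘L
          ContinuousLinearMap.snd ℝ SpaceX SpaceR)
  let p : SpaceX × SpaceR →L[ℝ] Plane :=
    ContinuousLinearMap.snd ℝ ℝ Plane ∘L ContinuousLinearMap.fst ℝ SpaceX SpaceR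
  let e : SpaceXX × SpaceX × SpaceX := ((1 / 2, 0, 0), 0, 0)
  have h1 : (fun x => inner ℝ (p x) (M.offset (p x))).HasTemperateGrowth :=
    (innerSL ℝ (E := Plane)).bilinear_hasTemperateGrowth p.hasTemperateGrowth
      (M.offset ∘L p).hasTemperateGrowth
  have h2 : (fun x => A x + inner ℝ (p x) (M.offset (p x)) • e).HasTemperateGrowth :=
    A.hasTemperateGrowth.add (h1.smul (Function.HasTemperateGrowth.const e))
  convert h2 using 1
  ext x <;> simp [straighten, A, p, e, speckleDelay_eq, offset_eq, div_eq_mul_inv]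

/-- `p` is recovered from `y_p` by a linear map, and then `σ` from `σ + s_p` at quadratic cost. -/
lemma norm_le_straighten : ∃ (k : ℕ) (C : ℝ), ∀ x, ‖x‖ ≤ C * (1 + ‖M.straighten x‖) ^ k := by
  refine ⟨2, 1 + ‖M.offsetInv‖, fun x => ?_⟩
  obtain ⟨⟨σ, p⟩, y, b₁, b₂⟩ := x
  set N := ‖M.straighten ((σ, p), y, b₁, b₂)‖ with hN
  have hN0 : 0 ≤ N := norm_nonneg _
  have hB : 0 ≤ ‖M.offsetInv‖ := norm_nonneg _
  have e : M.straighten ((σ, p), y, b₁, b₂) =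
    ((σ + M.speckleDelay p, M.offset p, y), b₁, b₂) := rfl
  rw [e] at hN
  simp only [Prod.norm_def] at hN
  have l1 : ‖σ + M.speckleDelay p‖ ≤ N := by rw [hN]; simp
  have l2 : ‖M.offset p‖ ≤ N := by rw [hN]; simp
  have l3 : ‖y‖ ≤ N := by rw [hN]; simp
  have l4 : max ‖b₁.1‖ ‖b₁.2‖ ≤ N := by
    rw [hN]; exact (le_max_left _ _).trans (le_max_right _ _)
  have l5 : max ‖b₂.1‖ ‖b₂.2‖ ≤ N := by
    rw [hN]; exact (le_max_right _ _).trans (le_max_right _ _)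
  have hp : ‖p‖ ≤ ‖M.offsetInv‖ * N := by
    calc ‖p‖ = ‖M.offsetInv (M.offset p)‖ := by rw [offsetInv_offset]
      _ ≤ ‖M.offsetInv‖ * ‖M.offset p‖ := M.offsetInv.le_opNorm _
      _ ≤ _ := by gcongr
  have hd : |M.speckleDelay p| ≤ ‖M.offsetInv‖ * N * N := by
    rw [speckleDelay_eq, abs_div, abs_two]
    have h1 := abs_real_inner_le_norm p (M.offset p)
    have h2 : ‖p‖ * ‖M.offset p‖ ≤ ‖M.offsetInv‖ * N * N := by gcongr
    have h3 : 0 ≤ ‖M.offsetInv‖ * N * N := by positivity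
    linarith
  have hσ : ‖σ‖ ≤ N + ‖M.offsetInv‖ * N * N := by
    have : σ = (σ + M.speckleDelay p) - M.speckleDelay p := by ring
    rw [this]
    exact (norm_sub_le _ _).trans (add_le_add l1 hd)
  have hbig : N ≤ (1 + ‖M.offsetInv‖) * (1 + N) ^ 2 := by
    nlinarith [mul_nonneg hB hN0, mul_nonneg hB (mul_nonneg hN0 hN0)]
  simp only [Prod.norm_def]
  refine max_le (max_le (hσ.trans ?_) (hp.trans ?_)) (max_le (l3.trans hbig)
    (max_le (l4.trans hbig) (l5.trans hbig)))
  · nlinarith [mul_nonneg hB hN0, mul_nonneg hB (mul_nonneg hN0 hN0)]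
  · nlinarith [mul_nonneg hB hN0, mul_nonneg hB (mul_nonneg hN0 hN0)]

/-- A test function in the straightened coordinates, again a Schwartz function. -/
def straightenCLM : 𝓢(SpaceXX × SpaceX × SpaceX, ℂ) →L[ℂ] 𝓢(SpaceX × SpaceR, ℂ) :=
  SchwartzMap.compCLM ℂ M.straighten_hasTemperateGrowth M.norm_le_straighten

lemma straightenCLM_apply (Φ : 𝓢(SpaceXX × SpaceX × SpaceX, ℂ)) (x : SpaceX × SpaceR) :
    M.straightenCLM Φ x = Φ (M.straighten x) := rfl

end Medium

/-- The linear form `(σ, p) ↦ -νσ + ξ·p` attached to `n = (ν, ξ)`. -/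
def freqForm (n : SpaceX) : SpaceX →L[ℝ] ℝ :=
  -(n.1 • ContinuousLinearMap.fst ℝ ℝ Plane) + innerSL ℝ n.2 ∘L ContinuousLinearMap.snd ℝ ℝ Plane

lemma freqForm_apply (n x : SpaceX) : freqForm n x = -(n.1 * x.1) + inner ℝ n.2 x.2 := by
  simp [freqForm]

/-- An integrable majorant on `ℝ × ℝ²`. -/
def freqDecay (n : SpaceX) : ℝ := (1 + n.1 ^ 2)⁻¹ * planeDecay n.2

lemma freqDecay_nonneg (n : SpaceX) : 0 ≤ freqDecay n :=
  mul_nonneg (by positivity) (planeDecay_nonneg _)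

lemma integrable_freqDecay : Integrable freqDecay :=
  integrable_inv_one_add_sq.mul_prod integrable_planeDecay

/-- The three coordinate directions of `ℝ × ℝ²`. -/
def freqDirs : List SpaceX := [(1, 0), (0, planeBasis 0), (0, planeBasis 1)]

/-- The operator `∏ᵢ (1 - ∂ᵢ²)` over the three coordinate directions of the first variable; its
image in `L¹` controls the partial Fourier transform. -/
def decayCLM : 𝓢(SpaceX × SpaceR, ℂ) →L[ℂ] 𝓢(SpaceX × SpaceR, ℂ) :=
  (oneSubSq ((((1, 0) : SpaceX), 0) : SpaceX × SpaceR)) ∘L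
    (oneSubSq ((((0, planeBasis 0) : SpaceX), 0) : SpaceX × SpaceR)) ∘L
    (oneSubSq ((((0, planeBasis 1) : SpaceX), 0) : SpaceX × SpaceR))

/-- The weight in the remaining variables of the bound on a partial Fourier transform. -/
def restWeight (f : 𝓢(SpaceX × SpaceR, ℂ)) (r : SpaceR) : ℝ := ∫ x, ‖decayCLM f (x, r)‖

lemma restWeight_nonneg (f : 𝓢(SpaceX × SpaceR, ℂ)) (r : SpaceR) : 0 ≤ restWeight f r :=
  integral_nonneg fun _ => norm_nonneg _

lemma integrable_restWeight (f : 𝓢(SpaceX × SpaceR, ℂ)) : Integrable (restWeight f) :=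
  ((decayCLM f).integrable (μ := volume)).norm.integral_prod_right

/-- The total mass of `restWeight` is an `L¹` norm of a Schwartz function, hence continuous in
`f`. -/
lemma integral_restWeight (f : 𝓢(SpaceX × SpaceR, ℂ)) :
    ∫ r, restWeight f r = ∫ x, ‖decayCLM f x‖ := by
  have h := ((decayCLM f).integrable (μ := (volume : Measure (SpaceX × SpaceR)))).norm
  exact (integral_prod_symm _ h).symm

lemma norm_partialFourier_freqForm_le (f : 𝓢(SpaceX × SpaceR, ℂ)) (n : SpaceX) (r : SpaceR) :
    ‖partialFourier f (freqForm n) r‖ ≤ freqDecay n * restWeight f r := by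
  have h := norm_partialFourier_le_of_list freqDirs f (freqForm n) r
  simp only [freqDirs, List.map_cons, List.map_nil, List.prod_cons, List.prod_nil, mul_one,
    freqForm_apply, mul_zero, neg_zero, zero_add, inner_zero_right, add_zero,
    inner_planeBasis, neg_sq] at h
  have hp : 0 < (1 + n.1 ^ 2) * ((1 + n.2 0 ^ 2) * (1 + n.2 1 ^ 2)) := by positivity
  rw [mul_comm, ← le_div_iff₀ hp] at h
  refine h.trans (le_of_eq ?_)
  rw [div_eq_mul_inv, mul_inv, mul_inv, mul_comm]
  rfl

lemma measurable_partialFourier_freqForm (f : 𝓢(SpaceX × SpaceR, ℂ)) :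
    Measurable fun q : SpaceX × SpaceR => partialFourier f (freqForm q.1) q.2 := by
  have : StronglyMeasurable fun q : SpaceX × SpaceR =>
      ∫ x : SpaceX, phase (freqForm q.1 x) * f (x, q.2) := by
    refine StronglyMeasurable.integral_prod_right
      (f := fun (q : SpaceX × SpaceR) (x : SpaceX) => phase (freqForm q.1 x) * f (x, q.2)) ?_
    refine Continuous.stronglyMeasurable ?_
    simp only [freqForm_apply]
    fun_prop
  exact this.measurable

end Speckle

namespace Speckle

/-! ### Changes of variables -/

namespace Medium

variable (M : Medium)

lemma measurePreserving_offset :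
    MeasurePreserving M.offset (ENNReal.ofReal M.detOffset • volume) volume := by
  refine ⟨M.offset.continuous.measurable, ?_⟩
  have h := Measure.map_linearMap_addHaar_eq_smul_addHaar (volume : Measure Plane)
    (f := M.offsetLin) (by rw [M.det_offset]; exact M.detOffset_pos.ne')
  have e : (⇑M.offset : Plane → Plane) = M.offsetLin := rfl
  rw [M.det_offset] at h
  rw [Measure.map_smul, e, h, smul_smul, ← ENNReal.ofReal_mul M.detOffset_pos.le,
    abs_of_pos (inv_pos.2 M.detOffset_pos), mul_inv_cancel₀ M.detOffset_pos.ne']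
  simp

lemma measurePreserving_straighten_fst :
    MeasurePreserving (fun x : SpaceX => ((x.1 + M.speckleDelay x.2, M.speckleOffset x.2) : SpaceX))
      (ENNReal.ofReal M.detOffset • volume) volume := by
  have h := M.measurePreserving_offset.skew_product (μc := (volume : Measure ℝ))
    (μd := (volume : Measure ℝ)) (g := fun p σ => σ + M.speckleDelay p)
    (by
      simp only [Function.uncurry_def, speckleDelay_eq]
      fun_prop)
    (Eventually.of_forall fun p => map_add_right_eq_self _ _)
  have h1 : MeasurePreserving (Prod.swap : ℝ × Plane → Plane × ℝ)
      (ENNReal.ofReal M.detOffset • volume)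
      ((ENNReal.ofReal M.detOffset • (volume : Measure Plane)).prod volume) := by
    rw [Measure.prod_smul_left]
    exact (Measure.measurePreserving_swap (μ := (volume : Measure ℝ))
      (ν := (volume : Measure Plane))).smul_measure _
  exact Measure.measurePreserving_swap.comp (h.comp h1)

/-- The Jacobian of the straightened coordinates is the constant determinant of `p ↦ y_p`. -/
lemma measurePreserving_straighten :
    MeasurePreserving M.straighten (ENNReal.ofReal M.detOffset • volume) volume := by
  have h1 := M.measurePreserving_straighten_fst.prod (MeasurePreserving.id (volume : Measure SpaceR))
  rw [Measure.prod_smul_left] at h1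
  have h2 := (volume_preserving_prodAssoc (α₁ := SpaceX) (β₁ := Plane) (γ₁ := SpaceX × SpaceX)).symm
  have h3 := (volume_preserving_prodAssoc (α₁ := ℝ) (β₁ := Plane) (γ₁ := Plane)).prod
    (MeasurePreserving.id (volume : Measure (SpaceX × SpaceX)))
  exact h3.comp (h2.comp h1)

lemma integral_straighten {F : SpaceXX × SpaceX × SpaceX → ℂ} (hF : Integrable F) :
    ∫ m, F m = M.detOffset * ∫ r, ∫ x, F (M.straighten (x, r)) := by
  have hmp := M.measurePreserving_straighten
  have h0 : ENNReal.ofReal M.detOffset ≠ 0 := by simpa using M.detOffset_pos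
  have hi : Integrable (fun q => F (M.straighten q)) := by
    have h := hmp.integrable_comp_of_integrable hF
    rwa [integrable_smul_measure h0 ENNReal.ofReal_ne_top] at h
  calc ∫ m, F m = ∫ q, F (M.straighten q) ∂(ENNReal.ofReal M.detOffset • volume) := by
        rw [← integral_map hmp.aemeasurable (by rw [hmp.map_eq]; exact hF.aestronglyMeasurable),
          hmp.map_eq]
    _ = M.detOffset * ∫ q, F (M.straighten q) := by
        rw [integral_smul_measure, ENNReal.toReal_ofReal M.detOffset_pos.le, Complex.real_smul]
    _ = _ := by
        congr 1
        exact integral_prod_symm _ hi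

end Medium

/-- The substitution `ω₂ = ω - η²ν`, `u = c - ω₂⁻¹(ωe - ηξ)`, of Jacobian `η⁴ / ω₂²`. It degenerates
at `ω₂ = 0`, where the integrand is assumed to vanish. -/
lemma integral_eq_integral_detuning {g : SpaceX → ℂ} (hg0 : ∀ z : SpaceX, z.1 = 0 → g z = 0)
    (hg : Integrable g) {η : ℝ} (hη : 0 < η) (ω : ℝ) (c e : Plane)
    (hi : Integrable fun n : SpaceX => ((((ω - η ^ 2 * n.1)⁻¹) ^ 2 : ℝ) : ℂ) *
      g (ω - η ^ 2 * n.1, c - (ω - η ^ 2 * n.1)⁻¹ • (ω • e - η • n.2))) :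
    ∫ z, g z = (η ^ 4 : ℝ) * ∫ n : SpaceX, ((((ω - η ^ 2 * n.1)⁻¹) ^ 2 : ℝ) : ℂ) *
      g (ω - η ^ 2 * n.1, c - (ω - η ^ 2 * n.1)⁻¹ • (ω • e - η • n.2)) := by
  have inner_subst : ∀ ω₂ : ℝ, ∫ u, g (ω₂, u) =
      (η ^ 2 : ℝ) * ∫ ξ : Plane, (((ω₂⁻¹) ^ 2 : ℝ) : ℂ) * g (ω₂, c - ω₂⁻¹ • (ω • e - η • ξ)) := by
    intro ω₂
    rcases eq_or_ne ω₂ 0 with h | h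
    · simp [hg0 (ω₂, _) h]
    · have h1 := Measure.integral_comp_smul (volume : Measure Plane)
        (fun v => g (ω₂, (c - ω₂⁻¹ • ω • e) + v)) (ω₂⁻¹ * η)
      rw [integral_add_left_eq_self (fun v => g (ω₂, v))] at h1
      have h2 : ∀ ξ : Plane, c - ω₂⁻¹ • (ω • e - η • ξ) =
          (c - ω₂⁻¹ • ω • e) + (ω₂⁻¹ * η) • ξ := by
        intro ξ; rw [smul_sub, mul_smul]; abel
      simp only [h2]
      rw [integral_const_mul, h1, finrank_euclideanSpace_fin, abs_of_nonneg (by positivity),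
        Complex.real_smul, ← mul_assoc, ← mul_assoc]
      norm_cast
      rw [show η ^ 2 * ω₂⁻¹ ^ 2 * ((ω₂⁻¹ * η) ^ 2)⁻¹ = 1 by field_simp]
      simp
  have outer_subst : ∀ F : ℝ → ℂ, ∫ ω₂, F ω₂ = (η ^ 2 : ℝ) * ∫ ν, F (ω - η ^ 2 * ν) := by
    intro F
    have h1 := Measure.integral_comp_mul_left (fun v => F (ω - v)) (η ^ 2)
    rw [integral_sub_left_eq_self, abs_of_nonneg (by positivity), Complex.real_smul] at h1
    rw [h1, ← mul_assoc]
    norm_cast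
    rw [mul_inv_cancel₀ (by positivity)]
    simp
  rw [Measure.volume_eq_prod, integral_prod _ hg, ← Measure.volume_eq_prod]
  simp only [inner_subst]
  rw [integral_const_mul, outer_subst]
  rw [Measure.volume_eq_prod] at hi ⊢
  rw [integral_prod _ hi, ← mul_assoc]
  congr 1
  norm_cast
  ring

end Speckle

namespace Speckle

/-! ### The mean correlation tested against a Schwartz function -/

lemma planeDecay_le_one (v : Plane) : planeDecay v ≤ 1 := by
  unfold planeDecay
  exact mul_le_one₀ (inv_le_one_of_one_le₀ (by nlinarith [sq_nonneg (v 0)])) (by positivity)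
    (inv_le_one_of_one_le₀ (by nlinarith [sq_nonneg (v 1)]))

lemma freqDecay_le_one (n : SpaceX) : freqDecay n ≤ 1 :=
  mul_le_one₀ (inv_le_one_of_one_le₀ (by nlinarith [sq_nonneg n.1])) (planeDecay_nonneg _)
    (planeDecay_le_one _)

section Random

variable {Ω : Type*} [MeasurableSpace Ω]
variable {P : Measure Ω} [IsProbabilityMeasure P] {V : Ω → Plane → ℝ}
variable (hVm : ∀ x, Measurable fun w => V w x) (hVc : ∀ w, Continuous (V w))

namespace Medium

variable (M : Medium) {Ψ : SpaceX → ℝ} {a b κ : ℝ}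
  (hs : ∀ ω k, profileHat Ψ ω k ≠ 0 → a ≤ |ω| ∧ |ω| ≤ b ∧ ‖k‖ ≤ κ)
  (hΨ : Integrable Ψ) (ha : 0 < a)

/-- The lever `y + ηỹ - u`: the rescaled observation point, without its part along `ȳ`, seen from
the point `u` of the pulse. -/
def lever (η : ℝ) (y : Plane) (q z : SpaceX) : Plane := y + η • q.2 - z.2

/-- The phase that remains in `corrPhase` once its dependence on the straightened coordinates
has been taken out. -/
def restPhase (η : ℝ) (r : SpaceR) (z₁ z₂ : SpaceX) : ℝ :=
  (z₁.1 * M.dualForm (lever η r.1 r.2.1 z₁) - z₂.1 * M.dualForm (lever η r.1 r.2.2 z₂)) / 2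
    - z₁.1 * r.2.1.1 + z₂.1 * r.2.2.1

/-- The variables `(ν, ξ)` dual to the straightened coordinates `(σ, p)`: the rescaled differences of
the two frequencies and of the two frequency-weighted levers. -/
def detuning (η : ℝ) (r : SpaceR) (z₁ z₂ : SpaceX) : SpaceX :=
  ((η ^ 2)⁻¹ * (z₁.1 - z₂.1),
    η⁻¹ • (z₁.1 • lever η r.1 r.2.1 z₁ - z₂.1 • lever η r.1 r.2.2 z₂))

@[fun_prop]
lemma continuous_lever (η : ℝ) {X : Type*} [TopologicalSpace X] {y : X → Plane} {q z : X → SpaceX}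
    (hy : Continuous y) (hq : Continuous q) (hz : Continuous z) :
    Continuous fun x => lever η (y x) (q x) (z x) := by
  unfold lever; fun_prop

@[fun_prop]
lemma continuous_restPhase (η : ℝ) {X : Type*} [TopologicalSpace X] {r : X → SpaceR}
    {z₁ z₂ : X → SpaceX} (hr : Continuous r) (h₁ : Continuous z₁) (h₂ : Continuous z₂) :
    Continuous fun x => M.restPhase η (r x) (z₁ x) (z₂ x) := by
  unfold restPhase; fun_prop

@[fun_prop]
lemma continuous_detuning (η : ℝ) {X : Type*} [TopologicalSpace X] {r : X → SpaceR}
    {z₁ z₂ : X → SpaceX} (hr : Continuous r) (h₁ : Continuous z₁) (h₂ : Continuous z₂) :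
    Continuous fun x => detuning η (r x) (z₁ x) (z₂ x) := by
  unfold detuning; fun_prop

/-- In the straightened coordinates the two terms quadratic in `p`, from the delay `s_p` and from
the propagation over `y_p`, cancel. -/
lemma specklePhase_straighten {η : ℝ} (σ : ℝ) (p y : Plane) (q z : SpaceX) :
    M.specklePhase η (σ + M.speckleDelay p, M.speckleOffset p, y) q z =
      -(z.1 * ((η ^ 2)⁻¹ * σ)) + η⁻¹ * (z.1 * inner ℝ p (lever η y q z)) +
      z.1 * M.dualForm (lever η y q z) / 2 - z.1 * q.1 := by
  have e : η⁻¹ • M.offset p + y + η • q.2 - z.2 = η⁻¹ • M.offset p + lever η y q z := by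
    rw [lever]; abel
  simp only [specklePhase, offset_eq, e]
  rw [M.dualForm_add, M.dualForm_smul, M.dualForm_offset, map_smul, M.offsetInv_offset,
    inner_smul_left, speckleDelay_eq]
  simp only [conj_trivial]
  rw [inv_pow]
  ring

/-- In the straightened coordinates the phase difference is affine in `(σ, p)`. -/
lemma corrPhase_straighten {η : ℝ} (x : SpaceX) (r : SpaceR) (z₁ z₂ : SpaceX) :
    M.corrPhase η (M.straighten (x, r)) (z₁, z₂) =
      freqForm (detuning η r z₁ z₂) x + M.restPhase η r z₁ z₂ := by
  simp only [corrPhase, straighten, specklePhase_straighten, freqForm_apply, detuning, restPhase,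
    real_inner_comm x.2, inner_smul_right, inner_sub_right]
  ring

lemma integral_phase_corrPhase_mul (η : ℝ) (Φ : 𝓢(SpaceXX × SpaceX × SpaceX, ℂ))
    (z₁ z₂ : SpaceX) :
    ∫ m, phase (M.corrPhase η m (z₁, z₂)) * Φ m = M.detOffset * ∫ r,
      partialFourier (M.straightenCLM Φ) (freqForm (detuning η r z₁ z₂)) r *
        phase (M.restPhase η r z₁ z₂) := by
  have hi : Integrable fun m => phase (M.corrPhase η m (z₁, z₂)) * Φ m := by
    refine Integrable.phase_mul Φ.integrable ?_
    exact (by fun_prop : Continuous fun m => M.corrPhase η m (z₁, z₂)).measurable.aemeasurable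
  rw [M.integral_straighten hi]
  congr 1
  congr 1; ext r
  rw [partialFourier, ← integral_mul_const]
  congr 1; ext x
  rw [corrPhase_straighten, phase_add, straightenCLM_apply]
  ring

/-- The integrand, over pairs of frequencies and positions and the remaining variables, of the
tested mean correlation. -/
def pairIntegrand (P : Measure Ω) (V : Ω → Plane → ℝ) (Ψ : SpaceX → ℝ) (η : ℝ)
    (f : 𝓢(SpaceX × SpaceR, ℂ)) (q : SpaceX × SpaceR) (z₂ : SpaceX) : ℂ :=
  M.weight P V Ψ η (q.1, z₂) * (partialFourier f (freqForm (detuning η q.2 q.1 z₂)) q.2 *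
    phase (M.restPhase η q.2 q.1 z₂))

lemma norm_pairIntegrand_le (η : ℝ) (f : 𝓢(SpaceX × SpaceR, ℂ)) (q : SpaceX × SpaceR)
    (z₂ : SpaceX) : ‖M.pairIntegrand P V Ψ η f q z₂‖ ≤
      ‖M.amp Ψ q.1‖ * restWeight f q.2 * ‖M.amp Ψ z₂‖ := by
  rw [pairIntegrand, norm_mul, norm_mul, norm_phase, mul_one]
  have h1 := M.norm_weight_le (P := P) (V := V) (Ψ := Ψ) η (q.1, z₂)
  have h2 := norm_partialFourier_freqForm_le f (detuning η q.2 q.1 z₂) q.2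
  have h3 : freqDecay (detuning η q.2 q.1 z₂) * restWeight f q.2 ≤ restWeight f q.2 :=
    mul_le_of_le_one_left (restWeight_nonneg _ _) (freqDecay_le_one _)
  calc _ ≤ ‖M.amp Ψ q.1‖ * ‖M.amp Ψ z₂‖ * restWeight f q.2 :=
        mul_le_mul h1 (h2.trans h3) (norm_nonneg _) (by positivity)
    _ = _ := by ring

include hs hΨ hVm hVc in
lemma measurable_pairIntegrand (η : ℝ) (f : 𝓢(SpaceX × SpaceR, ℂ)) :
    Measurable fun q : (SpaceX × SpaceR) × SpaceX => M.pairIntegrand P V Ψ η f q.1 q.2 := by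
  have c1 : Continuous fun q : (SpaceX × SpaceR) × SpaceX => q.1.1 := continuous_fst.fst
  have c2 : Continuous fun q : (SpaceX × SpaceR) × SpaceX => q.1.2 := continuous_fst.snd
  have c3 : Continuous fun q : (SpaceX × SpaceR) × SpaceX => q.2 := continuous_snd
  have h1 : Measurable fun q : (SpaceX × SpaceR) × SpaceX => M.weight P V Ψ η (q.1.1, q.2) :=
    ((M.continuous_weight hVm hVc hs hΨ η).comp (c1.prodMk c3)).measurable
  have h2 : Measurable fun q : (SpaceX × SpaceR) × SpaceX =>
      partialFourier f (freqForm (detuning η q.1.2 q.1.1 q.2)) q.1.2 :=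
    Measurable.comp (g := fun q : SpaceX × SpaceR => partialFourier f (freqForm q.1) q.2)
      (f := fun q : (SpaceX × SpaceR) × SpaceX => (detuning η q.1.2 q.1.1 q.2, q.1.2))
      (measurable_partialFourier_freqForm f)
      ((continuous_detuning η c2 c1 c3).measurable.prodMk c2.measurable)
  have h3 : Measurable fun q : (SpaceX × SpaceR) × SpaceX =>
      phase (M.restPhase η q.1.2 q.1.1 q.2) :=
    continuous_phase.measurable.comp (M.continuous_restPhase η c2 c1 c3).measurable
  exact h1.mul (h2.mul h3)

include hs hΨ ha hVm hVc in
lemma integrable_pairIntegrand (η : ℝ) (f : 𝓢(SpaceX × SpaceR, ℂ)) :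
    Integrable fun q : (SpaceX × SpaceR) × SpaceX => M.pairIntegrand P V Ψ η f q.1 q.2 := by
  have h := M.integrable_amp hs hΨ ha
  have hb : Integrable fun q : (SpaceX × SpaceR) × SpaceX =>
      ‖M.amp Ψ q.1.1‖ * restWeight f q.1.2 * ‖M.amp Ψ q.2‖ :=
    (h.norm.mul_prod (integrable_restWeight f)).mul_prod h.norm
  exact hb.mono' (M.measurable_pairIntegrand hVm hVc hs hΨ η f).aestronglyMeasurable
    (Eventually.of_forall fun q => M.norm_pairIntegrand_le η f q.1 q.2)

include hs hΨ ha hVm hVc in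
lemma integral_integral_corr_mul (hV : IsStationary P V) {ε : ℝ} (hε : 0 < ε) (γ : ℝ)
    {η : ℝ} (hη : η = ε ^ (γ - 1 / 2)) (Φ : 𝓢(SpaceXX × SpaceX × SpaceX, ℂ)) :
    ∫ m, (∫ w, M.corr Ψ ε γ (V w) m ∂P) * Φ m =
      ((η⁻¹) ^ 4 * M.prefactor ^ 2 * M.detOffset : ℝ) *
        ∫ q, ∫ z₂, M.pairIntegrand P V Ψ η (M.straightenCLM Φ) q z₂ := by
  have hw := M.integrable_weight (P := P) hVm hVc hs hΨ ha η
  have hI : Integrable (fun q : (SpaceXX × SpaceX × SpaceX) × (SpaceX × SpaceX) =>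
      phase (M.corrPhase η q.1 q.2) * (Φ q.1 * M.weight P V Ψ η q.2))
      ((volume : Measure (SpaceXX × SpaceX × SpaceX)).prod
        (volume : Measure (SpaceX × SpaceX))) :=
    Integrable.phase_mul (Φ.integrable.mul_prod hw)
      (M.continuous_corrPhase η).measurable.aemeasurable
  have h1 : ∀ m, (∫ w, M.corr Ψ ε γ (V w) m ∂P) * Φ m = ((η⁻¹) ^ 4 * M.prefactor ^ 2 : ℝ) *
      ∫ zz : SpaceX × SpaceX, phase (M.corrPhase η m zz) * (Φ m * M.weight P V Ψ η zz) := by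
    intro m
    rw [M.integral_corr_eq hVm hVc hs hΨ ha hV hε γ m hη, mul_assoc, ← integral_mul_const]
    congr 1; congr 1; ext zz; ring
  simp only [h1]
  rw [integral_const_mul, integral_integral_swap hI]
  have h2 : ∀ zz : SpaceX × SpaceX, ∫ m, phase (M.corrPhase η m zz) *
      (Φ m * M.weight P V Ψ η zz) = M.detOffset * ∫ r,
        M.pairIntegrand P V Ψ η (M.straightenCLM Φ) (zz.1, r) zz.2 := by
    intro zz
    simp only [← mul_assoc]
    rw [integral_mul_const, M.integral_phase_corrPhase_mul, mul_assoc, mul_comm _ (M.weight ..),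
      ← integral_const_mul]
    rfl
  simp only [h2]
  rw [integral_const_mul, ← mul_assoc, ← Complex.ofReal_mul]
  congr 1
  have hJ := M.integrable_pairIntegrand (P := P) hVm hVc hs hΨ ha η (M.straightenCLM Φ)
  have hmp : MeasurePreserving
      (fun q : (SpaceX × SpaceX) × SpaceR => (((q.1.1, q.2), q.1.2) : (SpaceX × SpaceR) × SpaceX)) := by
    have e1 := (volume_preserving_prodAssoc (α₁ := SpaceX) (β₁ := SpaceX) (γ₁ := SpaceR))
    have e2 := (MeasurePreserving.id (volume : Measure SpaceX)).prod
      (Measure.measurePreserving_swap (μ := (volume : Measure SpaceX))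
        (ν := (volume : Measure SpaceR)))
    have e3 := (volume_preserving_prodAssoc (α₁ := SpaceX) (β₁ := SpaceR) (γ₁ := SpaceX)).symm
    exact e3.comp (e2.comp e1)
  have hJ' := hmp.integrable_comp_of_integrable hJ
  calc _ = ∫ q : (SpaceX × SpaceX) × SpaceR,
        M.pairIntegrand P V Ψ η (M.straightenCLM Φ) (q.1.1, q.2) q.1.2 := (integral_prod _ hJ').symm
    _ = ∫ q : (SpaceX × SpaceR) × SpaceX,
        M.pairIntegrand P V Ψ η (M.straightenCLM Φ) q.1 q.2 := by
        rw [← hmp.map_eq, integral_map hmp.aemeasurable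
          (by rw [hmp.map_eq]; exact hJ.aestronglyMeasurable)]
    _ = _ := integral_prod _ hJ

end Medium
end Random
end Speckle

namespace Speckle

/-! ### The limit of the tested mean correlation -/

section Random

variable {Ω : Type*} [MeasurableSpace Ω]
variable {P : Measure Ω} [IsProbabilityMeasure P] {V : Ω → Plane → ℝ}
variable (hVm : ∀ x, Measurable fun w => V w x) (hVc : ∀ w, Continuous (V w))

namespace Medium

variable (M : Medium) {Ψ : SpaceX → ℝ} {a b κ : ℝ}
  (hs : ∀ ω k, profileHat Ψ ω k ≠ 0 → a ≤ |ω| ∧ |ω| ≤ b ∧ ‖k‖ ≤ κ)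
  (hΨ : Integrable Ψ) (ha : 0 < a)

/-- The second frequency, `ω₂ = ω - η²ν`. -/
def freqPartner (η : ℝ) (q : SpaceX × SpaceR) (n : SpaceX) : ℝ := q.1.1 - η ^ 2 * n.1

/-- The second pair `(ω₂, u₂)` as a function of the first one and of the dual variables. -/
def partner (η : ℝ) (q : SpaceX × SpaceR) (n : SpaceX) : SpaceX :=
  (freqPartner η q n, q.2.1 + η • q.2.2.2.2 -
    (freqPartner η q n)⁻¹ • (q.1.1 • lever η q.2.1 q.2.2.1 q.1 - η • n.2))

/-- The separation `(u₁ - u₂) / η`, in a form that makes sense at `η = 0`. -/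
def gap (η : ℝ) (q : SpaceX × SpaceR) (n : SpaceX) : Plane :=
  q.2.2.1.2 - q.2.2.2.2 +
    (freqPartner η q n)⁻¹ • ((η * n.1) • lever η q.2.1 q.2.2.1 q.1 - n.2)

/-- The integrand of the tested mean correlation in the dual variables, with the factor `ω₂⁻²` of
the Jacobian. It makes sense at `η = 0`, where it is the integrand of the limit. -/
def dualIntegrand (P : Measure Ω) (V : Ω → Plane → ℝ) (Ψ : SpaceX → ℝ)
    (f : 𝓢(SpaceX × SpaceR, ℂ)) (η : ℝ) (q : SpaceX × SpaceR) (n : SpaceX) : ℂ :=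
  partialFourier f (freqForm n) q.2 * (M.amp Ψ q.1 *
    (((((freqPartner η q n)⁻¹) ^ 2 : ℝ) : ℂ) * (starRingEnd ℂ) (M.amp Ψ (partner η q n))) *
    cohere P V (2 * M.s₀) q.1.1 (freqPartner η q n) (gap η q n)) *
    phase (M.restPhase η q.2 q.1 (partner η q n))

lemma lever_partner (η : ℝ) (q : SpaceX × SpaceR) (n : SpaceX) :
    lever η q.2.1 q.2.2.2 (partner η q n) =
      (freqPartner η q n)⁻¹ • (q.1.1 • lever η q.2.1 q.2.2.1 q.1 - η • n.2) := by
  exact sub_sub_cancel _ _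

/-- `partner` inverts `detuning`. -/
lemma detuning_partner {η : ℝ} (hη : η ≠ 0) (q : SpaceX × SpaceR) (n : SpaceX)
    (h : freqPartner η q n ≠ 0) : detuning η q.2 q.1 (partner η q n) = n := by
  rw [detuning, lever_partner]
  refine Prod.ext ?_ ?_
  · simp only [partner, freqPartner]
    field_simp
    ring
  · simp only [partner]
    rw [smul_smul (freqPartner η q n), mul_inv_cancel₀ h, one_smul, sub_sub_cancel, smul_smul,
      inv_mul_cancel₀ hη, one_smul]

lemma gap_eq {η : ℝ} (hη : η ≠ 0) (q : SpaceX × SpaceR) (n : SpaceX)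
    (h : freqPartner η q n ≠ 0) : η⁻¹ • (q.1.2 - (partner η q n).2) = gap η q n := by
  -- express both positions through the levers, `u = y + ηỹ - e`
  have e1 : q.1.2 = q.2.1 + η • q.2.2.1.2 - lever η q.2.1 q.2.2.1 q.1 := by
    rw [lever]; abel
  have e2 : lever η q.2.1 q.2.2.1 q.1 =
      (freqPartner η q n)⁻¹ • freqPartner η q n • lever η q.2.1 q.2.2.1 q.1 := by
    rw [smul_smul, inv_mul_cancel₀ h, one_smul]
  have e3 : freqPartner η q n • lever η q.2.1 q.2.2.1 q.1 =
    q.1.1 • lever η q.2.1 q.2.2.1 q.1 - η • (η * n.1) • lever η q.2.1 q.2.2.1 q.1 := by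
    rw [smul_smul, ← sub_smul, freqPartner]; congr 1; ring
  rw [e1, gap, partner]
  nth_rewrite 1 [e2]
  rw [e3]
  generalize lever η q.2.1 q.2.2.1 q.1 = e
  generalize (freqPartner η q n)⁻¹ = t
  have : η⁻¹ * η = 1 := inv_mul_cancel₀ hη
  match_scalars <;> field_simp <;> ring

lemma amp_eq_zero_of_freq_eq_zero {z : SpaceX} (h : z.1 = 0) : M.amp Ψ z = 0 := by
  simp [amp, h]

omit [IsProbabilityMeasure P] in
/-- `dualIntegrand` is `pairIntegrand` after the substitution of the dual variables. Where
`ω₂ = 0` both sides vanish, by the convention `0⁻¹ = 0`. -/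
lemma jacobian_mul_pairIntegrand {η : ℝ} (hη : η ≠ 0) (f : 𝓢(SpaceX × SpaceR, ℂ))
    (q : SpaceX × SpaceR) (n : SpaceX) :
    ((((freqPartner η q n)⁻¹) ^ 2 : ℝ) : ℂ) * M.pairIntegrand P V Ψ η f q (partner η q n) =
      M.dualIntegrand P V Ψ f η q n := by
  rcases eq_or_ne (freqPartner η q n) 0 with h | h
  · simp [dualIntegrand, h]
  · rw [pairIntegrand, dualIntegrand, weight, ampProd, detuning_partner hη q n h, gap_eq hη q n h]
    simp only [partner]
    ring

include hs ha in
/-- A majorant independent of `η`: the factor `ω₂⁻²` is bounded because the source has no frequency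
below `a`, and the Schwartz decay of the test function provides integrability in the dual
variables. -/
lemma exists_norm_dualIntegrand_le : ∃ C, 0 ≤ C ∧ ∀ (f : 𝓢(SpaceX × SpaceR, ℂ)) (η : ℝ)
    (q : SpaceX × SpaceR) (n : SpaceX), ‖M.dualIntegrand P V Ψ f η q n‖ ≤
      C * (‖M.amp Ψ q.1‖ * restWeight f q.2 * freqDecay n) := by
  obtain ⟨C, hC0, hC⟩ := M.exists_norm_amp_le hs
  refine ⟨(a⁻¹) ^ 2 * C, by positivity, fun f η q n => ?_⟩
  have h1 : ‖((((freqPartner η q n)⁻¹) ^ 2 : ℝ) : ℂ) *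
      (starRingEnd ℂ) (M.amp Ψ (partner η q n))‖ ≤ (a⁻¹) ^ 2 * C := by
    by_cases h : a ≤ |freqPartner η q n|
    · rw [norm_mul, RCLike.norm_conj, Complex.norm_real, norm_pow, norm_inv, Real.norm_eq_abs]
      gcongr
      exact hC _
    · rw [M.amp_eq_zero hs (z := partner η q n) (fun hh => h hh.1)]
      simp; positivity
  have h2 := norm_partialFourier_freqForm_le f n q.2
  have h3 := norm_cohere_le (P := P) (V := V) (2 * M.s₀) q.1.1 (freqPartner η q n) (gap η q n)
  rw [dualIntegrand, norm_mul _ (phase _), norm_phase, mul_one, norm_mul, norm_mul,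
    norm_mul (M.amp Ψ q.1)]
  have h4 : 0 ≤ freqDecay n * restWeight f q.2 :=
    mul_nonneg (freqDecay_nonneg _) (restWeight_nonneg _ _)
  calc _ ≤ (freqDecay n * restWeight f q.2) * (‖M.amp Ψ q.1‖ * ((a⁻¹) ^ 2 * C) * 1) := by
        gcongr
    _ = _ := by ring

include hs hΨ hVm hVc in
lemma measurable_dualIntegrand (f : 𝓢(SpaceX × SpaceR, ℂ)) (η : ℝ) :
    Measurable fun q : (SpaceX × SpaceR) × SpaceX => M.dualIntegrand P V Ψ f η q.1 q.2 := by
  have c1 : Measurable fun q : (SpaceX × SpaceR) × SpaceX => q.1.1 := measurable_fst.fst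
  have c2 : Measurable fun q : (SpaceX × SpaceR) × SpaceX => q.1.2 := measurable_fst.snd
  have c3 : Measurable fun q : (SpaceX × SpaceR) × SpaceX => q.2 := measurable_snd
  have c4 : Measurable fun q : (SpaceX × SpaceR) × SpaceX => freqPartner η q.1 q.2 := by
    unfold freqPartner
    exact c1.fst.sub (c3.fst.const_mul _)
  have c5 : Measurable fun q : (SpaceX × SpaceR) × SpaceX => lever η q.1.2.1 q.1.2.2.1 q.1.1 := by
    unfold lever
    exact (c2.fst.add (c2.snd.fst.snd.const_smul η)).sub c1.snd
  have c6 : Measurable fun q : (SpaceX × SpaceR) × SpaceX => partner η q.1 q.2 := by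
    unfold partner
    exact c4.prodMk ((c2.fst.add (c2.snd.snd.snd.const_smul η)).sub
      (c4.inv.smul ((c1.fst.smul c5).sub (c3.snd.const_smul η))))
  have c7 : Measurable fun q : (SpaceX × SpaceR) × SpaceX => gap η q.1 q.2 := by
    unfold gap
    exact (c2.snd.fst.snd.sub c2.snd.snd.snd).add
      (c4.inv.smul (((c3.fst.const_mul η).smul c5).sub c3.snd))
  have hamp := (M.continuous_amp hs hΨ).measurable
  have m1 : Measurable fun q : (SpaceX × SpaceR) × SpaceX =>
      partialFourier f (freqForm q.2) q.1.2 :=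
    Measurable.comp (g := fun q : SpaceX × SpaceR => partialFourier f (freqForm q.1) q.2)
      (f := fun q : (SpaceX × SpaceR) × SpaceX => (q.2, q.1.2))
      (measurable_partialFourier_freqForm f) (c3.prodMk c2)
  have m2 : Measurable fun q : (SpaceX × SpaceR) × SpaceX => M.amp Ψ q.1.1 := hamp.comp c1
  have m3 : Measurable fun q : (SpaceX × SpaceR) × SpaceX =>
      (starRingEnd ℂ) (M.amp Ψ (partner η q.1 q.2)) :=
    Complex.continuous_conj.measurable.comp (hamp.comp c6)
  have m4 : Measurable fun q : (SpaceX × SpaceR) × SpaceX =>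
      ((((freqPartner η q.1 q.2)⁻¹) ^ 2 : ℝ) : ℂ) :=
    Complex.measurable_ofReal.comp (c4.inv.pow_const 2)
  have m5 : Measurable fun q : (SpaceX × SpaceR) × SpaceX =>
      cohere P V (2 * M.s₀) q.1.1.1 (freqPartner η q.1 q.2) (gap η q.1 q.2) :=
    Measurable.comp (g := fun q : ℝ × ℝ × Plane => cohere P V (2 * M.s₀) q.1 q.2.1 q.2.2)
      (f := fun q : (SpaceX × SpaceR) × SpaceX =>
        (q.1.1.1, freqPartner η q.1 q.2, gap η q.1 q.2))
      (continuous_cohere hVm hVc _).measurable (c1.fst.prodMk (c4.prodMk c7))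
  have m6 : Measurable fun q : (SpaceX × SpaceR) × SpaceX =>
      phase (M.restPhase η q.1.2 q.1.1 (partner η q.1 q.2)) :=
    Measurable.comp (g := fun q : SpaceR × SpaceX × SpaceX =>
        phase (M.restPhase η q.1 q.2.1 q.2.2))
      (f := fun q : (SpaceX × SpaceR) × SpaceX => (q.1.2, q.1.1, partner η q.1 q.2))
      (by fun_prop : Continuous _).measurable (c2.prodMk (c1.prodMk c6))
  exact (m1.mul ((m2.mul (m4.mul m3)).mul m5)).mul m6

include hs hΨ ha in
lemma integrable_dualIntegrand_bound (f : 𝓢(SpaceX × SpaceR, ℂ)) :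
    Integrable fun q : (SpaceX × SpaceR) × SpaceX =>
      ‖M.amp Ψ q.1.1‖ * restWeight f q.1.2 * freqDecay q.2 :=
  ((M.integrable_amp hs hΨ ha).norm.mul_prod (integrable_restWeight f)).mul_prod
    integrable_freqDecay

include hs hΨ ha hVm hVc in
lemma integrable_dualIntegrand (f : 𝓢(SpaceX × SpaceR, ℂ)) (η : ℝ) :
    Integrable fun q : (SpaceX × SpaceR) × SpaceX => M.dualIntegrand P V Ψ f η q.1 q.2 := by
  obtain ⟨C, -, hC⟩ := M.exists_norm_dualIntegrand_le (P := P) (V := V) hs ha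
  exact ((M.integrable_dualIntegrand_bound hs hΨ ha f).const_mul C).mono'
    (M.measurable_dualIntegrand hVm hVc hs hΨ f η).aestronglyMeasurable
    (Eventually.of_forall fun q => hC f η q.1 q.2)

include hs hΨ ha hVm hVc in
lemma integral_pairIntegrand {η : ℝ} (hη : 0 < η) (f : 𝓢(SpaceX × SpaceR, ℂ))
    (q : SpaceX × SpaceR) :
    ∫ z₂, M.pairIntegrand P V Ψ η f q z₂ =
      (η ^ 4 : ℝ) * ∫ n, M.dualIntegrand P V Ψ f η q n := by
  have h0 : ∀ z : SpaceX, z.1 = 0 → M.pairIntegrand P V Ψ η f q z = 0 := by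
    intro z hz
    simp [pairIntegrand, weight, ampProd, M.amp_eq_zero_of_freq_eq_zero hz]
  have hm1 : Measurable fun z₂ => M.pairIntegrand P V Ψ η f q z₂ :=
    Measurable.comp (g := fun q : (SpaceX × SpaceR) × SpaceX => M.pairIntegrand P V Ψ η f q.1 q.2)
      (f := fun z => (q, z)) (M.measurable_pairIntegrand hVm hVc hs hΨ η f) measurable_prodMk_left
  have hm2 : Measurable fun n => M.dualIntegrand P V Ψ f η q n :=
    Measurable.comp (g := fun q : (SpaceX × SpaceR) × SpaceX => M.dualIntegrand P V Ψ f η q.1 q.2)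
      (f := fun z => (q, z)) (M.measurable_dualIntegrand hVm hVc hs hΨ f η) measurable_prodMk_left
  have h1 : Integrable fun z₂ => M.pairIntegrand P V Ψ η f q z₂ :=
    ((M.integrable_amp hs hΨ ha).norm.const_mul _).mono' hm1.aestronglyMeasurable
      (Eventually.of_forall fun z₂ => M.norm_pairIntegrand_le η f q z₂)
  obtain ⟨C, -, hC⟩ := M.exists_norm_dualIntegrand_le (P := P) (V := V) hs ha
  have h2 : Integrable fun n => M.dualIntegrand P V Ψ f η q n := by
    refine ((integrable_freqDecay.const_mul _).const_mul C).mono' hm2.aestronglyMeasurable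
      (Eventually.of_forall fun n => hC f η q n)
  have h3 := integral_eq_integral_detuning h0 h1 hη q.1.1 (q.2.1 + η • q.2.2.2.2)
    (lever η q.2.1 q.2.2.1 q.1)
  have h4 : ∀ n : SpaceX, ((((q.1.1 - η ^ 2 * n.1)⁻¹) ^ 2 : ℝ) : ℂ) *
      M.pairIntegrand P V Ψ η f q (q.1.1 - η ^ 2 * n.1, q.2.1 + η • q.2.2.2.2 -
        (q.1.1 - η ^ 2 * n.1)⁻¹ • (q.1.1 • lever η q.2.1 q.2.2.1 q.1 - η • n.2)) =
      M.dualIntegrand P V Ψ f η q n := fun n => M.jacobian_mul_pairIntegrand hη.ne' f q n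
  simp only [h4] at h3
  exact h3 h2

include hs hΨ ha hVm hVc in
lemma integral_integral_corr_mul_eq (hV : IsStationary P V) {ε : ℝ} (hε : 0 < ε) (γ : ℝ)
    (Φ : 𝓢(SpaceXX × SpaceX × SpaceX, ℂ)) :
    ∫ m, (∫ w, M.corr Ψ ε γ (V w) m ∂P) * Φ m = (M.prefactor ^ 2 * M.detOffset : ℝ) *
      ∫ q : (SpaceX × SpaceR) × SpaceX,
        M.dualIntegrand P V Ψ (M.straightenCLM Φ) (ε ^ (γ - 1 / 2)) q.1 q.2 := by
  have hη : 0 < ε ^ (γ - 1 / 2) := Real.rpow_pos_of_pos hε _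
  rw [M.integral_integral_corr_mul hVm hVc hs hΨ ha hV hε γ rfl]
  simp only [M.integral_pairIntegrand hVm hVc hs hΨ ha hη]
  rw [integral_const_mul, ← mul_assoc, ← Complex.ofReal_mul]
  congr 1
  · congr 1; field_simp
  · exact (integral_prod _ (M.integrable_dualIntegrand hVm hVc hs hΨ ha _ _)).symm

include hs hΨ hVm hVc in
lemma tendsto_dualIntegrand (f : 𝓢(SpaceX × SpaceR, ℂ)) (q : SpaceX × SpaceR) (n : SpaceX) :
    Tendsto (fun η => M.dualIntegrand P V Ψ f η q n) (𝓝 0)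
      (𝓝 (M.dualIntegrand P V Ψ f 0 q n)) := by
  -- `ω₂ → ω`, so only `ω = 0` could be singular, and there the first amplitude vanishes
  rcases eq_or_ne q.1.1 0 with h | h
  · simp [dualIntegrand, M.amp_eq_zero_of_freq_eq_zero h]
  have c1 : ContinuousAt (fun η => freqPartner η q n) 0 := by
    unfold freqPartner; fun_prop
  have h0 : freqPartner 0 q n ≠ 0 := by simpa [freqPartner] using h
  have c2 : ContinuousAt (fun η => (freqPartner η q n)⁻¹) 0 := c1.inv₀ h0
  have c3 : ContinuousAt (fun η => lever η q.2.1 q.2.2.1 q.1) 0 := by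
    unfold lever; fun_prop
  have c4 : ContinuousAt (fun η => partner η q n) 0 := by
    unfold partner; fun_prop
  have c5 : ContinuousAt (fun η => gap η q n) 0 := by
    unfold gap; fun_prop
  have m1 : ContinuousAt (fun η => M.amp Ψ (partner η q n)) 0 :=
    (M.continuous_amp hs hΨ).continuousAt.comp c4
  have m2 : ContinuousAt (fun η => (starRingEnd ℂ) (M.amp Ψ (partner η q n))) 0 :=
    Complex.continuous_conj.continuousAt.comp m1
  have m3 : ContinuousAt (fun η => cohere P V (2 * M.s₀) q.1.1 (freqPartner η q n)
      (gap η q n)) 0 :=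
    ContinuousAt.comp (g := fun q : ℝ × ℝ × Plane => cohere P V (2 * M.s₀) q.1 q.2.1 q.2.2)
      (f := fun η => (q.1.1, freqPartner η q n, gap η q n))
      (continuous_cohere hVm hVc _).continuousAt (by fun_prop)
  have m4 : ContinuousAt (fun η => phase (M.restPhase η q.2 q.1 (partner η q n))) 0 := by
    refine continuous_phase.continuousAt.comp ?_
    unfold restPhase lever
    fun_prop
  have m5 : ContinuousAt (fun η => ((((freqPartner η q n)⁻¹) ^ 2 : ℝ) : ℂ)) 0 :=
    Complex.continuous_ofReal.continuousAt.comp (c2.pow 2)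
  exact ((continuousAt_const.mul ((continuousAt_const.mul (m5.mul m2)).mul m3)).mul m4).tendsto

/-- The limit of the mean correlation tested against `Φ`, as an integral over the pulse, the
remaining variables and the dual variables. -/
def limitFunctional (P : Measure Ω) (V : Ω → Plane → ℝ) (Ψ : SpaceX → ℝ)
    (Φ : 𝓢(SpaceXX × SpaceX × SpaceX, ℂ)) : ℂ :=
  (M.prefactor ^ 2 * M.detOffset : ℝ) * ∫ q : (SpaceX × SpaceR) × SpaceX,
    M.dualIntegrand P V Ψ (M.straightenCLM Φ) 0 q.1 q.2

include hs hΨ ha hVm hVc in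
lemma tendsto_integral_corr_mul (hV : IsStationary P V) {γ : ℝ} (hγ : 1 / 2 < γ)
    (Φ : 𝓢(SpaceXX × SpaceX × SpaceX, ℂ)) :
    Tendsto (fun ε => ∫ m, (∫ w, M.corr Ψ ε γ (V w) m ∂P) * Φ m) (𝓝[>] 0)
      (𝓝 (M.limitFunctional P V Ψ Φ)) := by
  have hη : Tendsto (fun ε : ℝ => ε ^ (γ - 1 / 2)) (𝓝[>] 0) (𝓝 0) := by
    have h : 0 < γ - 1 / 2 := by linarith
    have := (Real.continuousAt_rpow_const 0 (γ - 1 / 2) (Or.inr h.le)).tendsto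
    rw [Real.zero_rpow h.ne'] at this
    exact this.mono_left nhdsWithin_le_nhds
  obtain ⟨C, -, hC⟩ := M.exists_norm_dualIntegrand_le (P := P) (V := V) hs ha
  have h1 : Tendsto (fun η => ∫ q : (SpaceX × SpaceR) × SpaceX,
      M.dualIntegrand P V Ψ (M.straightenCLM Φ) η q.1 q.2) (𝓝 0)
      (𝓝 (∫ q : (SpaceX × SpaceR) × SpaceX,
        M.dualIntegrand P V Ψ (M.straightenCLM Φ) 0 q.1 q.2)) :=
    tendsto_integral_filter_of_dominated_convergence _
      (Eventually.of_forall fun η =>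
        (M.measurable_dualIntegrand hVm hVc hs hΨ _ η).aestronglyMeasurable)
      (Eventually.of_forall fun η => Eventually.of_forall fun q => hC _ η q.1 q.2)
      ((M.integrable_dualIntegrand_bound hs hΨ ha (M.straightenCLM Φ)).const_mul C)
      (Eventually.of_forall fun q => M.tendsto_dualIntegrand hVm hVc hs hΨ _ q.1 q.2)
  refine ((h1.comp hη).const_mul ((M.prefactor ^ 2 * M.detOffset : ℝ) : ℂ)).congr' ?_
  filter_upwards [self_mem_nhdsWithin] with ε hε
  exact (M.integral_integral_corr_mul_eq hVm hVc hs hΨ ha hV hε γ Φ).symm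

include hs hΨ ha in
lemma exists_norm_limitFunctional_le : ∃ C, 0 ≤ C ∧ ∀ Φ : 𝓢(SpaceXX × SpaceX × SpaceX, ℂ),
    ‖M.limitFunctional P V Ψ Φ‖ ≤ C * ∫ x, ‖decayCLM (M.straightenCLM Φ) x‖ := by
  obtain ⟨C, hC0, hC⟩ := M.exists_norm_dualIntegrand_le (P := P) (V := V) hs ha
  refine ⟨‖((M.prefactor ^ 2 * M.detOffset : ℝ) : ℂ)‖ * (C * ((∫ z, ‖M.amp Ψ z‖) *
    ∫ n, freqDecay n)), ?_, fun Φ => ?_⟩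
  · have h1 : 0 ≤ ∫ z, ‖M.amp Ψ z‖ := integral_nonneg fun _ => norm_nonneg _
    have h2 : 0 ≤ ∫ n, freqDecay n := integral_nonneg fun _ => freqDecay_nonneg _
    positivity
  have hb := M.integrable_dualIntegrand_bound hs hΨ ha (M.straightenCLM Φ)
  have h : ‖∫ q : (SpaceX × SpaceR) × SpaceX,
      M.dualIntegrand P V Ψ (M.straightenCLM Φ) 0 q.1 q.2‖ ≤
      ∫ q : (SpaceX × SpaceR) × SpaceX,
        C * (‖M.amp Ψ q.1.1‖ * restWeight (M.straightenCLM Φ) q.1.2 * freqDecay q.2) :=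
    norm_integral_le_of_norm_le (hb.const_mul C) (Eventually.of_forall fun q => hC _ 0 q.1 q.2)
  have e1 : ∫ q : (SpaceX × SpaceR) × SpaceX,
      ‖M.amp Ψ q.1.1‖ * restWeight (M.straightenCLM Φ) q.1.2 * freqDecay q.2 =
      (∫ q : SpaceX × SpaceR, ‖M.amp Ψ q.1‖ * restWeight (M.straightenCLM Φ) q.2) *
        ∫ n, freqDecay n :=
    integral_prod_mul (μ := (volume : Measure (SpaceX × SpaceR))) (ν := (volume : Measure SpaceX))
      (fun q => ‖M.amp Ψ q.1‖ * restWeight (M.straightenCLM Φ) q.2) freqDecay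
  have e2 : ∫ q : SpaceX × SpaceR, ‖M.amp Ψ q.1‖ * restWeight (M.straightenCLM Φ) q.2 =
      (∫ z, ‖M.amp Ψ z‖) * ∫ r, restWeight (M.straightenCLM Φ) r :=
    integral_prod_mul (μ := (volume : Measure SpaceX)) (ν := (volume : Measure SpaceR))
      (fun z => ‖M.amp Ψ z‖) (restWeight (M.straightenCLM Φ))
  rw [integral_const_mul, e1, e2, integral_restWeight] at h
  rw [limitFunctional, norm_mul, mul_assoc]
  gcongr
  refine h.trans (le_of_eq ?_)
  ring

end Medium
end Random
end Speckle

namespace Speckle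

/-! ### Identification of the limit -/

section Inversion

open FourierTransform

/-- A Schwartz function of `(σ, p)` is dominated, uniformly in `σ`, by an integrable function of
`p`. -/
lemma exists_integrable_majorant (F : 𝓢(SpaceX, ℂ)) :
    ∃ g : Plane → ℝ, Integrable g ∧ ∀ σ p, ‖F (σ, p)‖ ≤ g p := by
  set C := 2 ^ 3 * (Finset.Iic ((3, 0) : ℕ × ℕ)).sup
    (fun m => SchwartzMap.seminorm ℂ m.1 m.2) F with hC
  refine ⟨fun p => C * (1 + ‖p‖) ^ (-(3 : ℝ)), ?_, fun σ p => ?_⟩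
  · refine (integrable_one_add_norm ?_).const_mul C
    rw [finrank_euclideanSpace_fin]; norm_num
  · have h := SchwartzMap.one_add_le_sup_seminorm_apply (𝕜 := ℂ) (m := (3, 0)) (k := 3) (n := 0)
      le_rfl le_rfl F (σ, p)
    rw [norm_iteratedFDeriv_zero] at h
    have h1 : (1 + ‖p‖) ^ 3 ≤ (1 + ‖((σ, p) : SpaceX)‖) ^ 3 := by
      gcongr
      exact le_max_right _ _
    have h2 : (0 : ℝ) < (1 + ‖p‖) ^ 3 := by positivity
    change ‖F (σ, p)‖ ≤ C * (1 + ‖p‖) ^ (-(3 : ℝ))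
    rw [Real.rpow_neg (by positivity), ← div_eq_mul_inv]
    have e : (1 + ‖p‖) ^ (3 : ℝ) = (1 + ‖p‖) ^ 3 := by norm_cast
    rw [e, le_div_iff₀ h2, mul_comm]
    exact (mul_le_mul_of_nonneg_right h1 (norm_nonneg _)).trans h

/-- Fourier inversion in the first variable: integrating over the frequency `ν` restricts to
`σ = 0`. -/
lemma integral_integral_phase_freqForm (F : 𝓢(SpaceX, ℂ)) (ξ : Plane)
    (hi : Integrable fun ν : ℝ => ∫ x, phase (freqForm (ν, ξ) x) * F x) :
    ∫ ν : ℝ, ∫ x, phase (freqForm (ν, ξ) x) * F x =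
      (2 * Real.pi : ℝ) * ∫ p, phase (inner ℝ ξ p) * F (0, p) := by
  -- `h` is continuous, so that the inversion formula holds at the point `σ = 0` itself
  let h : ℝ → ℂ := fun σ => ∫ p, phase (inner ℝ ξ p) * F (σ, p)
  have hint : Integrable fun x : SpaceX => phase (inner ℝ ξ x.2) * F x :=
    Integrable.phase_mul F.integrable (by fun_prop)
  have hh : Integrable h := hint.integral_prod_left
  have hc : Continuous h := by
    obtain ⟨g, hg, hgF⟩ := exists_integrable_majorant F
    refine continuous_of_dominated (bound := g) (fun σ => ?_)
      (fun σ => Eventually.of_forall fun p => ?_) hg (Eventually.of_forall fun p => ?_)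
    · exact (by fun_prop : Continuous fun p => phase (inner ℝ ξ p) * F (σ, p)).aestronglyMeasurable
    · rw [norm_phase_mul]; exact hgF σ p
    · fun_prop
  have e1 : ∀ ν : ℝ, ∫ x, phase (freqForm (ν, ξ) x) * F x = ∫ σ, phase (-(ν * σ)) * h σ := by
    intro ν
    have hI : Integrable fun x : SpaceX => phase (freqForm (ν, ξ) x) * F x :=
      Integrable.phase_mul F.integrable (by fun_prop)
    rw [Measure.volume_eq_prod] at hI ⊢
    rw [integral_prod _ hI]
    congr 1; ext σ
    rw [← integral_const_mul]
    congr 1; ext p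
    rw [freqForm_apply, phase_add, mul_assoc]
  have e2 : ∀ w : ℝ, 𝓕 h w = ∫ x, phase (freqForm ((2 * Real.pi) * w, ξ) x) * F x := by
    intro w
    rw [e1, Real.fourier_eq']
    congr 1; ext σ
    rw [smul_eq_mul, phase]
    congr 2
    simp
    ring
  have hi' : Integrable (𝓕 h) := by
    rw [show 𝓕 h = fun w : ℝ => ∫ x, phase (freqForm ((2 * Real.pi) * w, ξ) x) * F x from
      funext e2]
    exact hi.comp_mul_left' (by positivity)
  have h0 : 𝓕⁻ (𝓕 h) 0 = h 0 := hh.fourierInv_fourier_eq hi' hc.continuousAt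
  have e3 := Measure.integral_comp_mul_left
    (fun ν : ℝ => ∫ x, phase (freqForm (ν, ξ) x) * F x) (2 * Real.pi)
  rw [Real.fourierInv_eq'] at h0
  simp only [inner_zero_right, mul_zero, Complex.ofReal_zero, zero_mul, Complex.exp_zero,
    one_smul, e2] at h0
  rw [e3, abs_of_pos (by positivity), Complex.real_smul] at h0
  rw [show (∫ p, phase (inner ℝ ξ p) * F (0, p)) = h 0 from rfl, ← h0, ← mul_assoc]
  norm_cast
  rw [mul_inv_cancel₀ (by positivity)]
  simp

end Inversion

/-- The substitution `b₁ = b + b'`. -/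
lemma integral_eq_integral_difference {g : SpaceR → ℂ} (hg : Integrable g) :
    ∫ r, g r = ∫ b : SpaceX, ∫ r : Plane × SpaceX, g (r.1, b + r.2, r.2) := by
  have h1 : MeasurePreserving (fun q : (Plane × SpaceX) × SpaceX =>
      ((q.1, q.2 + q.1.2) : (Plane × SpaceX) × SpaceX)) :=
    (MeasurePreserving.id (volume : Measure (Plane × SpaceX))).skew_product
      (μc := (volume : Measure SpaceX)) (μd := (volume : Measure SpaceX))
      (g := fun r b => b + r.2) (by simp only [Function.uncurry_def]; fun_prop)
      (Eventually.of_forall fun r => map_add_right_eq_self _ _)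
  have h2 : MeasurePreserving (fun q : SpaceX × (Plane × SpaceX) =>
      ((q.2.1, q.1 + q.2.2, q.2.2) : SpaceR)) := by
    have e1 := Measure.measurePreserving_swap (μ := (volume : Measure SpaceX))
      (ν := (volume : Measure (Plane × SpaceX)))
    have e2 := (volume_preserving_prodAssoc (α₁ := Plane) (β₁ := SpaceX) (γ₁ := SpaceX))
    have e3 := (MeasurePreserving.id (volume : Measure Plane)).prod
      (Measure.measurePreserving_swap (μ := (volume : Measure SpaceX))
        (ν := (volume : Measure SpaceX)))
    exact e3.comp (e2.comp (h1.comp e1))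
  have h3 := h2.integrable_comp_of_integrable hg
  calc ∫ r, g r = ∫ q : SpaceX × (Plane × SpaceX), g (q.2.1, q.1 + q.2.2, q.2.2) := by
        rw [← h2.map_eq, integral_map h2.aemeasurable
          (by rw [h2.map_eq]; exact hg.aestronglyMeasurable)]
    _ = _ := integral_prod _ h3

/-- The substitution `ξ = ω(c - Y)`. -/
lemma integral_eq_integral_gap (g : Plane → ℂ) {ω : ℝ} (hω : ω ≠ 0) (c : Plane) :
    ∫ ξ, g ξ = (ω ^ 2 : ℝ) * ∫ Y, g (ω • (c - Y)) := by
  have h1 := Measure.integral_comp_smul (volume : Measure Plane) g ω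
  rw [integral_sub_left_eq_self (fun Y => g (ω • Y)), h1, finrank_euclideanSpace_fin,
    abs_of_nonneg (by positivity), Complex.real_smul, ← mul_assoc]
  norm_cast
  rw [mul_inv_cancel₀ (by positivity)]
  simp

instance instIsAddHaarMeasureAxis : (volume : Measure (Plane × SpaceR)).IsAddHaarMeasure :=
  instIsAddHaarMeasureVolumeProd (A := Plane) (B := SpaceR)

instance instHasTemperateGrowthAxis : (volume : Measure (Plane × SpaceR)).HasTemperateGrowth :=
  MeasureTheory.Measure.IsAddHaarMeasure.instHasTemperateGrowth

/-- Restriction to `σ = 0`, the curve of the scattered directions. -/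
def axisCLM : 𝓢(SpaceX × SpaceR, ℂ) →L[ℂ] 𝓢(Plane × SpaceR, ℂ) :=
  SchwartzMap.compCLM ℂ (g := fun q : Plane × SpaceR => (((0 : ℝ), q.1), q.2))
    (((ContinuousLinearMap.inr ℝ ℝ Plane ∘L ContinuousLinearMap.fst ℝ Plane SpaceR).prod
      (ContinuousLinearMap.snd ℝ Plane SpaceR)).hasTemperateGrowth)
    ⟨1, 1, fun q => by
      have h : ‖q‖ ≤ ‖(((0 : ℝ), q.1), q.2)‖ :=
        max_le ((le_max_right _ _).trans (le_max_left _ _)) (le_max_right _ _)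
      linarith⟩

/-- The Fourier transform along the curve of the scattered directions. -/
def axisFourier (f : 𝓢(SpaceX × SpaceR, ℂ)) (ξ : Plane) (r : SpaceR) : ℂ :=
  ∫ p, phase (inner ℝ ξ p) * f ((0, p), r)

lemma measurable_axisFourier (f : 𝓢(SpaceX × SpaceR, ℂ)) :
    Measurable fun q : Plane × SpaceR => axisFourier f q.1 q.2 := by
  have : StronglyMeasurable fun q : Plane × SpaceR =>
      ∫ p : Plane, phase (inner ℝ q.1 p) * f ((0, p), q.2) := by
    refine StronglyMeasurable.integral_prod_right
      (f := fun (q : Plane × SpaceR) (p : Plane) => phase (inner ℝ q.1 p) * f ((0, p), q.2)) ?_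
    refine Continuous.stronglyMeasurable ?_
    fun_prop
  exact this.measurable

lemma measurable_partialFourier_freqForm_left (f : 𝓢(SpaceX × SpaceR, ℂ)) (r : SpaceR) :
    Measurable fun n : SpaceX => partialFourier f (freqForm n) r :=
  Measurable.comp (g := fun q : SpaceX × SpaceR => partialFourier f (freqForm q.1) q.2)
    (f := fun n => (n, r)) (measurable_partialFourier_freqForm f) measurable_prodMk_right

lemma integrable_partialFourier_freq (f : 𝓢(SpaceX × SpaceR, ℂ)) (ξ : Plane) (r : SpaceR) :
    Integrable fun ν : ℝ => partialFourier f (freqForm (ν, ξ)) r := by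
  have hm : Measurable fun ν : ℝ => partialFourier f (freqForm (ν, ξ)) r :=
    Measurable.comp (g := fun n => partialFourier f (freqForm n) r) (f := fun ν => (ν, ξ))
      (measurable_partialFourier_freqForm_left f r) measurable_prodMk_right
  exact ((integrable_inv_one_add_sq.mul_const (planeDecay ξ)).mul_const (restWeight f r)).mono'
    hm.aestronglyMeasurable
    (Eventually.of_forall fun ν => norm_partialFourier_freqForm_le f (ν, ξ) r)

lemma integral_partialFourier_freq (f : 𝓢(SpaceX × SpaceR, ℂ)) (ξ : Plane) (r : SpaceR) :
    ∫ ν : ℝ, partialFourier f (freqForm (ν, ξ)) r =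
      (2 * Real.pi : ℝ) * axisFourier f ξ r :=
  integral_integral_phase_freqForm (sliceCLM r f) ξ (integrable_partialFourier_freq f ξ r)

/-- The decay in `ξ` of the partial Fourier transform survives the integration over `ν`. -/
lemma norm_axisFourier_le (f : 𝓢(SpaceX × SpaceR, ℂ)) (ξ : Plane) (r : SpaceR) :
    ‖axisFourier f ξ r‖ ≤ planeDecay ξ * restWeight f r := by
  have h1 : ‖∫ ν : ℝ, partialFourier f (freqForm (ν, ξ)) r‖ ≤
      ∫ ν : ℝ, (1 + ν ^ 2)⁻¹ * planeDecay ξ * restWeight f r :=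
    norm_integral_le_of_norm_le
      ((integrable_inv_one_add_sq.mul_const (planeDecay ξ)).mul_const (restWeight f r))
      (Eventually.of_forall fun ν => norm_partialFourier_freqForm_le f (ν, ξ) r)
  rw [integral_partialFourier_freq, integral_mul_const, integral_mul_const,
    integral_univ_inv_one_add_sq, norm_mul, Complex.norm_real, Real.norm_eq_abs,
    abs_of_pos (by positivity)] at h1
  have h2 : 0 ≤ planeDecay ξ * restWeight f r :=
    mul_nonneg (planeDecay_nonneg _) (restWeight_nonneg _ _)
  have h3 : Real.pi * (2 * ‖axisFourier f ξ r‖) ≤ Real.pi * (planeDecay ξ * restWeight f r) := by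
    linarith
  have h4 := le_of_mul_le_mul_left h3 Real.pi_pos
  linarith [norm_nonneg (axisFourier f ξ r)]

/-- Integration over the dual variables, for a fixed value of the remaining ones. -/
lemma integral_partialFourier_mul {k : Plane → ℂ} (hk : Continuous k) (hk1 : ∀ y, ‖k y‖ ≤ 1)
    (f : 𝓢(SpaceX × SpaceR, ℂ)) (r : SpaceR) {ω : ℝ} (hω : ω ≠ 0) (c : Plane) :
    ∫ n : SpaceX, partialFourier f (freqForm n) r * k (c - ω⁻¹ • n.2) =
      (2 * Real.pi * ω ^ 2 : ℝ) * ∫ Y, axisFourier f (ω • (c - Y)) r * k Y := by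
  have hm : Measurable fun n : SpaceX =>
      partialFourier f (freqForm n) r * k (c - ω⁻¹ • n.2) :=
    (measurable_partialFourier_freqForm_left f r).mul (by fun_prop : Continuous _).measurable
  have hi : Integrable fun n : SpaceX =>
      partialFourier f (freqForm n) r * k (c - ω⁻¹ • n.2) := by
    refine (integrable_freqDecay.mul_const (restWeight f r)).mono' hm.aestronglyMeasurable
      (Eventually.of_forall fun n => ?_)
    rw [norm_mul]
    exact (mul_le_of_le_one_right (norm_nonneg _) (hk1 _)).trans
      (norm_partialFourier_freqForm_le f n r)
  calc ∫ n : SpaceX, partialFourier f (freqForm n) r * k (c - ω⁻¹ • n.2)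
      = ∫ ξ : Plane, ∫ ν : ℝ, partialFourier f (freqForm (ν, ξ)) r * k (c - ω⁻¹ • ξ) :=
        integral_prod_symm _ hi
    _ = (2 * Real.pi : ℝ) * ∫ ξ : Plane, axisFourier f ξ r * k (c - ω⁻¹ • ξ) := by
        rw [← integral_const_mul]
        congr 1; ext ξ
        rw [integral_mul_const, integral_partialFourier_freq, mul_assoc]
    _ = _ := by
        rw [integral_eq_integral_gap _ hω c, ← mul_assoc, ← Complex.ofReal_mul]
        congr 1
        congr 1; ext Y
        rw [smul_smul, inv_mul_cancel₀ hω, one_smul, sub_sub_cancel]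

lemma integrable_axisFourier_gap {k : Plane → ℂ} (hk : Continuous k) (hk1 : ∀ y, ‖k y‖ ≤ 1)
    (f : 𝓢(SpaceX × SpaceR, ℂ)) {ω : ℝ} (hω : ω ≠ 0) :
    Integrable fun q : SpaceR × Plane =>
      axisFourier f (ω • (q.1.2.1.2 - q.1.2.2.2 - q.2)) q.1 * k q.2 := by
  have hc : Continuous fun q : SpaceR × Plane => ω • (q.1.2.1.2 - q.1.2.2.2 - q.2) := by
    fun_prop
  -- the majorant is a product up to the volume-preserving change of variable `Y ↦ ỹ₁ - ỹ₂ - Y`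
  have hb : Integrable fun q : SpaceR × Plane =>
      planeDecay (ω • (q.1.2.1.2 - q.1.2.2.2 - q.2)) * restWeight f q.1 := by
    have hmp : MeasurePreserving (fun q : SpaceR × Plane =>
        ((q.1, q.1.2.1.2 - q.1.2.2.2 - q.2) : SpaceR × Plane)) :=
      (MeasurePreserving.id (volume : Measure SpaceR)).skew_product
        (μc := (volume : Measure Plane)) (μd := (volume : Measure Plane))
        (g := fun r Y => r.2.1.2 - r.2.2.2 - Y) (by simp only [Function.uncurry_def]; fun_prop)
        (Eventually.of_forall fun r => (Measure.measurePreserving_sub_left volume _).map_eq)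
    have h1 : Integrable fun Y : Plane => planeDecay (ω • Y) :=
      (integrable_comp_smul_iff volume _ hω).2 integrable_planeDecay
    have h2 := hmp.integrable_comp_of_integrable ((integrable_restWeight f).mul_prod h1)
    refine h2.congr (Eventually.of_forall fun q => ?_)
    simp only [Function.comp]
    ring
  have hm : Measurable fun q : SpaceR × Plane =>
      axisFourier f (ω • (q.1.2.1.2 - q.1.2.2.2 - q.2)) q.1 * k q.2 := by
    refine Measurable.mul ?_ (hk.measurable.comp measurable_snd)
    exact Measurable.comp (g := fun q : Plane × SpaceR => axisFourier f q.1 q.2)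
      (f := fun q : SpaceR × Plane => (ω • (q.1.2.1.2 - q.1.2.2.2 - q.2), q.1))
      (measurable_axisFourier f) (hc.measurable.prodMk measurable_fst)
  refine hb.mono' hm.aestronglyMeasurable (Eventually.of_forall fun q => ?_)
  rw [norm_mul]
  exact (mul_le_of_le_one_right (norm_nonneg _) (hk1 _)).trans (norm_axisFourier_le f _ _)

/-- Integration over the remaining variables, for a fixed separation `Y`. -/
lemma integral_axisFourier_gap (f : 𝓢(SpaceX × SpaceR, ℂ)) (ω : ℝ) (Y : Plane) :
    ∫ r : SpaceR, axisFourier f (ω • (r.2.1.2 - r.2.2.2 - Y)) r *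
        phase (-(ω * (r.2.1.1 - r.2.2.1))) =
      ∫ p : Plane, phase (-(ω * inner ℝ p Y)) * ∫ b : SpaceX,
        phase (-(ω * (b.1 - inner ℝ p b.2))) *
          ∫ r : Plane × SpaceX, f ((0, p), (r.1, b + r.2, r.2)) := by
  let G : Plane → SpaceR → ℂ := fun p r =>
    phase (-(ω * ((r.2.1.1 - r.2.2.1) - inner ℝ p (r.2.1.2 - r.2.2.2)))) * f ((0, p), r)
  have hG : Integrable fun q : Plane × SpaceR => G q.1 q.2 := by
    refine Integrable.phase_mul (axisCLM f).integrable ?_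
    exact (by fun_prop : Continuous _).measurable.aemeasurable
  have hG2 : Integrable fun q : Plane × SpaceR => phase (-(ω * inner ℝ q.1 Y)) * G q.1 q.2 :=
    Integrable.phase_mul hG (by fun_prop : Continuous _).measurable.aemeasurable
  have e1 : ∀ r : SpaceR, axisFourier f (ω • (r.2.1.2 - r.2.2.2 - Y)) r *
      phase (-(ω * (r.2.1.1 - r.2.2.1))) = ∫ p, phase (-(ω * inner ℝ p Y)) * G p r := by
    intro r
    rw [axisFourier, ← integral_mul_const]
    congr 1; ext p
    simp only [G]
    rw [mul_right_comm, ← phase_add, ← mul_assoc, ← phase_add]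
    congr 2
    rw [inner_smul_left, inner_sub_left, real_inner_comm p Y, real_inner_comm p]
    simp only [conj_trivial]
    ring
  simp only [e1]
  rw [integral_integral_swap (f := fun r p => phase (-(ω * inner ℝ p Y)) * G p r) hG2.swap]
  refine integral_congr_ae ?_
  filter_upwards [hG.prod_right_ae] with p hp
  rw [integral_const_mul, integral_eq_integral_difference hp]
  congr 1; congr 1; ext b
  rw [← integral_const_mul]
  congr 1; ext r
  simp only [G]
  congr 3
  simp

/-- Integration over all the variables but the frequency and the position of the pulse. -/
lemma integral_integral_partialFourier_mul {k : Plane → ℂ} (hk : Continuous k)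
    (hk1 : ∀ y, ‖k y‖ ≤ 1) (f : 𝓢(SpaceX × SpaceR, ℂ)) {ω : ℝ} (hω : ω ≠ 0) :
    ∫ r : SpaceR, (∫ n : SpaceX, partialFourier f (freqForm n) r *
        k (r.2.1.2 - r.2.2.2 - ω⁻¹ • n.2)) * phase (-(ω * (r.2.1.1 - r.2.2.1))) =
      (2 * Real.pi * ω ^ 2 : ℝ) * ∫ Y, k Y * ∫ p : Plane, phase (-(ω * inner ℝ p Y)) *
        ∫ b : SpaceX, phase (-(ω * (b.1 - inner ℝ p b.2))) *
          ∫ r : Plane × SpaceX, f ((0, p), (r.1, b + r.2, r.2)) := by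
  simp only [integral_partialFourier_mul hk hk1 f _ hω, ← integral_axisFourier_gap]
  simp only [mul_assoc]
  rw [integral_const_mul]
  have hi : Integrable fun q : SpaceR × Plane => phase (-(ω * (q.1.2.1.1 - q.1.2.2.1))) *
      (axisFourier f (ω • (q.1.2.1.2 - q.1.2.2.2 - q.2)) q.1 * k q.2) :=
    Integrable.phase_mul (integrable_axisFourier_gap hk hk1 f hω)
      (by fun_prop : Continuous _).measurable.aemeasurable
  have e : ∀ r : SpaceR, (∫ Y, axisFourier f (ω • (r.2.1.2 - r.2.2.2 - Y)) r * k Y) *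
      phase (-(ω * (r.2.1.1 - r.2.2.1))) = ∫ Y, phase (-(ω * (r.2.1.1 - r.2.2.1))) *
      (axisFourier f (ω • (r.2.1.2 - r.2.2.2 - Y)) r * k Y) := by
    intro r
    rw [integral_const_mul, mul_comm]
  simp only [e]
  rw [integral_integral_swap (f := fun r Y => phase (-(ω * (r.2.1.1 - r.2.2.1))) *
      (axisFourier f (ω • (r.2.1.2 - r.2.2.2 - Y)) r * k Y)) hi]
  congr 1; congr 1; ext Y
  rw [← integral_const_mul]
  congr 1; ext r
  ring

end Speckle

namespace Speckle

section Random

variable {Ω : Type*} [MeasurableSpace Ω]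
variable {P : Measure Ω} [IsProbabilityMeasure P] {V : Ω → Plane → ℝ}
variable (hVm : ∀ x, Measurable fun w => V w x) (hVc : ∀ w, Continuous (V w))

namespace Medium

variable (M : Medium) {Ψ : SpaceX → ℝ} {a b κ : ℝ}
  (hs : ∀ ω k, profileHat Ψ ω k ≠ 0 → a ≤ |ω| ∧ |ω| ≤ b ∧ ‖k‖ ≤ κ)
  (hΨ : Integrable Ψ) (ha : 0 < a)

omit [IsProbabilityMeasure P] in
/-- At `η = 0` the two frequencies and the two positions coincide, and so do the two levers. -/
lemma dualIntegrand_zero (f : 𝓢(SpaceX × SpaceR, ℂ)) (q : SpaceX × SpaceR) (n : SpaceX) :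
    M.dualIntegrand P V Ψ f 0 q n = (((q.1.1⁻¹) ^ 2 * ‖M.amp Ψ q.1‖ ^ 2 : ℝ) : ℂ) *
      ((partialFourier f (freqForm n) q.2 *
        cohere P V (2 * M.s₀) q.1.1 q.1.1 (q.2.2.1.2 - q.2.2.2.2 - q.1.1⁻¹ • n.2)) *
        phase (-(q.1.1 * (q.2.2.1.1 - q.2.2.2.1)))) := by
  rcases eq_or_ne q.1.1 0 with h | h
  · simp [dualIntegrand, M.amp_eq_zero_of_freq_eq_zero h]
  have e1 : freqPartner 0 q n = q.1.1 := by simp [freqPartner]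
  have e2 : partner 0 q n = q.1 := by
    refine Prod.ext (by simp [partner, e1]) ?_
    simp only [partner, e1, lever]
    rw [zero_smul, zero_smul, zero_smul, sub_zero, smul_smul, inv_mul_cancel₀ h, one_smul]
    abel
  have e3 : gap 0 q n = q.2.2.1.2 - q.2.2.2.2 - q.1.1⁻¹ • n.2 := by
    simp [gap, e1, sub_eq_add_neg]
  have e4 : M.restPhase 0 q.2 q.1 q.1 = -(q.1.1 * (q.2.2.1.1 - q.2.2.2.1)) := by
    simp only [restPhase, lever, zero_smul]; ring
  have e5 : (((‖M.amp Ψ q.1‖ ^ 2 : ℝ)) : ℂ) = M.amp Ψ q.1 * (starRingEnd ℂ) (M.amp Ψ q.1) := by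
    rw [Complex.mul_conj, Complex.normSq_eq_norm_sq]
  rw [dualIntegrand, e2, e1, e3, e4, Complex.ofReal_mul, e5]
  ring

include hs hΨ ha in
lemma integral_norm_sq_amp {ω : ℝ} (hω : ω ≠ 0) :
    ∫ u, (ω⁻¹) ^ 2 * ‖M.amp Ψ (ω, u)‖ ^ 2 =
      (2 * Real.pi) ^ 2 / M.detOffset * profilePower Ψ ω := by
  have hd := M.detOffset_pos
  have e : ∀ u, (ω⁻¹) ^ 2 * ‖M.amp Ψ (ω, u)‖ ^ 2 =
      ω ^ 4 / ((2 * Real.pi) ^ 2 * M.detOffset) * ‖M.pulse Ψ ω u‖ ^ 2 := by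
    intro u
    rw [amp, norm_mul, norm_div, norm_mul, norm_mul, norm_mul, norm_pow]
    simp only [Complex.norm_real, Complex.norm_I, Complex.norm_ofNat, Real.norm_eq_abs]
    rw [abs_of_pos Real.pi_pos, abs_of_nonneg (Real.sqrt_nonneg _), mul_pow, div_pow, mul_one,
      mul_pow _ (Real.sqrt _), Real.sq_sqrt hd.le, ← pow_mul, ← abs_pow,
      show 3 * 2 = 6 from rfl, abs_of_nonneg (by positivity)]
    field_simp
  simp only [e]
  rw [integral_const_mul, M.integral_norm_sq_pulse hs hΨ ha hω]
  field_simp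

include hs hΨ ha hVm hVc in
/-- The limit is the pairing of `Φ` with the stated distribution. -/
lemma limitFunctional_eq (Φ : 𝓢(SpaceXX × SpaceX × SpaceX, ℂ)) :
    M.limitFunctional P V Ψ Φ = limitCorrPairing M Ψ P V (differenceAverage Φ) := by
  set f := M.straightenCLM Φ with hf
  have hI := M.integrable_dualIntegrand (P := P) hVm hVc hs hΨ ha f 0
  have hI2 : Integrable fun q : SpaceX × SpaceR => ∫ n, M.dualIntegrand P V Ψ f 0 q n :=
    hI.integral_prod_left
  -- the integral over all the variables but `(ω, u)` depends on `ω` only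
  let Z : ℝ → ℂ := fun ω => ∫ r : SpaceR, (∫ n : SpaceX, partialFourier f (freqForm n) r *
    cohere P V (2 * M.s₀) ω ω (r.2.1.2 - r.2.2.2 - ω⁻¹ • n.2)) *
      phase (-(ω * (r.2.1.1 - r.2.2.1)))
  have e1 : ∀ z : SpaceX, ∫ r, ∫ n, M.dualIntegrand P V Ψ f 0 (z, r) n =
      (((z.1⁻¹) ^ 2 * ‖M.amp Ψ z‖ ^ 2 : ℝ) : ℂ) * Z z.1 := by
    intro z
    simp only [dualIntegrand_zero, Z]
    rw [← integral_const_mul]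
    congr 1; ext r
    rw [integral_const_mul, integral_mul_const]
  have hI3 : Integrable fun z : SpaceX => (((z.1⁻¹) ^ 2 * ‖M.amp Ψ z‖ ^ 2 : ℝ) : ℂ) * Z z.1 := by
    simp only [← e1]
    exact hI2.integral_prod_left
  have e2 : ∫ q : (SpaceX × SpaceR) × SpaceX, M.dualIntegrand P V Ψ f 0 q.1 q.2 =
      ∫ ω : ℝ, ∫ u : Plane, ((((ω⁻¹) ^ 2 * ‖M.amp Ψ (ω, u)‖ ^ 2 : ℝ)) : ℂ) * Z ω := by
    calc _ = ∫ q : SpaceX × SpaceR, ∫ n, M.dualIntegrand P V Ψ f 0 q n := integral_prod _ hI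
      _ = ∫ z : SpaceX, ∫ r, ∫ n, M.dualIntegrand P V Ψ f 0 (z, r) n := integral_prod _ hI2
      _ = ∫ z : SpaceX, (((z.1⁻¹) ^ 2 * ‖M.amp Ψ z‖ ^ 2 : ℝ) : ℂ) * Z z.1 := by simp only [e1]
      _ = _ := integral_prod _ hI3
  have e3 : ∀ ω : ℝ, ω ≠ 0 → ∫ u : Plane, ((((ω⁻¹) ^ 2 * ‖M.amp Ψ (ω, u)‖ ^ 2 : ℝ)) : ℂ) * Z ω =
      ((2 * Real.pi) ^ 3 / M.detOffset : ℝ) * (((profilePower Ψ ω * ω ^ 2 : ℝ) : ℂ) *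
        scatteringPairing P V (2 * M.s₀) ω fun p =>
          ∫ b : SpaceX, phase (-(ω * (b.1 - inner ℝ p b.2))) *
            differenceAverage Φ (M.speckleDelay p, M.speckleOffset p) b) := by
    intro ω hω
    have hk : Continuous fun y => cohere P V (2 * M.s₀) ω ω y :=
      (continuous_cohere hVm hVc (2 * M.s₀)).comp
        (by fun_prop : Continuous fun y : Plane => (ω, ω, y))
    have hZ : Z ω = (2 * Real.pi * ω ^ 2 : ℝ) * scatteringPairing P V (2 * M.s₀) ω fun p =>
          ∫ b : SpaceX, phase (-(ω * (b.1 - inner ℝ p b.2))) *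
            differenceAverage Φ (M.speckleDelay p, M.speckleOffset p) b := by
      refine (integral_integral_partialFourier_mul hk (fun y => norm_cohere_le _ _ _ _) f
        hω).trans ?_
      rw [scatteringPairing]
      congr 1; congr 1; ext Y
      congr 1
      · rw [cohere]
        congr 1; ext w
        congr 1; ring
      · congr 1; ext p; congr 1; congr 1; ext b; congr 1
        simp [differenceAverage, hf, straightenCLM_apply, straighten]
    rw [integral_mul_const, integral_complex_ofReal, M.integral_norm_sq_amp hs hΨ ha hω, hZ,
      ← mul_assoc, ← mul_assoc, ← Complex.ofReal_mul, ← Complex.ofReal_mul]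
    congr 2
    ring
  have e4 : ∫ ω : ℝ, ∫ u : Plane, ((((ω⁻¹) ^ 2 * ‖M.amp Ψ (ω, u)‖ ^ 2 : ℝ)) : ℂ) * Z ω =
      ∫ ω : ℝ, ((2 * Real.pi) ^ 3 / M.detOffset : ℝ) * (((profilePower Ψ ω * ω ^ 2 : ℝ) : ℂ) *
        scatteringPairing P V (2 * M.s₀) ω fun p =>
          ∫ b : SpaceX, phase (-(ω * (b.1 - inner ℝ p b.2))) *
            differenceAverage Φ (M.speckleDelay p, M.speckleOffset p) b) := by
    refine integral_congr_ae ?_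
    filter_upwards [Measure.ae_ne volume (0 : ℝ)] with ω hω
    exact e3 ω hω
  rw [limitFunctional, e2, e4, integral_const_mul, limitCorrPairing, ← mul_assoc,
    ← Complex.ofReal_mul]
  congr 2
  have hd := M.detOffset_pos.ne'
  rw [prefactor]
  field_simp
  norm_num

omit [IsProbabilityMeasure P] in
lemma limitCorrPairing_eq_zero (Φ : SpaceXX × SpaceX × SpaceX → ℂ)
    (h : ∀ p y b₁ b₂, Φ ((M.speckleDelay p, M.speckleOffset p, y), b₁, b₂) = 0) :
    limitCorrPairing M Ψ P V (differenceAverage Φ) = 0 := by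
  simp [limitCorrPairing, scatteringPairing, differenceAverage, h]

/-! ### The mean correlation and its limit as tempered distributions -/

include hs hΨ ha hVm hVc in
lemma integrable_integral_corr_mul (hV : IsStationary P V) {ε : ℝ} (hε : 0 < ε) (γ : ℝ)
    (Φ : 𝓢(SpaceXX × SpaceX × SpaceX, ℂ)) :
    Integrable fun m => (∫ w, M.corr Ψ ε γ (V w) m ∂P) * Φ m := by
  obtain ⟨C, hC⟩ := M.exists_norm_integral_corr_le (P := P) hVm hVc hs hΨ ha hV hε γ
  exact Φ.integrable.bdd_mul
    (M.continuous_integral_corr hVm hVc hs hΨ ha hV hε γ).aestronglyMeasurable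
    (Eventually.of_forall hC)

include hs hΨ ha hVm hVc in
/-- The limit is linear, as a pointwise limit of linear functionals, and it is continuous because
it is controlled by an `L¹` norm of derivatives of the test function. Any exponent serves in the
proof, since the limit does not depend on `γ`. -/
lemma exists_limitDistribution (hV : IsStationary P V) :
    ∃ C : 𝓢'(SpaceXX × SpaceX × SpaceX, ℂ), ∀ Φ, C Φ = M.limitFunctional P V Ψ Φ := by
  have ht := fun Φ => M.tendsto_integral_corr_mul (P := P) hVm hVc hs hΨ ha hV
    (γ := 1) (by norm_num) Φ
  have hint := fun (ε : ℝ) (hε : 0 < ε) Φ =>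
    M.integrable_integral_corr_mul (P := P) hVm hVc hs hΨ ha hV hε 1 Φ
  have hadd : ∀ Φ₁ Φ₂, M.limitFunctional P V Ψ (Φ₁ + Φ₂) =
      M.limitFunctional P V Ψ Φ₁ + M.limitFunctional P V Ψ Φ₂ := by
    intro Φ₁ Φ₂
    refine tendsto_nhds_unique (ht _) (((ht Φ₁).add (ht Φ₂)).congr' ?_)
    filter_upwards [self_mem_nhdsWithin] with ε hε
    rw [← integral_add (hint ε hε _) (hint ε hε _)]
    congr 1; ext m
    rw [_root_.add_apply, mul_add]
  have hsmul : ∀ (c : ℂ) Φ, M.limitFunctional P V Ψ (c • Φ) =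
      c * M.limitFunctional P V Ψ Φ := by
    intro c Φ
    refine tendsto_nhds_unique (ht _) (((ht Φ).const_mul c).congr fun ε => ?_)
    rw [← integral_const_mul]
    congr 1; ext m
    rw [_root_.smul_apply, smul_eq_mul]; ring
  let L : 𝓢(SpaceXX × SpaceX × SpaceX, ℂ) →ₗ[ℂ] ℂ :=
    { toFun := M.limitFunctional P V Ψ
      map_add' := hadd
      map_smul' := hsmul }
  have hL : Continuous L := by
    obtain ⟨C, hC0, hC⟩ := M.exists_norm_limitFunctional_le (P := P) (V := V) hs hΨ ha
    let T := SchwartzMap.toLpCLM ℂ ℂ 1 (volume : Measure (SpaceX × SpaceR)) ∘L decayCLM ∘L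
      M.straightenCLM
    have hT : ∀ Φ, ‖T Φ‖ = ∫ x, ‖decayCLM (M.straightenCLM Φ) x‖ := by
      intro Φ
      rw [L1.norm_eq_integral_norm]
      refine integral_congr_ae ?_
      filter_upwards [(decayCLM (M.straightenCLM Φ)).coeFn_toLp 1
        (volume : Measure (SpaceX × SpaceR))] with x hx
      exact congrArg norm hx
    refine continuous_of_continuousAt_zero L ?_
    rw [ContinuousAt, map_zero]
    refine squeeze_zero_norm (a := fun Φ => C * ‖T Φ‖) (fun Φ => ?_) ?_
    · rw [hT]; exact hC Φ
    · have : Continuous fun Φ => C * ‖T Φ‖ := by fun_prop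
      simpa using this.tendsto 0
  exact ⟨⟨L, hL⟩, fun Φ => rfl⟩

include hs hΨ ha hVm hVc in
lemma exists_corrDistribution (hV : IsStationary P V) {ε : ℝ} (hε : 0 < ε) (γ : ℝ) :
    ∃ C : 𝓢'(SpaceXX × SpaceX × SpaceX, ℂ), ∀ Φ,
      C Φ = ∫ m, (∫ w, M.corr Ψ ε γ (V w) m ∂P) * Φ m := by
  obtain ⟨C, hC⟩ := M.exists_norm_integral_corr_le (P := P) hVm hVc hs hΨ ha hV hε γ
  have hm : MemLp (fun m => ∫ w, M.corr Ψ ε γ (V w) m ∂P) ⊤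
      (volume : Measure (SpaceXX × SpaceX × SpaceX)) :=
    memLp_top_of_bound
      (M.continuous_integral_corr hVm hVc hs hΨ ha hV hε γ).aestronglyMeasurable C
      (Eventually.of_forall hC)
  refine ⟨Lp.toTemperedDistribution (hm.toLp _), fun Φ => ?_⟩
  rw [Lp.toTemperedDistribution_apply]
  refine integral_congr_ae ?_
  filter_upwards [hm.coeFn_toLp] with m hm'
  rw [hm', smul_eq_mul, mul_comm]

end Medium
end Random
end Speckle

namespace Speckle

/-! ### The generalized Snell law of reflection -/

namespace Medium

variable (M : Medium)

lemma inv_c₀_sq : (M.c₀ ^ 2)⁻¹ = M.s₀ ^ 2 + ‖M.k₀‖ ^ 2 := by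
  have hc := M.c₀_pos
  rw [M.s₀_sq]
  field_simp
  ring

lemma one_sub_sq_eq : 1 - M.c₀ ^ 2 * ‖M.k₀‖ ^ 2 = (M.c₀ * M.s₀) ^ 2 := by
  have hc := M.c₀_pos
  rw [mul_pow, M.s₀_sq]
  field_simp

lemma A₀coef_eq : M.A₀coef = ((M.c₀ * M.s₀) ^ 3)⁻¹ := by
  have h : 0 ≤ M.c₀ * M.s₀ := (mul_pos M.c₀_pos M.s₀_pos).le
  rw [A₀coef, one_sub_sq_eq, ← Real.rpow_natCast, ← Real.rpow_natCast, ← Real.rpow_mul h, one_div]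
  norm_num

lemma tan_incidenceAngle : Real.tan M.incidenceAngle = ‖M.k₀‖ / M.s₀ := Real.tan_arctan _

lemma sqrt_one_add_div_s₀ : Real.sqrt (1 + (‖M.k₀‖ / M.s₀) ^ 2) = (M.c₀ * M.s₀)⁻¹ := by
  have hc := M.c₀_pos
  have hs := M.s₀_pos
  have e : 1 + (‖M.k₀‖ / M.s₀) ^ 2 = ((M.c₀ * M.s₀)⁻¹) ^ 2 := by
    have h : ((M.c₀ * M.s₀)⁻¹) ^ 2 = (M.c₀ ^ 2)⁻¹ * (M.s₀ ^ 2)⁻¹ := by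
      rw [inv_pow, mul_pow, mul_inv]
    rw [h, M.inv_c₀_sq]
    field_simp
  rw [e, Real.sqrt_sq (by positivity)]

lemma sin_incidenceAngle : Real.sin M.incidenceAngle = M.c₀ * ‖M.k₀‖ := by
  have hs := M.s₀_pos.ne'
  rw [incidenceAngle, Real.sin_arctan, sqrt_one_add_div_s₀]
  field_simp

lemma cos_incidenceAngle : Real.cos M.incidenceAngle = M.c₀ * M.s₀ := by
  rw [incidenceAngle, Real.cos_arctan, sqrt_one_add_div_s₀, one_div, inv_inv]

/-- The horizontal displacement per unit height along the reflected ray. -/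
def raySlope (ε γ : ℝ) (p : Plane) : Plane :=
  M.s₀⁻¹ • M.k₀ + (ε ^ (1 - γ) * M.c₀) • M.applyA₀ p

lemma reflectionAngle_eq (ε γ : ℝ) (p : Plane) :
    M.reflectionAngle ε γ p = Real.arctan ‖M.raySlope ε γ p‖ := by
  have hz := M.zint_pos
  have e : M.obsPoint ε γ (M.speckleOffset p) 0 - M.xInt = M.zint • M.raySlope ε γ p := by
    rw [obsPoint, raySlope, speckleOffset, xObs, xInt]
    match_scalars <;> ring
  rw [reflectionAngle, e, norm_smul, Real.norm_of_nonneg hz.le, mul_div_cancel_left₀ _ hz.ne']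

/-- The slope is `|k₀| / s₀` times the vector with components the two terms of `snellXi`, along `k₀`
and its rotation `k₀^⊥`. -/
lemma norm_sq_raySlope (hk : M.k₀ ≠ 0) (ε γ : ℝ) (p : Plane) :
    ‖M.raySlope ε γ p‖ ^ 2 = (‖M.k₀‖ / M.s₀) ^ 2 * M.snellXi ε γ p := by
  have hs := M.s₀_pos
  have hc := M.c₀_pos
  have hk' := norm_pos_iff.2 hk
  have hN : M.k₀ 0 ^ 2 + M.k₀ 1 ^ 2 = ‖M.k₀‖ ^ 2 := M.norm_k₀_sq.symm
  have hκ := M.one_sub_sq_eq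
  set e := ε ^ (1 - γ)
  have e0 : M.raySlope ε γ p 0 = M.s₀⁻¹ * M.k₀ 0 + e * M.c₀ * M.applyA₀ p 0 := by
    simp [raySlope, e]
  have e1 : M.raySlope ε γ p 1 = M.s₀⁻¹ * M.k₀ 1 + e * M.c₀ * M.applyA₀ p 1 := by
    simp [raySlope, e]
  -- the components of the slope along `k₀` and along `k₀^⊥`
  have c1 : M.k₀ 0 * M.raySlope ε γ p 0 + M.k₀ 1 * M.raySlope ε γ p 1 =
      ‖M.k₀‖ ^ 2 / M.s₀ * (1 + e / ‖M.k₀‖ ^ 2 *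
        ((p 0 * M.k₀ 0 + p 1 * M.k₀ 1) / (M.c₀ * M.s₀) ^ 2)) := by
    rw [e0, e1, applyA₀_zero, applyA₀_one, A₀coef_eq, ← hN]
    have : M.k₀ 0 ^ 2 + M.k₀ 1 ^ 2 ≠ 0 := by rw [hN]; positivity
    field_simp
    ring
  have c2 : -M.k₀ 1 * M.raySlope ε γ p 0 + M.k₀ 0 * M.raySlope ε γ p 1 =
      ‖M.k₀‖ ^ 2 / M.s₀ * (e / ‖M.k₀‖ ^ 2 * (p 0 * -M.k₀ 1 + p 1 * M.k₀ 0)) := by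
    have h : -M.k₀ 1 * M.applyA₀ p 0 + M.k₀ 0 * M.applyA₀ p 1 =
        M.A₀coef * (1 - M.c₀ ^ 2 * ‖M.k₀‖ ^ 2) * (p 0 * -M.k₀ 1 + p 1 * M.k₀ 0) := by
      rw [applyA₀_zero, applyA₀_one, ← hN]; ring
    have h2 : -M.k₀ 1 * M.raySlope ε γ p 0 + M.k₀ 0 * M.raySlope ε γ p 1 =
        e * M.c₀ * (-M.k₀ 1 * M.applyA₀ p 0 + M.k₀ 0 * M.applyA₀ p 1) := by
      rw [e0, e1]; ring
    rw [h2, h, A₀coef_eq, hκ]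
    field_simp
  have hpyth : ‖M.k₀‖ ^ 2 * ‖M.raySlope ε γ p‖ ^ 2 =
      (M.k₀ 0 * M.raySlope ε γ p 0 + M.k₀ 1 * M.raySlope ε γ p 1) ^ 2 +
      (-M.k₀ 1 * M.raySlope ε γ p 0 + M.k₀ 0 * M.raySlope ε γ p 1) ^ 2 := by
    rw [← hN, EuclideanSpace.norm_sq_eq (M.raySlope ε γ p), Fin.sum_univ_two,
      Real.norm_eq_abs, Real.norm_eq_abs, sq_abs, sq_abs]
    ring
  have hXi : M.snellXi ε γ p = (1 + e / ‖M.k₀‖ ^ 2 *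
      ((p 0 * M.k₀ 0 + p 1 * M.k₀ 1) / (M.c₀ * M.s₀) ^ 2)) ^ 2 +
      (e / ‖M.k₀‖ ^ 2 * (p 0 * -M.k₀ 1 + p 1 * M.k₀ 0)) ^ 2 := by
    have hξ : e * M.c₀ ^ 2 / (M.c₀ * ‖M.k₀‖) ^ 2 = e / ‖M.k₀‖ ^ 2 := by field_simp
    simp only [snellXi, sin_incidenceAngle, cos_incidenceAngle, inner_plane]
    rw [hξ]
    simp
    ring
  have hk2 : ‖M.k₀‖ ^ 2 ≠ 0 := by positivity
  apply mul_left_cancel₀ hk2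
  rw [hpyth, c1, c2, hXi]
  ring

lemma snellXi_nonneg (ε γ : ℝ) (p : Plane) : 0 ≤ M.snellXi ε γ p := by
  unfold snellXi; positivity

lemma norm_raySlope (hk : M.k₀ ≠ 0) (ε γ : ℝ) (p : Plane) :
    ‖M.raySlope ε γ p‖ = ‖M.k₀‖ / M.s₀ * Real.sqrt (M.snellXi ε γ p) := by
  have hs := M.s₀_pos
  rw [← Real.sqrt_sq (norm_nonneg (M.raySlope ε γ p)), M.norm_sq_raySlope hk,
    Real.sqrt_mul (by positivity), Real.sqrt_sq (by positivity)]

lemma tan_reflectionAngle (hk : M.k₀ ≠ 0) (ε γ : ℝ) (p : Plane) :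
    Real.tan (M.reflectionAngle ε γ p) / Real.tan M.incidenceAngle =
      Real.sqrt (M.snellXi ε γ p) := by
  have hs := M.s₀_pos
  have hk' := norm_pos_iff.2 hk
  rw [reflectionAngle_eq, Real.tan_arctan, tan_incidenceAngle, M.norm_raySlope hk]
  field_simp

lemma sin_reflectionAngle (hk : M.k₀ ≠ 0) (ε γ : ℝ) (p : Plane) :
    Real.sin (M.reflectionAngle ε γ p) / M.c₀ = Real.sin M.incidenceAngle / M.c₀ +
      ‖M.k₀‖ * (Real.sqrt (M.snellXi ε γ p /
        (1 + Real.sin M.incidenceAngle ^ 2 * (M.snellXi ε γ p - 1))) - 1) := by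
  have hs := M.s₀_pos
  have hc := M.c₀_pos
  have hX := M.snellXi_nonneg ε γ p
  have e1 := M.norm_sq_raySlope hk ε γ p
  have e2 := M.norm_raySlope hk ε γ p
  set X := M.snellXi ε γ p
  have h1 : 1 + M.c₀ ^ 2 * ‖M.k₀‖ ^ 2 * (X - 1) =
      M.c₀ ^ 2 * M.s₀ ^ 2 * (1 + (‖M.k₀‖ / M.s₀) ^ 2 * X) := by
    have h : M.c₀ ^ 2 * (M.s₀ ^ 2 + ‖M.k₀‖ ^ 2) = 1 := by
      rw [← M.inv_c₀_sq]; field_simp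
    have h2 : M.s₀ ^ 2 * (‖M.k₀‖ / M.s₀) ^ 2 = ‖M.k₀‖ ^ 2 := by field_simp
    linear_combination (-1 : ℝ) * h - M.c₀ ^ 2 * X * h2
  have h3 : Real.sqrt (M.c₀ ^ 2 * M.s₀ ^ 2) = M.c₀ * M.s₀ := by
    rw [← mul_pow, Real.sqrt_sq (by positivity)]
  have h4 : 0 < Real.sqrt (1 + (‖M.k₀‖ / M.s₀) ^ 2 * X) := Real.sqrt_pos.2 (by positivity)
  rw [reflectionAngle_eq, Real.sin_arctan, sin_incidenceAngle, mul_pow, h1, e1, e2,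
    Real.sqrt_div hX, Real.sqrt_mul (by positivity), h3]
  generalize Real.sqrt (1 + (‖M.k₀‖ / M.s₀) ^ 2 * X) = t at h4 ⊢
  field_simp
  ring

lemma reflectionAngle_of_k₀_eq_zero (hk : M.k₀ = 0) {ε : ℝ} (hε : 0 < ε) (γ : ℝ) (p : Plane) :
    M.reflectionAngle ε γ p = Real.arctan (ε ^ (1 - γ) * M.c₀ * ‖p‖) := by
  have hA : M.applyA₀ p = p := by
    ext i
    fin_cases i <;> simp [applyA₀_zero, applyA₀_one, A₀coef, hk]
  have h : 0 ≤ ε ^ (1 - γ) * M.c₀ := mul_nonneg (Real.rpow_nonneg hε.le _) M.c₀_pos.le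
  rw [reflectionAngle_eq, raySlope, hA, hk, smul_zero, zero_add, norm_smul, Real.norm_of_nonneg h]

end Medium
end Speckle

end

theorem mainTheorem2 {Ω : Type*} [MeasurableSpace Ω] (P : Measure Ω) [IsProbabilityMeasure P]
    (V : Ω → Speckle.Plane → ℝ) (hVmeas : ∀ x, Measurable fun w => V w x)
    (hVcont : ∀ w, Continuous (V w)) (hVstat : Speckle.IsStationary P V)
    (M : Speckle.Medium) (Ψ : Speckle.SpaceX → ℝ) (hΨint : Integrable Ψ)
    (hΨsupp : ∃ a b κ : ℝ, 0 < a ∧ ∀ ω k, Speckle.profileHat Ψ ω k ≠ 0 →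
      a ≤ |ω| ∧ |ω| ≤ b ∧ ‖k‖ ≤ κ)
    (γ : ℝ) (hγ : γ ∈ Set.Ioc (1 / 2 : ℝ) 1) :
    -- the reflected field is well defined
    (∀ ε : ℝ, 0 < ε → ∀ w x ω,
      Tendsto (fun δ : ℝ => ∫ q, (Real.exp (-δ * ‖q‖ ^ 2) : ℂ) *
          M.reflIntegrand Ψ ε γ (V w) x ω q) (𝓝[>] 0)
        (𝓝 (Speckle.oscillatoryIntegral (M.reflIntegrand Ψ ε γ (V w) x ω)))) ∧
    (∀ ε : ℝ, 0 < ε → ∀ w t x, Integrable (M.reflFreqIntegrand Ψ ε γ (V w) t x)) ∧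
    (∀ ε : ℝ, 0 < ε → ∀ m, Integrable (fun w => M.corr Ψ ε γ (V w) m) P) ∧
    -- the two expressions of the power spectrum of the source agree
    (∀ ω : ℝ, Speckle.profilePower Ψ ω =
      ∫ x : Speckle.Plane, ‖∫ s : ℝ, Speckle.phase (ω * s) * (Ψ (s, x) : ℂ)‖ ^ 2) ∧
    -- convergence of the mean correlation function in the space of tempered distributions
    (∃ (Cε : ℝ → 𝓢'(Speckle.SpaceXX × Speckle.SpaceX × Speckle.SpaceX, ℂ))
        (C : 𝓢'(Speckle.SpaceXX × Speckle.SpaceX × Speckle.SpaceX, ℂ)),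
      (∀ ε : ℝ, 0 < ε → ∀ Φ : 𝓢(Speckle.SpaceXX × Speckle.SpaceX × Speckle.SpaceX, ℂ),
        Integrable (fun m => (∫ w, M.corr Ψ ε γ (V w) m ∂P) * Φ m) ∧
        Cε ε Φ = ∫ m, (∫ w, M.corr Ψ ε γ (V w) m ∂P) * Φ m) ∧
      (∀ Φ : 𝓢(Speckle.SpaceXX × Speckle.SpaceX × Speckle.SpaceX, ℂ),
        C Φ = Speckle.limitCorrPairing M Ψ P V (Speckle.differenceAverage Φ)) ∧
      Tendsto Cε (𝓝[>] 0) (𝓝 C) ∧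
      -- the limit lives at the offsets and time lags of the scattered directions
      (∀ Φ : 𝓢(Speckle.SpaceXX × Speckle.SpaceX × Speckle.SpaceX, ℂ),
        (∀ p y b₁ b₂, Φ ((M.speckleDelay p, M.speckleOffset p, y), b₁, b₂) = 0) → C Φ = 0)) ∧
    -- the generalized Snell law of reflection
    Real.sin M.incidenceAngle = M.c₀ * ‖M.k₀‖ ∧
    (∀ ε : ℝ, 0 < ε → ∀ p : Speckle.Plane,
      (M.k₀ ≠ 0 →
        Real.tan (M.reflectionAngle ε γ p) / Real.tan M.incidenceAngle =
          Real.sqrt (M.snellXi ε γ p) ∧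
        Real.sin (M.reflectionAngle ε γ p) / M.c₀ = Real.sin M.incidenceAngle / M.c₀ +
          ‖M.k₀‖ * (Real.sqrt (M.snellXi ε γ p /
            (1 + Real.sin M.incidenceAngle ^ 2 * (M.snellXi ε γ p - 1))) - 1)) ∧
      (M.k₀ = 0 → M.reflectionAngle ε γ p = Real.arctan (ε ^ (1 - γ) * M.c₀ * ‖p‖))) := by
  obtain ⟨a, b, κ, ha, hs⟩ := hΨsupp
  refine ⟨fun ε hε w x ω => ?_,
    fun ε hε w t x => M.integrable_reflFreqIntegrand hs hΨint ha hε γ (hVcont w) t x,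
    fun ε hε m => M.integrable_corr hVmeas hVcont hs hΨint ha hε γ m,
    Speckle.profilePower_eq hs hΨint ha, ?_, M.sin_incidenceAngle,
    fun ε hε p => ⟨fun hk => ⟨M.tan_reflectionAngle hk ε γ p, M.sin_reflectionAngle hk ε γ p⟩,
      fun hk => M.reflectionAngle_of_k₀_eq_zero hk hε γ p⟩⟩
  · have h := M.tendsto_reg_reflIntegrand hs hΨint ha hε γ (hVcont w) x ω
    rw [Speckle.oscillatoryIntegral, h.limUnder_eq]
    exact h
  · obtain ⟨C, hC⟩ := M.exists_limitDistribution hVmeas hVcont hs hΨint ha hVstat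
    choose Cε hCε using fun ε : {ε : ℝ // 0 < ε} =>
      M.exists_corrDistribution hVmeas hVcont hs hΨint ha hVstat ε.2 γ
    have hCε' : ∀ ε (hε : 0 < ε), (if h : 0 < ε then Cε ⟨ε, h⟩ else 0) = Cε ⟨ε, hε⟩ :=
      fun ε hε => dif_pos hε
    refine ⟨fun ε => if h : 0 < ε then Cε ⟨ε, h⟩ else 0, C, fun ε hε Φ =>
      ⟨M.integrable_integral_corr_mul hVmeas hVcont hs hΨint ha hVstat hε γ Φ, ?_⟩,
      fun Φ => ?_, ?_, fun Φ hΦ => ?_⟩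
    · simp only [hCε' ε hε, hCε]
    · rw [hC, M.limitFunctional_eq hVmeas hVcont hs hΨint ha]
    · rw [PointwiseConvergenceCLM.tendsto_iff_forall_tendsto]
      intro Φ
      rw [hC]
      refine (M.tendsto_integral_corr_mul hVmeas hVcont hs hΨint ha hVstat hγ.1 Φ).congr' ?_
      filter_upwards [self_mem_nhdsWithin] with ε hε
      simp only [hCε' ε hε, hCε]
    · rw [hC, M.limitFunctional_eq hVmeas hVcont hs hΨint ha]
      exact M.limitCorrPairing_eq_zero Φ hΦ
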